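/- Throughout, an algorithm is a randomized algorithm for a random-access machine (integer registers and arrays, addition, truncated subtraction, indirect addressing and fair coin tosses, each at unit cost), graphs are given by their adjacency matrix, and the running time of an algorithm on an input is its expected number of steps over its coin tosses. For $n,\kappa\in\mathbb N$ with $\kappa\le n$, let $\mathcal G(n,\tfrac12)$ be the Erdős–Rényi distribution on graphs with $n$ vertices in which every edge is present independently with probability $\tfrac12$, and let $\mathcal G(n,\tfrac12,\kappa)$ be the distribution of the graph obtained from $G\sim\mathcal G(n,\tfrac12)$ by adding all edges inside an independent, uniformly random set of $\kappa$ vertices. The Strongish Planted Clique Hypothesis (SPCH) states: there is a constant $\delta\in(0,\tfrac12)$ such that there is no algorithm $\mathcal B$ that, for all sufficiently large $n$, runs in time $n^{o(\log n)}$ on every $n$-vertex graph and satisfies both $$\Pr_{G\sim\mathcal G(n,\frac12,\lceil n^\delta\rceil)}[\mathcal B(G)=1]\ge \tfrac23 \qquad\text{and}\qquad \Pr_{G\sim\mathcal G(n,\frac12)}[\mathcal B(G)=1]\le \tfrac13,$$ the probabilities being over $G$ and the coin tosses of $\mathcal B$. In the Smallest $k$-Edge Subgraph problem, the input is an undirected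 graph $G$ with $n$ vertices and a positive integer $k$ such that $G$ has at least $k$ edges, and the goal is to find a set $S$ of vertices, of smallest size $\mathrm{OPT}(G,k)$, that induces at least $k$ edges of $G$. The perfect completeness case consists of those inputs for which $k=\binom{\kappa}{2}$ for some $\kappa\in\mathbb N$ and $G$ contains a clique of size $\kappa$. An algorithm approximates the problem (or its perfect completeness case) within a factor $g(k)$ if on every input (respectively, every input of the perfect completeness case) it outputs, with probability at least $\tfrac23$, a set $S$ of vertices that induces at least $k$ edges and satisfies $|S|\le g(k)\cdot \mathrm{OPT}(G,k)$. **Corollary.** Assume SPCH. Let $g:\mathbb N\to\mathbb R$ be any function with $g(k)=o(\sqrt k)$, let $f:\mathbb N\to\mathbb N$ be any function, and let $q$ be any polynomial with coefficients in $\mathbb N$. Then no algorithm with running time at most $f(k)\cdot q(n)$ approximates Smallest $k$-Edge Subgraph within a factor $g(k)$. Furthermore, no algorithm whose running time is at most $f(k)\cdot q(n)$ on the inputs of the perfect completeness case approximates the perfect completeness case within a factor $g(k)$. -/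

import Mathlib

open MeasureTheory ProbabilityTheory Filter Asymptotics
open scoped ENNReal

/-! ### Randomized random-access machines

Structured (while-)programs for a random-access machine. The memory consists of arrays of natural
numbers, named by natural numbers; a program mentions finitely many names, while the indices into an
array are computed at run time. The arithmetic is addition and truncated subtraction, at unit cost
(no multiplication, so that the number of bits of a number grows by at most a constant per step). -/

namespace RAM

/-- Expressions: constants, the entry `a[i]` of an array, sums and truncated differences. -/
inductive Expr where
  | const (c : ℕ)
  | read (a : ℕ) (i : Expr)
  | add (e₁ e₂ : Expr)
  | sub (e₁ e₂ : Expr)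

/-- Programs. -/
inductive Prog where
  /-- do nothing -/
  | skip
  /-- `a[i] := e` -/
  | assign (a : ℕ) (i e : Expr)
  /-- `a[i] := ` a fresh fair random bit -/
  | coin (a : ℕ) (i : Expr)
  /-- make `a` a fresh array, all of whose entries are zero -/
  | clear (a : ℕ)
  /-- sequential composition -/
  | seq (p q : Prog)
  /-- if `e ≠ 0` then `p` else `q` -/
  | ite (e : Expr) (p q : Prog)
  /-- while `e ≠ 0` do `p` -/
  | loop (e : Expr) (p : Prog)

/-- A state: the memory (`mem a i` is the entry `a[i]`) and the random bits not yet used. -/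
structure State where
  mem : ℕ → ℕ → ℕ
  bits : ℕ → Bool

/-- The value of an expression in a memory. -/
def Expr.eval (m : ℕ → ℕ → ℕ) : Expr → ℕ
  | const c => c
  | read a i => m a (i.eval m)
  | add e₁ e₂ => e₁.eval m + e₂.eval m
  | sub e₁ e₂ => e₁.eval m - e₂.eval m

/-- The memory after writing `x` into `a[i]`. -/
def write (m : ℕ → ℕ → ℕ) (a i x : ℕ) : ℕ → ℕ → ℕ :=
  Function.update m a (Function.update (m a) i x)

/-- `Exec p s t s'`: the program `p`, started in the state `s`, halts after exactly `t` steps, in the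
state `s'`. Every basic instruction and every test of a condition is one step. -/
inductive Exec : Prog → State → ℕ → State → Prop where
  | skip (s : State) : Exec .skip s 1 s
  | assign (a : ℕ) (i e : Expr) (s : State) :
      Exec (.assign a i e) s 1 ⟨write s.mem a (i.eval s.mem) (e.eval s.mem), s.bits⟩
  | coin (a : ℕ) (i : Expr) (s : State) :
      Exec (.coin a i) s 1
        ⟨write s.mem a (i.eval s.mem) (s.bits 0).toNat, fun j => s.bits (j + 1)⟩
  | clear (a : ℕ) (s : State) :
      Exec (.clear a) s 1 ⟨Function.update s.mem a (fun _ => 0), s.bits⟩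
  | seq {p q : Prog} {s s' s'' : State} {t t' : ℕ} :
      Exec p s t s' → Exec q s' t' s'' → Exec (.seq p q) s (t + t') s''
  | ite_true {e : Expr} {p q : Prog} {s s' : State} {t : ℕ} :
      e.eval s.mem ≠ 0 → Exec p s t s' → Exec (.ite e p q) s (t + 1) s'
  | ite_false {e : Expr} {p q : Prog} {s s' : State} {t : ℕ} :
      e.eval s.mem = 0 → Exec q s t s' → Exec (.ite e p q) s (t + 1) s'
  | loop_done {e : Expr} {p : Prog} {s : State} :
      e.eval s.mem = 0 → Exec (.loop e p) s 1 s
  | loop_step {e : Expr} {p : Prog} {s s' s'' : State} {t t' : ℕ} :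
      e.eval s.mem ≠ 0 → Exec p s t s' → Exec (.loop e p) s' t' s'' →
        Exec (.loop e p) s (t + t' + 1) s''

/-- The number of steps of `p` from the state `s`; it is `∞` if `p` does not halt. -/
noncomputable def runtime (p : Prog) (s : State) : ℝ≥0∞ :=
  ⨅ (t : ℕ) (s' : State) (_ : Exec p s t s'), (t : ℝ≥0∞)

/-- The law of an infinite sequence of independent fair bits. -/
noncomputable def coins : Measure (ℕ → Bool) :=
  Measure.infinitePi fun _ => (PMF.uniformOfFintype Bool).toMeasure

open Classical in
/-- The initial state on the input `(G, k)`, with random bits `ω`: the array `0` holds the number `n`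
of vertices and `k`, the array `1` the adjacency matrix of `G`, row by row; all else is zero. -/
noncomputable def input {n : ℕ} (G : SimpleGraph (Fin n)) (k : ℕ) (ω : ℕ → Bool) : State where
  mem a i :=
    if a = 0 then (if i = 0 then n else if i = 1 then k else 0)
    else if a = 1 then (if ∃ u v : Fin n, G.Adj u v ∧ i = u.val * n + v.val then 1 else 0)
    else 0
  bits := ω

/-- The expected running time of `p` on the input `(G, k)`, over the random bits of `p`. -/
noncomputable def expectedTime (p : Prog) {n : ℕ} (G : SimpleGraph (Fin n)) (k : ℕ) : ℝ≥0∞ :=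
  ∫⁻ ω, runtime p (input G k ω) ∂coins

/-- With the random bits `ω`, the program `p` halts on the graph `G` with output `1`, the output
being the entry `0` of the array `2`. -/
def Accepts (p : Prog) {n : ℕ} (G : SimpleGraph (Fin n)) (ω : ℕ → Bool) : Prop :=
  ∃ t s', Exec p (input G 0 ω) t s' ∧ s'.mem 2 0 = 1

/-- With the random bits `ω`, the program `p` halts on the input `(G, k)` and outputs the vertex set
`S`, given by the nonzero ones among the first `n` entries of the array `2`. -/
def OutputsSet (p : Prog) {n : ℕ} (G : SimpleGraph (Fin n)) (k : ℕ) (ω : ℕ → Bool)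
    (S : Finset (Fin n)) : Prop :=
  ∃ t s', Exec p (input G k ω) t s' ∧ ∀ v : Fin n, v ∈ S ↔ s'.mem 2 v.val ≠ 0

end RAM

/-! ### The Strongish Planted Clique Hypothesis -/

namespace PlantedClique

/-- The complete graph on the vertex set `C`, all other vertices being isolated. -/
def cliqueOn {V : Type*} (C : Finset V) : SimpleGraph V where
  Adj u v := u ≠ v ∧ u ∈ C ∧ v ∈ C
  symm := ⟨fun _ _ h => ⟨h.1.symm, h.2.2, h.2.1⟩⟩
  loopless := ⟨fun _ h => h.1 rfl⟩

/-- The Erdős–Rényi distribution `𝒢(n, 1/2)`. -/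
noncomputable def gnHalf (n : ℕ) : Measure (SimpleGraph (Fin n)) :=
  SimpleGraph.binomialRandom (Fin n) ⟨1 / 2, by norm_num, by norm_num⟩

/-- The distribution `𝒢(n, 1/2, κ)`: a graph from `𝒢(n, 1/2)`, to which the clique on an independent,
uniformly random set of `κ` vertices is added. -/
noncomputable def planted (n κ : ℕ) : Measure (SimpleGraph (Fin n)) :=
  ((gnHalf n).prod (uniformOn {C : Finset (Fin n) | C.card = κ})).map
    fun x => x.1 ⊔ cliqueOn x.2

/-- The Strongish Planted Clique Hypothesis: for some constant `δ ∈ (0, 1/2)`, no randomized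
algorithm of running time `n ^ o(log n)` distinguishes, for all large `n`, the distributions
`𝒢(n, 1/2, ⌈n ^ δ⌉)` and `𝒢(n, 1/2)`. -/
def SPCH : Prop :=
  ∃ δ : ℝ, 0 < δ ∧ δ < 1 / 2 ∧
    ¬ ∃ (B : RAM.Prog) (h : ℕ → ℝ), h =o[atTop] (fun n : ℕ => Real.log n) ∧
      ∀ᶠ n : ℕ in atTop,
        (∀ G : SimpleGraph (Fin n), RAM.expectedTime B G 0 ≤ ENNReal.ofReal ((n : ℝ) ^ h n)) ∧
        2 / 3 ≤ ((planted n ⌈(n : ℝ) ^ δ⌉₊).prod RAM.coins).real {x | RAM.Accepts B x.1 x.2} ∧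
        ((gnHalf n).prod RAM.coins).real {x | RAM.Accepts B x.1 x.2} ≤ 1 / 3

end PlantedClique

/-! ### Smallest `k`-Edge Subgraph -/

namespace SmallestEdgeSubgraph

/-- `S` induces at least `k` edges of `G`. -/
def Feasible {n : ℕ} (G : SimpleGraph (Fin n)) (k : ℕ) (S : Finset (Fin n)) : Prop :=
  k ≤ (G.induce (S : Set (Fin n))).edgeSet.ncard

/-- The smallest size of a vertex set that induces at least `k` edges of `G` (used only if there is
such a set). -/
noncomputable def opt {n : ℕ} (G : SimpleGraph (Fin n)) (k : ℕ) : ℕ :=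
  sInf {m | ∃ S : Finset (Fin n), Feasible G k S ∧ S.card = m}

/-- The instances of the problem: `k` is positive and `G` has at least `k` edges. -/
def IsInstance {n : ℕ} (G : SimpleGraph (Fin n)) (k : ℕ) : Prop :=
  0 < k ∧ k ≤ G.edgeSet.ncard

/-- The perfect completeness case: `k` is positive, `k = κ(κ-1)/2` for some `κ`, and `G` contains a
clique of size `κ`. -/
def IsPerfectInstance {n : ℕ} (G : SimpleGraph (Fin n)) (k : ℕ) : Prop :=
  0 < k ∧ ∃ κ : ℕ, k = κ.choose 2 ∧ ∃ C : Finset (Fin n), G.IsNClique κ C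

/-- On every input `(G, k)` that satisfies the promise `P`, the randomized algorithm `A` has expected
running time at most `f(k) · q(n)`, where `n` is the number of vertices, and with probability at least
`2/3` it outputs a set of vertices that induces at least `k` edges and whose size is at most `g(k)`
times the optimum. -/
def Approximates (A : RAM.Prog) (P : ∀ {n : ℕ}, SimpleGraph (Fin n) → ℕ → Prop)
    (g : ℕ → ℝ) (f : ℕ → ℕ) (q : Polynomial ℕ) : Prop :=
  ∀ (n : ℕ) (G : SimpleGraph (Fin n)) (k : ℕ), P G k →
    RAM.expectedTime A G k ≤ ((f k * q.eval n : ℕ) : ℝ≥0∞) ∧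
    2 / 3 ≤ RAM.coins.real {ω | ∃ S : Finset (Fin n), RAM.OutputsSet A G k ω S ∧
      Feasible G k S ∧ (S.card : ℝ) ≤ g k * (opt G k : ℝ)}

end SmallestEdgeSubgraph

/-! ### Finite coin-tossing trees -/

/-! A hypothetical algorithm `A` of factor `g(k) = o(√k)` for the perfect completeness case is
turned into a planted clique distinguisher by a randomized graph product. Let `u` be the logarithm
of `n` to the base `2^d`, rounded up, for a constant `d ≥ 4/δ`; then `n ≤ 2^(du)`, and `2^(2u) ≤
n^δ` for large `n`. At level `b`, sample `N = 2^(2d(d-1)ub)` tuples of `2db` random numbers below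
`2^(du)`, and join two tuples if every entry of the one is equal or adjacent in `G` to every entry
of the other; numbers from `n` on are not vertices and spoil every edge.

Completeness. If `G` has a clique of at least `2^(2u)` vertices, the expected number of tuples
inside it is at least `2^(2dub)`, so with few exceptions the tuple graph has a clique of any
prescribed size `κ + 1 ≤ b + 1`. With `k = (κ+1 choose 2)`, the algorithm finds `k` edges on at most
`g(k)(κ+1)` vertices. If `b ≥ u/D` and `κ` is a large enough constant in terms of `D`, this is at
most `kb/(4d²u)`; a set with `k` edges and so few vertices is called a certificate
(`le_pr_attemptTree`, `eventually_le_pr_tryTree`).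

Soundness. For a random graph a certificate hardly ever exists, whatever `A` does. With high
probability any `s ≤ k` of the tuples have at least `bs` different entries; by Hall's theorem they
have disjoint sets of `b` entries each, so `k` edges between them require `kb²` different edges of
`G`. The probability `2^(-kb²)` of this beats the number `N^s 2^(s²)` of choices, because `s ≤
kb/(4d²u)` (`expect_cert_le`).

Choice of the level. Level `b` costs `2^(O(ub))`, so `b` should be about `u/D` with `D` tending to
infinity, but the admissible speed depends on `f` and `g`, which need not be computable. The
distinguisher therefore finds a level by itself: it tries levels one after the other on random
graphs with cliques that it plants, until one recognizes them all. It tests every clique size from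
`2^(2u)` to `n`, so that `n^δ` need not be computed. A level that passes is reliable on the planted
distribution (`pr_testTree_le`, and `plantedPr_eq` for the position of the clique), while soundness
holds at every level. For each fixed `D`, level `u/D + 1` eventually passes except with
exponentially small probability, which outweighs the cost `2^(O(u²))` of going on (`meanTime_le`).
Hence the mean time is `n^(o(log n))` (`isLittleO_log_meanTime`).

On the machine side, programs are matched with finite coin-tossing trees by `Impl`, so that all
probabilities become finite averages. `A` is simulated under a clock, since only its expected time
is bounded, and only on the promise (`impl_clocked`, `avg_exhausted_le`). -/

namespace RAM

/-- A computation that tosses finitely many fair coins and returns a value. -/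
inductive Tree (α : Type) where
  | leaf (a : α)
  | flip (k : Bool → Tree α)

namespace Tree

variable {α β γ : Type}

/-- The value and the unused random bits of a computation fed with the random bits `ω`. -/
def eval : Tree α → (ℕ → Bool) → α × (ℕ → Bool)
  | leaf a, ω => (a, ω)
  | flip k, ω => (k (ω 0)).eval fun j => ω (j + 1)

/-- Sequential composition. -/
def bind : Tree α → (α → Tree β) → Tree β
  | leaf a, f => f a
  | flip k, f => flip fun b => (k b).bind f

/-- Apply a function to the returned value. -/
def map (f : α → β) (c : Tree α) : Tree β := c.bind fun a => leaf (f a)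

/-- The expectation of `F` of the returned value. -/
noncomputable def avg : Tree α → (α → ℝ) → ℝ
  | leaf a, F => F a
  | flip k, F => ((k true).avg F + (k false).avg F) / 2

/-- A property of all values that can be returned. -/
def All (P : α → Prop) : Tree α → Prop
  | leaf a => P a
  | flip k => ∀ b, (k b).All P

/-- `n` rounds of a loop: in the round with counter `j + 1` the step `s j` is made. -/
def down (s : ℕ → α → Tree α) : ℕ → α → Tree α
  | 0, a => leaf a
  | n + 1, a => (s n a).bind (down s n)

@[simp] lemma bind_leaf (a : α) (f : α → Tree β) : (leaf a).bind f = f a := rfl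
@[simp] lemma map_leaf (f : α → β) (a : α) : (leaf a).map f = leaf (f a) := rfl
@[simp] lemma eval_leaf (a : α) (ω : ℕ → Bool) : (leaf a).eval ω = (a, ω) := rfl
@[simp] lemma avg_leaf (a : α) (F : α → ℝ) : (leaf a).avg F = F a := rfl

lemma bind_pure (c : Tree α) : c.bind leaf = c := by
  induction c with
  | leaf a => rfl
  | flip k ih => simp [bind, ih]

lemma bind_assoc (c : Tree α) (f : α → Tree β) (g : β → Tree γ) :
    (c.bind f).bind g = c.bind fun a => (f a).bind g := by
  induction c with
  | leaf a => rfl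
  | flip k ih => simp [bind, ih]

lemma eval_bind (c : Tree α) (f : α → Tree β) (ω : ℕ → Bool) :
    (c.bind f).eval ω = (f (c.eval ω).1).eval (c.eval ω).2 := by
  induction c generalizing ω with
  | leaf a => rfl
  | flip k ih => simp [bind, eval, ih]

lemma eval_map (c : Tree α) (f : α → β) (ω : ℕ → Bool) :
    (c.map f).eval ω = (f (c.eval ω).1, (c.eval ω).2) := by
  simp [map, eval_bind]

lemma avg_bind (c : Tree α) (f : α → Tree β) (F : β → ℝ) :
    (c.bind f).avg F = c.avg fun a => (f a).avg F := by
  induction c with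
  | leaf a => rfl
  | flip k ih => simp [bind, avg, ih]

lemma avg_map (c : Tree α) (f : α → β) (F : β → ℝ) :
    (c.map f).avg F = c.avg fun a => F (f a) := by
  simp [map, avg_bind]

lemma avg_mono (c : Tree α) {F F' : α → ℝ} (h : ∀ a, F a ≤ F' a) : c.avg F ≤ c.avg F' := by
  induction c with
  | leaf a => exact h a
  | flip k ih => simp only [avg]; linarith [ih true, ih false]

lemma avg_const (c : Tree α) (x : ℝ) : (c.avg fun _ => x) = x := by
  induction c with
  | leaf a => rfl
  | flip k ih => simp [avg, ih]

lemma avg_add (c : Tree α) (F F' : α → ℝ) :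
    (c.avg fun a => F a + F' a) = c.avg F + c.avg F' := by
  induction c with
  | leaf a => rfl
  | flip k ih => simp only [avg, ih]; ring

lemma avg_mul_left (c : Tree α) (x : ℝ) (F : α → ℝ) :
    (c.avg fun a => x * F a) = x * c.avg F := by
  induction c with
  | leaf a => rfl
  | flip k ih => simp only [avg, ih]; ring

lemma avg_mul_right (c : Tree α) (x : ℝ) (F : α → ℝ) :
    (c.avg fun a => F a * x) = c.avg F * x := by
  simp_rw [mul_comm _ x, avg_mul_left]

lemma avg_sub (c : Tree α) (F F' : α → ℝ) :
    (c.avg fun a => F a - F' a) = c.avg F - c.avg F' := by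
  induction c with
  | leaf a => rfl
  | flip k ih => simp only [avg, ih]; ring

lemma avg_nonneg (c : Tree α) {F : α → ℝ} (h : ∀ a, 0 ≤ F a) : 0 ≤ c.avg F := by
  simpa [avg_const] using c.avg_mono (F := fun _ => 0) h

lemma avg_sum {ι : Type*} (c : Tree α) (s : Finset ι) (F : ι → α → ℝ) :
    (c.avg fun a => ∑ i ∈ s, F i a) = ∑ i ∈ s, c.avg (F i) := by
  induction c with
  | leaf a => rfl
  | flip k ih => simp only [avg, ih, ← Finset.sum_add_distrib, Finset.sum_div]

lemma All.eval {P : α → Prop} {c : Tree α} (h : c.All P) (ω : ℕ → Bool) : P (c.eval ω).1 := by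
  induction c generalizing ω with
  | leaf a => exact h
  | flip k ih => exact ih _ (h _) _

lemma All.mono {P P' : α → Prop} {c : Tree α} (h : c.All P) (hP : ∀ a, P a → P' a) :
    c.All P' := by
  induction c with
  | leaf a => exact hP _ h
  | flip k ih => exact fun b => ih b (h b)

lemma All.bind {P : α → Prop} {P' : β → Prop} {c : Tree α} {f : α → Tree β} (h : c.All P)
    (hf : ∀ a, P a → (f a).All P') : (c.bind f).All P' := by
  induction c with
  | leaf a => exact hf _ h
  | flip k ih => exact fun b => ih b (h b)

lemma avg_mono_of_all {P : α → Prop} {c : Tree α} (hc : c.All P) {F F' : α → ℝ}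
    (h : ∀ a, P a → F a ≤ F' a) : c.avg F ≤ c.avg F' := by
  induction c with
  | leaf a => exact h a hc
  | flip k ih => simp only [avg]; linarith [ih true (hc true), ih false (hc false)]

end Tree

/-! ### Trees and the law of the coins -/

instance : IsProbabilityMeasure coins := by unfold coins; infer_instance

/-- Put a bit in front of a sequence of bits. -/
def consBit (x : Bool × (ℕ → Bool)) : ℕ → Bool
  | 0 => x.1
  | j + 1 => x.2 j

lemma measurable_consBit : Measurable consBit := by
  refine measurable_pi_lambda _ fun j => ?_
  cases j with
  | zero => exact measurable_fst
  | succ j => exact (measurable_pi_apply j).comp measurable_snd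

/-- A product measure is determined by its values on finite cylinders, and the preimage of a
cylinder under `consBit` is again a product: the condition on the index `0`, times the conditions on
the later indices moved down by one. -/
lemma map_consBit_coins :
    (((PMF.uniformOfFintype Bool).toMeasure).prod coins).map consBit = coins := by
  refine Measure.eq_infinitePi _ fun s t ht => ?_
  rw [Measure.map_apply measurable_consBit (.pi s.countable_toSet fun i _ => ht i)]
  -- The indices are filled up to an initial segment, with trivial conditions on the new ones, so
  -- that moving them by one becomes an identity about ranges.
  let s' : Finset ℕ := (Finset.range (s.sup id + 1))
  let t' : ℕ → Set Bool := fun i => if i ∈ s then t i else Set.univ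
  have hpre : consBit ⁻¹' (Set.pi (s : Set ℕ) t) =
      (t' 0) ×ˢ (Set.pi (s' : Set ℕ) fun i => t' (i + 1)) := by
    ext ⟨b, ω⟩
    simp only [Set.mem_preimage, Set.mem_pi, Finset.mem_coe, Set.mem_prod, s', t',
      Finset.mem_range]
    constructor
    · intro h
      refine ⟨?_, fun i _ => ?_⟩
      · split_ifs with h0
        · exact h 0 h0
        · trivial
      · split_ifs with h0
        · exact h (i + 1) h0
        · trivial
    · rintro ⟨h0, h1⟩ i hi
      cases i with
      | zero => simpa [hi, consBit] using h0
      | succ j =>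
        have : j + 1 ≤ s.sup id := Finset.le_sup (f := id) hi
        simpa [hi, consBit] using h1 j (by omega)
  have ht' : ∀ i, MeasurableSet (t' i) := fun i => by
    simp only [t']; split_ifs
    · exact ht i
    · exact MeasurableSet.univ
  rw [hpre, Measure.prod_prod, coins, Measure.infinitePi_pi _ fun i _ => ht' _]
  have h1 : ∏ i ∈ s, (PMF.uniformOfFintype Bool).toMeasure (t i) =
      ∏ i ∈ Finset.range (s.sup id + 2), (PMF.uniformOfFintype Bool).toMeasure (t' i) := by
    rw [← Finset.prod_subset (s₁ := s) (s₂ := Finset.range (s.sup id + 2))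
      (f := fun i => (PMF.uniformOfFintype Bool).toMeasure (t' i))]
    · exact Finset.prod_congr rfl fun i hi => by simp only [t', hi, if_true]
    · intro i hi
      have : i ≤ s.sup id := Finset.le_sup (f := id) hi
      rw [Finset.mem_range]; omega
    · intro i _ hi
      simp only [t', hi, if_false, measure_univ]
  rw [h1, Finset.prod_range_succ' _ (s.sup id + 1), mul_comm]

/-- Conditioning on the first bit, the induction step for trees. -/
lemma lintegral_coins {φ : (ℕ → Bool) → ℝ≥0∞} (hφ : Measurable φ) :
    ∫⁻ ω, φ ω ∂coins =
      ((∫⁻ ω, φ (consBit (true, ω)) ∂coins) + ∫⁻ ω, φ (consBit (false, ω)) ∂coins) / 2 := by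
  conv_lhs => rw [← map_consBit_coins]
  rw [lintegral_map hφ measurable_consBit,
    lintegral_prod (fun a => φ (consBit a)) (hφ.comp measurable_consBit).aemeasurable,
    lintegral_fintype]
  simp [ENNReal.div_eq_inv_mul, mul_add, mul_comm]

namespace Tree

variable {α : Type}

lemma measurable_eval (c : Tree α) (F : α → ℝ≥0∞) : Measurable fun ω => F (c.eval ω).1 := by
  induction c with
  | leaf a => simp
  | flip k ih =>
    have hs : Measurable fun (ω : ℕ → Bool) j => ω (j + 1) :=
      measurable_pi_lambda _ fun j => measurable_pi_apply (j + 1)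
    have h : (fun ω => F ((flip k).eval ω).1) =
        fun ω : ℕ → Bool => if ω 0 = true then F ((k true).eval fun j => ω (j + 1)).1
          else F ((k false).eval fun j => ω (j + 1)).1 := by
      funext ω
      cases h : ω 0 <;> simp [eval, h]
    rw [h]
    exact Measurable.ite
      (measurableSet_eq_fun (measurable_pi_apply 0) measurable_const)
      ((ih true).comp hs) ((ih false).comp hs)

/-- The bridge from the measure on infinite bit sequences to finite averages: applied to step counts
it gives expected times, applied to indicators it gives probabilities. -/
lemma lintegral_eval (c : Tree α) {F : α → ℝ} (hF : ∀ a, 0 ≤ F a) :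
    ∫⁻ ω, ENNReal.ofReal (F (c.eval ω).1) ∂coins = ENNReal.ofReal (c.avg F) := by
  induction c with
  | leaf a => simp
  | flip k ih =>
    rw [lintegral_coins (measurable_eval (flip k) fun a => ENNReal.ofReal (F a))]
    have h : ∀ b, ∫⁻ ω, ENNReal.ofReal (F ((flip k).eval (consBit (b, ω))).1) ∂coins =
        ENNReal.ofReal ((k b).avg F) := fun b => ih b
    rw [h, h, ← ENNReal.ofReal_add (avg_nonneg _ hF) (avg_nonneg _ hF), avg,
      ENNReal.ofReal_div_of_pos two_pos]
    simp

lemma measurableSet_eval (c : Tree α) (X : Set α) : MeasurableSet {ω | (c.eval ω).1 ∈ X} := by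
  classical
  have := measurable_eval c (fun a => if a ∈ X then 1 else 0) (measurableSet_singleton 1)
  convert this using 1
  ext ω
  simp

open Classical in
lemma coins_eval (c : Tree α) (X : Set α) :
    coins.real {ω | (c.eval ω).1 ∈ X} = c.avg fun a => if a ∈ X then 1 else 0 := by
  have h := lintegral_eval c (F := fun a => if a ∈ X then 1 else 0)
    fun a => by split_ifs <;> norm_num
  have h2 : ∀ ω, ENNReal.ofReal (if (c.eval ω).1 ∈ X then 1 else 0) =
      Set.indicator {ω | (c.eval ω).1 ∈ X} 1 ω := fun ω => by
    by_cases hω : (c.eval ω).1 ∈ X <;> simp [hω]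
  simp_rw [h2, lintegral_indicator_one (c.measurableSet_eval X)] at h
  rw [measureReal_def, h, ENNReal.toReal_ofReal]
  exact avg_nonneg _ fun a => by split_ifs <;> norm_num

end Tree
end RAM

/-! ### Executions are deterministic -/

namespace RAM

lemma Exec.det {p : Prog} {s s₁ s₂ : State} {t₁ t₂ : ℕ} (h₁ : Exec p s t₁ s₁)
    (h₂ : Exec p s t₂ s₂) : t₁ = t₂ ∧ s₁ = s₂ := by
  induction h₁ generalizing t₂ s₂ with
  | skip s => cases h₂; exact ⟨rfl, rfl⟩
  | assign a i e s => cases h₂; exact ⟨rfl, rfl⟩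
  | coin a i s => cases h₂; exact ⟨rfl, rfl⟩
  | clear a s => cases h₂; exact ⟨rfl, rfl⟩
  | seq _ _ ih ih' =>
    cases h₂ with
    | seq h h' =>
      obtain ⟨rfl, rfl⟩ := ih h
      obtain ⟨rfl, rfl⟩ := ih' h'
      exact ⟨rfl, rfl⟩
  | ite_true he _ ih =>
    cases h₂ with
    | ite_true _ h => obtain ⟨rfl, rfl⟩ := ih h; exact ⟨rfl, rfl⟩
    | ite_false he' h => exact absurd he' he
  | ite_false he _ ih =>
    cases h₂ with
    | ite_true he' h => exact absurd he he'
    | ite_false _ h => obtain ⟨rfl, rfl⟩ := ih h; exact ⟨rfl, rfl⟩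
  | loop_done he =>
    cases h₂ with
    | loop_done _ => exact ⟨rfl, rfl⟩
    | loop_step he' _ _ => exact absurd he he'
  | loop_step he _ _ ih ih' =>
    cases h₂ with
    | loop_done he' => exact absurd he' he
    | loop_step _ h h' =>
      obtain ⟨rfl, rfl⟩ := ih h
      obtain ⟨rfl, rfl⟩ := ih' h'
      exact ⟨rfl, rfl⟩

/-! ### Clocked interpretation

The interpreter runs a program with a budget of steps; loops stop when the budget is exhausted, so
that it always halts. -/

/-- The contents of the memory. -/
abbrev Mem := ℕ → ℕ → ℕ

/-- The iterations of a loop with test `e` and body `f`; the first argument bounds their number. -/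
def loopInterp (e : Expr) (f : Mem × ℕ → Tree (Mem × ℕ)) : ℕ → Mem × ℕ → Tree (Mem × ℕ)
  | 0, x => .leaf x
  | j + 1, x =>
    if e.eval x.1 = 0 ∨ x.2 = 0 then .leaf x
    else (f x).bind fun y => loopInterp e f j (y.1, y.2 - 1)

/-- The clocked interpreter, on a memory and a budget of steps. -/
def interp : Prog → Mem × ℕ → Tree (Mem × ℕ)
  | .skip, x => .leaf (x.1, x.2 - 1)
  | .assign a i e, x => .leaf (write x.1 a (i.eval x.1) (e.eval x.1), x.2 - 1)
  | .coin a i, x => .flip fun c => .leaf (write x.1 a (i.eval x.1) c.toNat, x.2 - 1)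
  | .clear a, x => .leaf (Function.update x.1 a (fun _ => 0), x.2 - 1)
  | .seq p q, x => (interp p x).bind (interp q)
  | .ite e p q, x =>
    if e.eval x.1 ≠ 0 then interp p (x.1, x.2 - 1) else interp q (x.1, x.2 - 1)
  | .loop e p, x => loopInterp e (interp p) (x.2 - 1) (x.1, x.2 - 1)

lemma loopInterp_le {e : Expr} {f : Mem × ℕ → Tree (Mem × ℕ)}
    (hf : ∀ x, (f x).All fun y => y.2 ≤ x.2) (j : ℕ) (x : Mem × ℕ) :
    (loopInterp e f j x).All fun y => y.2 ≤ x.2 := by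
  induction j generalizing x with
  | zero => exact le_rfl
  | succ j ih =>
    rw [loopInterp]
    split_ifs
    · exact le_rfl
    · exact (hf x).bind fun y hy => (ih _).mono fun z hz => by simp only at hz; omega

lemma interp_le (p : Prog) (x : Mem × ℕ) : (interp p x).All fun y => y.2 ≤ x.2 := by
  induction p generalizing x with
  | skip => exact Nat.sub_le _ _
  | assign a i e => exact Nat.sub_le _ _
  | coin a i => exact fun _ => Nat.sub_le _ _
  | clear a => exact Nat.sub_le _ _
  | seq p q ihp ihq =>
    exact (ihp x).bind fun y hy => (ihq y).mono fun z hz => hz.trans hy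
  | ite e p q ihp ihq =>
    rw [interp]
    split_ifs
    · exact (ihp _).mono fun z hz => hz.trans (Nat.sub_le _ _)
    · exact (ihq _).mono fun z hz => hz.trans (Nat.sub_le _ _)
  | loop e p ih =>
    exact (loopInterp_le ih _ _).mono fun z hz => hz.trans (Nat.sub_le _ _)

lemma Tree.bind_congr_of_all {α β : Type} {P : α → Prop} {c : Tree α} (hc : c.All P)
    {f f' : α → Tree β} (h : ∀ a, P a → f a = f' a) : c.bind f = c.bind f' := by
  induction c with
  | leaf a => exact h a hc
  | flip k ih => simp only [Tree.bind]; congr 1; funext b; exact ih b (hc b)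

/-- Every iteration lowers the budget, so an iteration bound that is at least the budget is never
reached. The bound only makes the recursion structural. -/
lemma loopInterp_fuel {e : Expr} {f : Mem × ℕ → Tree (Mem × ℕ)}
    (hf : ∀ x, (f x).All fun y => y.2 ≤ x.2) (j : ℕ) (x : Mem × ℕ) (hj : x.2 ≤ j) :
    loopInterp e f j x = loopInterp e f x.2 x := by
  induction j using Nat.strong_induction_on generalizing x with
  | _ j ih =>
    obtain ⟨m, b⟩ := x
    rcases b with _ | b
    · cases j <;> simp [loopInterp]
    · rcases j with _ | j
      · simp at hj
      · rw [loopInterp]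
        conv_rhs => rw [loopInterp]
        by_cases hc : e.eval m = 0 ∨ b + 1 = 0
        · rw [if_pos hc, if_pos hc]
        · rw [if_neg hc, if_neg hc]
          refine Tree.bind_congr_of_all (hf _) fun y hy => ?_
          simp only at hy hj
          rw [ih j (by omega) _ (by simp only; omega)]
          rcases Nat.lt_or_ge b (j + 1) with hb | hb
          · rw [ih b (by omega) (y.1, y.2 - 1) (by simp only; omega)]
          · omega

/-- If a program halts within the budget, then so does the interpreter, with the same result. -/
lemma Exec.interp_eval {p : Prog} {s s' : State} {t : ℕ} (h : Exec p s t s') :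
    -- Strict, because a remaining budget of zero is reserved for exhausted runs.
    ∀ b, t < b → (interp p (s.mem, b)).eval s.bits = ((s'.mem, b - t), s'.bits) := by
  induction h with
  | skip s => intro b _; rfl
  | assign a i e s => intro b _; rfl
  | coin a i s => intro b _; rfl
  | clear a s => intro b _; rfl
  | seq _ _ ih ih' =>
    intro b hb
    rw [interp, Tree.eval_bind, ih b (by omega)]
    simp only
    rw [ih' _ (by omega), Nat.sub_sub]
  | ite_true he _ ih =>
    intro b hb
    rw [interp, if_pos he, ih _ (by simp only; omega)]
    simp only [Nat.sub_sub, Nat.add_comm]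
  | ite_false he _ ih =>
    intro b hb
    rw [interp, if_neg (not_not.2 he), ih _ (by simp only; omega)]
    simp only [Nat.sub_sub, Nat.add_comm]
  | loop_done he =>
    intro b hb
    obtain ⟨b, rfl⟩ : ∃ c, b = c + 2 := ⟨b - 2, by omega⟩
    simp [interp, loopInterp, he]
  | @loop_step e p s s' s'' t t' he _ _ ih ih' =>
    intro b hb
    obtain ⟨b, rfl⟩ : ∃ c, b = c + 2 := ⟨b - 2, by omega⟩
    rw [interp]
    simp only [Nat.add_succ_sub_one, loopInterp, he, false_or]
    rw [if_neg (by omega), Tree.eval_bind, ih _ (by omega)]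
    simp only
    -- The iteration bound left over differs from the one in the induction hypothesis, but both are
    -- at least the remaining budget.
    rw [loopInterp_fuel (interp_le p) _ _ (by simp only; omega)]
    have := ih' (b + 1 - t) (by omega)
    rw [interp] at this
    simp only at this ⊢
    rw [this]
    congr 2
    omega

/-- The loop case of `exec_of_interp`. The step count starts from `x.2 + 1` because `interp` charges
the first test before it enters `loopInterp`; the unit charged after each body pays for the next
test. -/
lemma exec_of_loopInterp {e : Expr} {p : Prog}
    (ih : ∀ x ω, 0 < ((interp p x).eval ω).1.2 →
      Exec p ⟨x.1, ω⟩ (x.2 - ((interp p x).eval ω).1.2)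
        ⟨((interp p x).eval ω).1.1, ((interp p x).eval ω).2⟩) (j : ℕ) (x : Mem × ℕ)
    (hj : x.2 ≤ j) (ω : ℕ → Bool) (h : 0 < ((loopInterp e (interp p) j x).eval ω).1.2) :
    Exec (.loop e p) ⟨x.1, ω⟩ (x.2 + 1 - ((loopInterp e (interp p) j x).eval ω).1.2)
      ⟨((loopInterp e (interp p) j x).eval ω).1.1,
        ((loopInterp e (interp p) j x).eval ω).2⟩ := by
  induction j generalizing x ω with
  | zero => simp only [loopInterp, Tree.eval_leaf] at h; omega
  | succ j ihj =>
    rw [loopInterp] at h ⊢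
    split_ifs at h ⊢ with hc
    · simp only [Tree.eval_leaf] at h ⊢
      have he : e.eval x.1 = 0 := hc.resolve_right (by omega)
      simpa using Exec.loop_done (p := p) (s := ⟨x.1, ω⟩) he
    · push Not at hc
      rw [Tree.eval_bind] at h ⊢
      set y := (interp p x).eval ω with hy
      have hyx : y.1.2 ≤ x.2 := (interp_le p x).eval ω
      have hle := (loopInterp_le (e := e) (interp_le p) j (y.1.1, y.1.2 - 1)).eval y.2
      simp only at hle
      have h1 := ih x ω (by rw [← hy]; omega)
      have h2 := ihj (y.1.1, y.1.2 - 1) (by simp only; omega) y.2 h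
      rw [← hy] at h1
      convert Exec.loop_step hc.1 h1 h2 using 1
      simp only
      omega

/-- If the interpreter does not exhaust its budget, then the program halts with the same result. -/
lemma exec_of_interp (p : Prog) (x : Mem × ℕ) (ω : ℕ → Bool)
    (h : 0 < ((interp p x).eval ω).1.2) :
    Exec p ⟨x.1, ω⟩ (x.2 - ((interp p x).eval ω).1.2)
      ⟨((interp p x).eval ω).1.1, ((interp p x).eval ω).2⟩ := by
  induction p generalizing x ω with
  | skip =>
    simp only [interp, Tree.eval_leaf] at h ⊢
    convert Exec.skip _ using 1
    omega
  | assign a i e =>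
    simp only [interp, Tree.eval_leaf] at h ⊢
    convert Exec.assign a i e _ using 1
    omega
  | coin a i =>
    simp only [interp, Tree.eval] at h ⊢
    convert Exec.coin a i _ using 1
    omega
  | clear a =>
    simp only [interp, Tree.eval_leaf] at h ⊢
    convert Exec.clear a _ using 1
    omega
  | seq p q ihp ihq =>
    rw [interp, Tree.eval_bind] at h ⊢
    set y := (interp p x).eval ω with hy
    have h1 : y.1.2 ≤ x.2 := (interp_le p x).eval ω
    have h2 := (interp_le q y.1).eval y.2
    convert Exec.seq (ihp x ω (by rw [← hy]; omega)) (ihq _ _ h) using 1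
    rw [← hy]
    omega
  | ite e p q ihp ihq =>
    rw [interp] at h ⊢
    split_ifs at h ⊢ with he
    · have h2 := (interp_le p (x.1, x.2 - 1)).eval ω
      simp only at h2
      convert Exec.ite_true he (ihp _ _ h) using 1
      simp only
      omega
    · have h2 := (interp_le q (x.1, x.2 - 1)).eval ω
      simp only at h2
      convert Exec.ite_false (not_not.1 he) (ihq _ _ h) using 1
      simp only
      omega
  | loop e p ih =>
    rw [interp] at h ⊢
    have h2 := (loopInterp_le (e := e) (interp_le p) (x.2 - 1) (x.1, x.2 - 1)).eval ω
    simp only at h2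
    convert exec_of_loopInterp ih (x.2 - 1) (x.1, x.2 - 1) le_rfl ω h using 1
    simp only
    omega

/-! ### Programs that implement trees -/

/-- From the memory `m`, the program `p` behaves as the coin-tossing computation `c`: if `c` returns
`a`, then the final memory `m'` and the number of steps `t` satisfy `Q a m' t`. -/
def Impl {α : Type} (p : Prog) (m : Mem) (c : Tree α) (Q : α → Mem → ℕ → Prop) : Prop :=
  ∀ ω, ∃ t m', Exec p ⟨m, ω⟩ t ⟨m', (c.eval ω).2⟩ ∧ Q (c.eval ω).1 m' t

namespace Impl

variable {α β : Type} {p q : Prog} {m : Mem} {c : Tree α}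

lemma mono {Q Q' : α → Mem → ℕ → Prop} (h : Impl p m c Q) (hQ : ∀ a m' t, Q a m' t → Q' a m' t) :
    Impl p m c Q' := fun ω => by
  obtain ⟨t, m', h1, h2⟩ := h ω
  exact ⟨t, m', h1, hQ _ _ _ h2⟩

lemma map {f : α → β} {Q : β → Mem → ℕ → Prop} (h : Impl p m c fun a => Q (f a)) :
    Impl p m (c.map f) Q := fun ω => by
  obtain ⟨t, m', h1, h2⟩ := h ω
  refine ⟨t, m', ?_, ?_⟩ <;> rw [Tree.eval_map] <;> assumption

lemma seq {k : α → Tree β} {Q : α → Mem → ℕ → Prop} {Q' : β → Mem → ℕ → Prop}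
    (hp : Impl p m c Q)
    (hq : ∀ a m₁ t₁, Q a m₁ t₁ → Impl q m₁ (k a) fun b m₂ t₂ => Q' b m₂ (t₁ + t₂)) :
    Impl (.seq p q) m (c.bind k) Q' := fun ω => by
  obtain ⟨t, m', h1, h2⟩ := hp ω
  obtain ⟨t', m'', h3, h4⟩ := hq _ _ _ h2 (c.eval ω).2
  refine ⟨t + t', m'', ?_, ?_⟩ <;> rw [Tree.eval_bind]
  · exact h1.seq h3
  · exact h4

/-- Composition with a deterministic first program. -/
lemma seq_left {Q : Unit → Mem → ℕ → Prop} {Q' : α → Mem → ℕ → Prop}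
    (hp : Impl p m (.leaf ()) Q)
    (hq : ∀ m₁ t₁, Q () m₁ t₁ → Impl q m₁ c fun b m₂ t₂ => Q' b m₂ (t₁ + t₂)) :
    Impl (.seq p q) m c Q' :=
  hp.seq (k := fun _ => c) fun _ => hq

/-- Composition with a deterministic second program. -/
lemma seq_right {Q : α → Mem → ℕ → Prop} {Q' : α → Mem → ℕ → Prop} (hp : Impl p m c Q)
    (hq : ∀ a m₁ t₁, Q a m₁ t₁ →
      Impl q m₁ (.leaf ()) fun _ m₂ t₂ => Q' a m₂ (t₁ + t₂)) :
    Impl (.seq p q) m c Q' := by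
  rw [← c.bind_pure]
  exact hp.seq fun a m₁ t₁ h ω => by
    obtain ⟨t, m', h1, h2⟩ := hq a m₁ t₁ h ω
    exact ⟨t, m', h1, h2⟩

lemma skip {a : α} {Q : α → Mem → ℕ → Prop} (h : Q a m 1) : Impl .skip m (.leaf a) Q :=
  fun _ => ⟨1, m, .skip _, h⟩

lemma assign {a : α} {x : ℕ} {i e : Expr} {Q : α → Mem → ℕ → Prop}
    (h : Q a (write m x (i.eval m) (e.eval m)) 1) : Impl (.assign x i e) m (.leaf a) Q :=
  fun _ => ⟨1, _, .assign _ _ _ _, h⟩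

lemma clear {a : α} {x : ℕ} {Q : α → Mem → ℕ → Prop}
    (h : Q a (Function.update m x fun _ => 0) 1) : Impl (.clear x) m (.leaf a) Q :=
  fun _ => ⟨1, _, .clear _ _, h⟩

lemma coin {x : ℕ} {i : Expr} {Q : Bool → Mem → ℕ → Prop}
    (h : ∀ b : Bool, Q b (write m x (i.eval m) b.toNat) 1) :
    Impl (.coin x i) m (.flip .leaf) Q :=
  fun _ => ⟨1, _, .coin _ _ _, h _⟩

lemma ite {e : Expr} {Q : α → Mem → ℕ → Prop}
    (hp : e.eval m ≠ 0 → Impl p m c fun a m' t => Q a m' (t + 1))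
    (hq : e.eval m = 0 → Impl q m c fun a m' t => Q a m' (t + 1)) :
    Impl (.ite e p q) m c Q := fun ω => by
  by_cases he : e.eval m = 0
  · obtain ⟨t, m', h1, h2⟩ := hq he ω
    exact ⟨t + 1, m', .ite_false he h1, h2⟩
  · obtain ⟨t, m', h1, h2⟩ := hp he ω
    exact ⟨t + 1, m', .ite_true he h1, h2⟩

lemma loop_done {e : Expr} {a : α} {Q : α → Mem → ℕ → Prop} (he : e.eval m = 0) (h : Q a m 1) :
    Impl (.loop e p) m (.leaf a) Q :=
  fun _ => ⟨1, m, .loop_done he, h⟩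

lemma loop_step {e : Expr} {k : α → Tree β} {Q : α → Mem → ℕ → Prop} {Q' : β → Mem → ℕ → Prop}
    (he : e.eval m ≠ 0) (hp : Impl p m c Q)
    (hq : ∀ a m₁ t₁, Q a m₁ t₁ →
      Impl (.loop e p) m₁ (k a) fun b m₂ t₂ => Q' b m₂ (t₁ + t₂ + 1)) :
    Impl (.loop e p) m (c.bind k) Q' := fun ω => by
  obtain ⟨t, m', h1, h2⟩ := hp ω
  obtain ⟨t', m'', h3, h4⟩ := hq _ _ _ h2 (c.eval ω).2
  refine ⟨t + t' + 1, m'', ?_, ?_⟩ <;> rw [Tree.eval_bind]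
  · exact .loop_step he h1 h3
  · exact h4

end Impl

@[simp] lemma write_same (m : Mem) (a i x : ℕ) : write m a i x a i = x := by simp [write]

lemma write_apply (m : Mem) (a i x j : ℕ) :
    write m a i x a j = if j = i then x else m a j := by
  simp [write, Function.update_apply]

lemma write_of_ne (m : Mem) {a b : ℕ} (i x : ℕ) (h : b ≠ a) : write m a i x b = m b := by
  simp [write, h]

/-! ### The clocked program -/

/-- The expression with all array names increased by `s`. -/
def Expr.shift (s : ℕ) : Expr → Expr
  | const c => const c
  | read a i => read (a + s) (i.shift s)
  | add e₁ e₂ => add (e₁.shift s) (e₂.shift s)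
  | sub e₁ e₂ => sub (e₁.shift s) (e₂.shift s)

/-- A strict upper bound for the array names of an expression. -/
def Expr.bound : Expr → ℕ
  | const _ => 0
  | read a i => max (a + 1) i.bound
  | add e₁ e₂ => max e₁.bound e₂.bound
  | sub e₁ e₂ => max e₁.bound e₂.bound

/-- A strict upper bound for the array names of a program. -/
def Prog.bound : Prog → ℕ
  | skip => 0
  | assign a i e => max (a + 1) (max i.bound e.bound)
  | coin a i => max (a + 1) i.bound
  | clear a => a + 1
  | seq p q => max p.bound q.bound
  | ite e p q => max e.bound (max p.bound q.bound)
  | loop e p => max e.bound p.bound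

/-- The entry `a[0]`. -/
def reg (a : ℕ) : Expr := .read a (.const 0)

/-- `a[0] := e`. -/
def setReg (a : ℕ) (e : Expr) : Prog := .assign a (.const 0) e

@[simp] lemma eval_const (m : Mem) (c : ℕ) : (Expr.const c).eval m = c := rfl
@[simp] lemma eval_reg (m : Mem) (a : ℕ) : (reg a).eval m = m a 0 := rfl
@[simp] lemma eval_add (m : Mem) (e e' : Expr) : (e.add e').eval m = e.eval m + e'.eval m := rfl
@[simp] lemma eval_sub (m : Mem) (e e' : Expr) : (e.sub e').eval m = e.eval m - e'.eval m := rfl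
@[simp] lemma eval_read (m : Mem) (a : ℕ) (i : Expr) :
    (Expr.read a i).eval m = m a (i.eval m) := rfl

/-- `a[0] := a[0] - 1`. -/
def decReg (a : ℕ) : Prog := setReg a ((reg a).sub (.const 1))

/-- The clocked version of a program: array names are shifted by `s`, the budget is in `c[0]`. -/
def clocked (s c : ℕ) : Prog → Prog
  | .skip => decReg c
  | .assign a i e => .seq (decReg c) (.assign (a + s) (i.shift s) (e.shift s))
  | .coin a i => .seq (decReg c) (.coin (a + s) (i.shift s))
  | .clear a => .seq (decReg c) (.clear (a + s))
  | .seq p q => .seq (clocked s c p) (clocked s c q)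
  | .ite e p q => .seq (decReg c) (.ite (e.shift s) (clocked s c p) (clocked s c q))
  -- The expression `e - (e - c)` is the minimum of `e` and the budget, so the loop also stops when
  -- the budget is zero.
  | .loop e p => .seq (decReg c) (.loop ((e.shift s).sub ((e.shift s).sub (reg c)))
      (.seq (clocked s c p) (decReg c)))

/-- The slowdown of the clocked version. -/
def clockedCost : Prog → ℕ
  | .seq p q => clockedCost p + clockedCost q
  | .ite _ p q => clockedCost p + clockedCost q + 2
  | .loop _ p => 2 * (clockedCost p + 2) + 2
  | _ => 2

/-- The memory `m` of the clocked program represents the memory and the budget `x`. -/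
def Shifted (s c K : ℕ) (x : Mem × ℕ) (m : Mem) : Prop :=
  (∀ a < K, m (a + s) = x.1 a) ∧ m c 0 = x.2

lemma Shifted.eval {s c K : ℕ} {x : Mem × ℕ} {m : Mem} (h : Shifted s c K x m) (e : Expr)
    (he : e.bound ≤ K) : (e.shift s).eval m = e.eval x.1 := by
  induction e with
  | const c => rfl
  | read a i ih =>
    simp only [Expr.bound, max_le_iff] at he
    simp only [Expr.shift, eval_read, ih he.2, h.1 a (by omega)]
  | add e e' ih ih' =>
    simp only [Expr.bound, max_le_iff] at he
    simp only [Expr.shift, eval_add, ih he.1, ih' he.2]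
  | sub e e' ih ih' =>
    simp only [Expr.bound, max_le_iff] at he
    simp only [Expr.shift, eval_sub, ih he.1, ih' he.2]

lemma Shifted.write {s c K : ℕ} {x : Mem × ℕ} {m : Mem} (h : Shifted s c K x m) (hc : c < s)
    (a i y : ℕ) : Shifted s c K (RAM.write x.1 a i y, x.2) (RAM.write m (a + s) i y) := by
  refine ⟨fun b hb => ?_, ?_⟩
  · by_cases hab : b = a
    · subst hab
      funext j
      simp [write_apply, h.1 b hb]
    · rw [write_of_ne _ _ _ (by omega), h.1 b hb]
      exact (write_of_ne _ _ _ hab).symm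
  · rw [write_of_ne _ _ _ (by omega)]
    exact h.2

lemma Shifted.clear {s c K : ℕ} {x : Mem × ℕ} {m : Mem} (h : Shifted s c K x m) (hc : c < s)
    (a : ℕ) : Shifted s c K (Function.update x.1 a fun _ => 0, x.2)
      (Function.update m (a + s) fun _ => 0) := by
  refine ⟨fun b hb => ?_, ?_⟩
  · by_cases hab : b = a
    · subst hab; simp
    · simp [hab, h.1 b hb]
  · have : c ≠ a + s := by omega
    simp [this, h.2]

lemma Shifted.dec {s c K : ℕ} {x : Mem × ℕ} {m : Mem} (h : Shifted s c K x m) (hc : c < s) :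
    Shifted s c K (x.1, x.2 - 1) (RAM.write m c 0 (m c 0 - 1)) :=
  ⟨fun b hb => by rw [write_of_ne _ _ _ (by omega), h.1 b hb], by simp [h.2]⟩

/-- What the clocked program guarantees, started with the budget `b` in the memory `m`. -/
def ClockedPost (s c K k b : ℕ) (m : Mem) (y : Mem × ℕ) (m' : Mem) (t : ℕ) : Prop :=
  -- The `+ 1` pays for straight-line code that is still executed once the budget has reached zero.
  y.2 ≤ b ∧ Shifted s c K y m' ∧ (∀ a < s, a ≠ c → m' a = m a) ∧ t ≤ k * (b - y.2 + 1)

lemma impl_decReg {s c K : ℕ} {x : Mem × ℕ} {m : Mem} (h : Shifted s c K x m) (hc : c < s) :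
    Impl (decReg c) m (.leaf ()) fun _ m' t =>
      Shifted s c K (x.1, x.2 - 1) m' ∧ (∀ a < s, a ≠ c → m' a = m a) ∧ t = 1 :=
  .assign ⟨h.dec hc, fun _ _ ha => write_of_ne _ _ _ ha, rfl⟩

/-- The loop case of `impl_clocked`. The body is entered with a positive budget only and is followed
by a decrement, so each iteration spends at least one unit; this absorbs the additive constant of
the body, at the price of a factor `2`. -/
lemma impl_clocked_loop {s c K : ℕ} (hc : c < s) {e : Expr} {p : Prog} (he : e.bound ≤ K)
    (ih : ∀ x m, Shifted s c K x m → Impl (clocked s c p) m (interp p x)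
      (ClockedPost s c K (clockedCost p) x.2 m)) (j : ℕ) (x : Mem × ℕ) (m : Mem) (hj : x.2 ≤ j)
    (h : Shifted s c K x m) :
    Impl (.loop ((e.shift s).sub ((e.shift s).sub (reg c)))
      (.seq (clocked s c p) (decReg c))) m (loopInterp e (interp p) j x)
      fun y m' t => y.2 ≤ x.2 ∧ Shifted s c K y m' ∧ (∀ a < s, a ≠ c → m' a = m a) ∧
        t ≤ 2 * (clockedCost p + 2) * (x.2 - y.2) + 1 := by
  induction j generalizing x m with
  | zero =>
    rw [loopInterp]
    refine .loop_done ?_ ⟨le_rfl, h, fun _ _ _ => rfl, by simp⟩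
    simp [h.2, Nat.le_zero.1 hj]
  | succ j ihj =>
    rw [loopInterp]
    split_ifs with hx
    · refine .loop_done ?_ ⟨le_rfl, h, fun _ _ _ => rfl, by simp⟩
      simp only [eval_sub, h.eval e he, eval_reg, h.2]
      omega
    · push Not at hx
      refine .loop_step ?_ (Q := fun y m' t => y.2 ≤ x.2 ∧ Shifted s c K (y.1, y.2 - 1) m' ∧
        (∀ a < s, a ≠ c → m' a = m a) ∧ t ≤ clockedCost p * (x.2 - y.2 + 1) + 1) ?_ ?_
      · simp only [eval_sub, h.eval e he, eval_reg, h.2]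
        omega
      · refine (ih x m h).seq_right fun y m₁ t₁ h₁ => (impl_decReg h₁.2.1 hc).mono ?_
        rintro - m₂ t₂ ⟨h2, h3, rfl⟩
        exact ⟨h₁.1, h2, fun a ha hac => (h3 a ha hac).trans (h₁.2.2.1 a ha hac),
          by have := h₁.2.2.2; omega⟩
      · rintro y m₁ t₁ ⟨h1, h2, h3, h4⟩
        refine (ihj (y.1, y.2 - 1) m₁ (by simp only; omega) h2).mono ?_
        rintro z m₂ t₂ ⟨h5, h6, h7, h8⟩
        refine ⟨by simp only at h5; omega, h6,
          fun a ha hac => (h7 a ha hac).trans (h3 a ha hac), ?_⟩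
        simp only at h5 h8
        have h9 : x.2 - y.2 + 1 ≤ 2 * (x.2 - (y.2 - 1)) := by omega
        have h10 : x.2 - z.2 = (x.2 - (y.2 - 1)) + (y.2 - 1 - z.2) := by omega
        have h11 : 1 ≤ x.2 - (y.2 - 1) := by omega
        rw [h10]
        calc t₁ + t₂ + 1 ≤ clockedCost p * (2 * (x.2 - (y.2 - 1))) + 1 +
              (2 * (clockedCost p + 2) * (y.2 - 1 - z.2) + 1) + 1 := by
              have := Nat.mul_le_mul_left (clockedCost p) h9
              omega
          _ ≤ _ := by nlinarith

/-- The clocked program implements the clocked interpreter. -/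
lemma impl_clocked {s c K : ℕ} (hc : c < s) (p : Prog) (hp : p.bound ≤ K) (x : Mem × ℕ) (m : Mem)
    (h : Shifted s c K x m) :
    Impl (clocked s c p) m (interp p x) (ClockedPost s c K (clockedCost p) x.2 m) := by
  induction p generalizing x m with
  | skip =>
    exact .assign ⟨Nat.sub_le _ _, h.dec hc, fun _ _ ha => write_of_ne _ _ _ ha,
      by simp only [clockedCost]; omega⟩
  | assign a i e =>
    simp only [Prog.bound, max_le_iff] at hp
    refine (impl_decReg h hc).seq_left ?_
    rintro m₁ t₁ ⟨h1, h2, rfl⟩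
    refine .assign ⟨Nat.sub_le _ _, ?_, fun b hb hbc => ?_, by simp only [clockedCost]; omega⟩
    · rw [h1.eval i hp.2.1, h1.eval e hp.2.2]
      exact h1.write hc _ _ _
    · rw [write_of_ne _ _ _ (by omega), h2 b hb hbc]
  | coin a i =>
    simp only [Prog.bound, max_le_iff] at hp
    refine (impl_decReg h hc).seq_left ?_
    rintro m₁ t₁ ⟨h1, h2, rfl⟩
    intro ω
    refine ⟨1, _, .coin _ _ _, Nat.sub_le _ _, ?_, fun b hb hbc => ?_,
      by simp only [clockedCost]; omega⟩
    · rw [h1.eval i hp.2]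
      exact h1.write hc _ _ _
    · rw [write_of_ne _ _ _ (by omega)]
      exact h2 b hb hbc
  | clear a =>
    refine (impl_decReg h hc).seq_left ?_
    rintro m₁ t₁ ⟨h1, h2, rfl⟩
    refine .clear ⟨Nat.sub_le _ _, h1.clear hc a, fun b hb hbc => ?_,
      by simp only [clockedCost]; omega⟩
    rw [Function.update_of_ne (by omega), h2 b hb hbc]
  | seq p q ihp ihq =>
    simp only [Prog.bound, max_le_iff] at hp
    refine (ihp hp.1 x m h).seq fun y m₁ t₁ h1 => (ihq hp.2 y m₁ h1.2.1).mono ?_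
    intro z m₂ t₂ h2
    refine ⟨h2.1.trans h1.1, h2.2.1,
      fun a ha hac => (h2.2.2.1 a ha hac).trans (h1.2.2.1 a ha hac), ?_⟩
    have h3 := h1.2.2.2
    have h4 := h2.2.2.2
    have h5 := h1.1
    have h6 := h2.1
    have h7 : x.2 - y.2 + 1 ≤ x.2 - z.2 + 1 := by omega
    have h8 : y.2 - z.2 + 1 ≤ x.2 - z.2 + 1 := by omega
    simp only [clockedCost, add_mul]
    exact add_le_add (h3.trans (Nat.mul_le_mul_left _ h7)) (h4.trans (Nat.mul_le_mul_left _ h8))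
  | ite e p q ihp ihq =>
    simp only [Prog.bound, max_le_iff] at hp
    rw [interp]
    refine (impl_decReg h hc).seq_left ?_
    rintro m₁ t₁ ⟨h1, h2, rfl⟩
    refine .ite (fun he => ?_) (fun he => ?_) <;> rw [h1.eval e hp.1] at he
    · rw [if_pos he]
      refine (ihp hp.2.1 _ m₁ h1).mono fun y m₂ t₂ h3 => ?_
      refine ⟨h3.1.trans (Nat.sub_le _ _), h3.2.1,
        fun a ha hac => (h3.2.2.1 a ha hac).trans (h2 a ha hac), ?_⟩
      have h4 := h3.2.2.2
      have h5 : x.2 - 1 - y.2 + 1 ≤ x.2 - y.2 + 1 := by omega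
      have h6 := Nat.mul_le_mul_left (clockedCost p) h5
      simp only [clockedCost]
      nlinarith
    · rw [if_neg (not_not.2 he)]
      refine (ihq hp.2.2 _ m₁ h1).mono fun y m₂ t₂ h3 => ?_
      refine ⟨h3.1.trans (Nat.sub_le _ _), h3.2.1,
        fun a ha hac => (h3.2.2.1 a ha hac).trans (h2 a ha hac), ?_⟩
      have h4 := h3.2.2.2
      have h5 : x.2 - 1 - y.2 + 1 ≤ x.2 - y.2 + 1 := by omega
      have h6 := Nat.mul_le_mul_left (clockedCost q) h5
      simp only [clockedCost]
      nlinarith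
  | loop e p ih =>
    simp only [Prog.bound, max_le_iff] at hp
    rw [interp]
    refine (impl_decReg h hc).seq_left ?_
    rintro m₁ t₁ ⟨h1, h2, rfl⟩
    refine (impl_clocked_loop hc hp.1 (ih hp.2) _ _ m₁ le_rfl h1).mono ?_
    rintro y m₂ t₂ ⟨h3, h4, h5, h6⟩
    refine ⟨h3.trans (Nat.sub_le _ _), h4,
        fun a ha hac => (h5 a ha hac).trans (h2 a ha hac), ?_⟩
    simp only at h6
    have h7 : x.2 - 1 - y.2 ≤ x.2 - y.2 := by omega
    have h8 := Nat.mul_le_mul_left (2 * (clockedCost p + 2)) h7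
    simp only [clockedCost]
    nlinarith

end RAM

/-! ### Programs for the reduction, and the trees that they implement -/

namespace RAM

/-! ### Counting loops and arithmetic -/

/-- The programs below work in the arrays `0, …, 63`; `L` lists the arrays that may have changed. -/
def Frame (L : List ℕ) (m m' : Mem) : Prop := ∀ a < 64, a ∉ L → m' a = m a

lemma Frame.refl (L : List ℕ) (m : Mem) : Frame L m m := fun _ _ _ => rfl

lemma Frame.trans {L : List ℕ} {m m₁ m₂ : Mem} (h : Frame L m m₁) (h' : Frame L m₁ m₂) :
    Frame L m m₂ := fun a ha haL => (h' a ha haL).trans (h a ha haL)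

lemma Frame.mono {L L' : List ℕ} {m m' : Mem} (h : Frame L m m') (hL : L ⊆ L') : Frame L' m m' :=
  fun a ha haL => h a ha fun h => haL (hL h)

lemma frame_write {L : List ℕ} {a : ℕ} (ha : a ∈ L) (m : Mem) (i x : ℕ) :
    Frame L m (write m a i x) := fun b _ hb => write_of_ne _ _ _ (by rintro rfl; exact hb ha)

lemma Frame.write {L : List ℕ} {m m' : Mem} (h : Frame L m m') {a : ℕ} (ha : a ∈ L) (i x : ℕ) :
    Frame L m (write m' a i x) := h.trans (frame_write ha _ _ _)

lemma frame_clear {L : List ℕ} {a : ℕ} (ha : a ∈ L) (m : Mem) :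
    Frame L m (Function.update m a fun _ => 0) :=
  fun b _ hb => Function.update_of_ne (by rintro rfl; exact hb ha) _ _

/-- `for i[0] := e, e - 1, …, 1 do p`. -/
def forDown (i : ℕ) (e : Expr) (p : Prog) : Prog :=
  .seq (setReg i e) (.loop (reg i) (.seq p (decReg i)))

section
variable {α : Type} {s : ℕ → α → Tree α} {Inv : ℕ → α → Mem → Prop} {i n τ : ℕ} {e : Expr}
  {p : Prog}

/-- `Φ` is a potential: a round may exceed `τ` steps by the increase of `Φ`. This serves loops whose
cost depends on the state reached, as in `impl_search`; elsewhere `Φ` is zero. The condition `hInv`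
says that the invariant ignores the counter. -/
lemma impl_loopDown (Φ : α → ℕ) (hInv : ∀ j a m x, Inv j a m → Inv j a (write m i 0 x))
    (hbody : ∀ j a m, j < n → Inv (j + 1) a m → m i 0 = j + 1 →
      Impl p m (s j a) fun a' m' t => m' i 0 = j + 1 ∧ Inv j a' m' ∧ t + Φ a ≤ τ + Φ a')
    {a : α} {m : Mem} (h : Inv n a m) (hi : m i 0 = n) :
    Impl (.loop (reg i) (.seq p (decReg i))) m (Tree.down s n a)
      fun a' m' t => Inv 0 a' m' ∧ t + Φ a ≤ n * (τ + 2) + 1 + Φ a' := by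
  induction n generalizing a m with
  | zero => exact .loop_done hi ⟨h, by omega⟩
  | succ n ih =>
    refine .loop_step (by simp [hi]) (Q := fun a' m' t => m' i 0 = n ∧ Inv n a' m' ∧
      t + Φ a ≤ τ + 1 + Φ a') ?_ ?_
    · refine (hbody n a m (by omega) h hi).seq_right fun a' m₁ t₁ h₁ => .assign ?_
      refine ⟨by simp [h₁.1], hInv _ _ _ _ h₁.2.1, by have := h₁.2.2; omega⟩
    · rintro a' m₁ t₁ ⟨h1, h2, h3⟩
      refine (ih (fun j a m hj => hbody j a m (by omega)) h2 h1).mono ?_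
      rintro a'' m₂ t₂ ⟨h4, h5⟩
      exact ⟨h4, by rw [Nat.succ_mul]; omega⟩

lemma impl_forDown (Φ : α → ℕ) (hInv : ∀ j a m x, Inv j a m → Inv j a (write m i 0 x))
    (hbody : ∀ j a m, j < n → Inv (j + 1) a m → m i 0 = j + 1 →
      Impl p m (s j a) fun a' m' t => m' i 0 = j + 1 ∧ Inv j a' m' ∧ t + Φ a ≤ τ + Φ a')
    {a : α} {m : Mem} (h : Inv n a m) (he : e.eval m = n) :
    Impl (forDown i e p) m (Tree.down s n a)
      fun a' m' t => Inv 0 a' m' ∧ t + Φ a ≤ n * (τ + 2) + 2 + Φ a' := by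
  refine Impl.seq_left (Q := fun _ m' t => Inv n a m' ∧ m' i 0 = n ∧ t = 1)
    (.assign ⟨hInv _ _ _ _ h, by simp [he], rfl⟩) ?_
  rintro m₁ t₁ ⟨h1, h2, rfl⟩
  refine (impl_loopDown Φ hInv hbody h1 h2).mono ?_
  rintro a' m' t ⟨h3, h4⟩
  exact ⟨h3, by omega⟩

lemma impl_forDown' (hInv : ∀ j a m x, Inv j a m → Inv j a (write m i 0 x))
    (hbody : ∀ j a m, j < n → Inv (j + 1) a m → m i 0 = j + 1 →
      Impl p m (s j a) fun a' m' t => m' i 0 = j + 1 ∧ Inv j a' m' ∧ t ≤ τ)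
    {a : α} {m : Mem} (h : Inv n a m) (he : e.eval m = n) :
    Impl (forDown i e p) m (Tree.down s n a)
      fun a' m' t => Inv 0 a' m' ∧ t ≤ n * (τ + 2) + 2 := by
  simpa using impl_forDown (s := s) (fun _ => 0) hInv (by simpa using hbody) h he

end

lemma Tree.down_unit (n : ℕ) : Tree.down (fun _ _ => .leaf ()) n () = .leaf () := by
  induction n with
  | zero => rfl
  | succ n ih => simpa [Tree.down] using ih

lemma det_forDown {Inv : ℕ → Mem → Prop} {i n τ : ℕ} {e : Expr} {p : Prog}
    (hInv : ∀ j m x, Inv j m → Inv j (write m i 0 x))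
    (hbody : ∀ j m, j < n → Inv (j + 1) m → m i 0 = j + 1 →
      Impl p m (.leaf ()) fun _ m' t => m' i 0 = j + 1 ∧ Inv j m' ∧ t ≤ τ)
    {m : Mem} (h : Inv n m) (he : e.eval m = n) :
    Impl (forDown i e p) m (.leaf ()) fun _ m' t => Inv 0 m' ∧ t ≤ n * (τ + 2) + 2 := by
  rw [← Tree.down_unit n]
  exact impl_forDown' (Inv := fun j _ => Inv j) (fun j _ m x => hInv j m x)
    (fun j _ m hj => hbody j m hj) h he

/-- `c` times the expression `e`. -/
def Expr.scale : ℕ → Expr → Expr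
  | 0, _ => .const 0
  | c + 1, e => (Expr.scale c e).add e

@[simp] lemma eval_scale (m : Mem) (c : ℕ) (e : Expr) : (e.scale c).eval m = c * e.eval m := by
  induction c with
  | zero => simp [Expr.scale]
  | succ c ih => simp [Expr.scale, ih, Nat.succ_mul]

/-- An expression that is nonzero if and only if both given ones are. -/
def Expr.and (e e' : Expr) : Expr := e.sub (e.sub e')

lemma eval_and_ne_zero (m : Mem) (e e' : Expr) :
    (e.and e').eval m ≠ 0 ↔ e.eval m ≠ 0 ∧ e'.eval m ≠ 0 := by
  simp only [Expr.and, eval_sub]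
  omega

lemma eval_and_eq_zero (m : Mem) (e e' : Expr) :
    (e.and e').eval m = 0 ↔ ¬ (e.eval m ≠ 0 ∧ e'.eval m ≠ 0) := by
  rw [← eval_and_ne_zero, not_not]

/-- `o[0] := x[0] * y[0]`, with the counter `i`. -/
def mulReg (o i x y : ℕ) : Prog :=
  .seq (setReg o (.const 0)) (forDown i (reg x) (setReg o ((reg o).add (reg y))))

lemma impl_mulReg {o i x y : ℕ} (hoi : o ≠ i) (hox : x ≠ o) (hoy : y ≠ o) (hiy : y ≠ i) (hy : y < 64)
    (m : Mem) : Impl (mulReg o i x y) m (.leaf ()) fun _ m' t =>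
      m' o 0 = m x 0 * m y 0 ∧ Frame [o, i] m m' ∧ t ≤ 3 * m x 0 + 3 := by
  refine Impl.seq_left (Q := fun _ m' t => m' = write m o 0 0 ∧ t = 1) (.assign ⟨rfl, rfl⟩) ?_
  rintro m₁ t₁ ⟨rfl, rfl⟩
  refine (det_forDown (n := m x 0) (τ := 1) (Inv := fun j m' => m' o 0 + j * m y 0 =
    m x 0 * m y 0 ∧ Frame [o, i] m m') ?_ ?_ ?_ ?_).mono ?_
  · rintro j m' z ⟨h1, h2⟩
    exact ⟨by rwa [write_of_ne _ _ _ hoi], h2.write (by simp) _ _⟩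
  · rintro j m' - ⟨h1, h2⟩ h3
    refine .assign ⟨by rwa [write_of_ne _ _ _ hoi.symm], ⟨?_, h2.write (by simp) _ _⟩, le_rfl⟩
    have h4 : m' y 0 = m y 0 := by rw [h2 y hy (by simp [hoy, hiy])]
    simp only [eval_const, eval_add, eval_reg, write_same, h4]
    rw [← h1]; ring
  · exact ⟨by simp, (Frame.refl _ _).write (by simp) _ _⟩
  · simp [write_of_ne _ _ _ hox]
  · rintro - m' t ⟨⟨h1, h2⟩, h3⟩
    exact ⟨by simpa using h1, h2, by omega⟩

/-- `o[0] := 2 ^ e`, with the counter `i`. -/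
def powReg (o i : ℕ) (e : Expr) : Prog :=
  .seq (setReg o (.const 1)) (forDown i e (setReg o ((reg o).add (reg o))))

lemma impl_powReg {o i x : ℕ} {e : Expr} (hoi : o ≠ i) (m : Mem)
    (he : e.eval (write m o 0 1) = x) :
    Impl (powReg o i e) m (.leaf ()) fun _ m' t =>
      m' o 0 = 2 ^ x ∧ Frame [o, i] m m' ∧ t ≤ 3 * x + 3 := by
  refine Impl.seq_left (Q := fun _ m' t => m' = write m o 0 1 ∧ t = 1) (.assign ⟨rfl, rfl⟩) ?_
  rintro m₁ t₁ ⟨rfl, rfl⟩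
  refine (det_forDown (n := x) (τ := 1) (Inv := fun j m' => m' o 0 * 2 ^ j = 2 ^ x ∧
    Frame [o, i] m m') ?_ ?_ ?_ he).mono ?_
  · rintro j m' z ⟨h1, h2⟩
    exact ⟨by rwa [write_of_ne _ _ _ hoi], h2.write (by simp) _ _⟩
  · rintro j m' - ⟨h1, h2⟩ h3
    refine .assign ⟨by rwa [write_of_ne _ _ _ hoi.symm], ⟨?_, h2.write (by simp) _ _⟩, le_rfl⟩
    simp only [eval_const, eval_add, eval_reg, write_same]
    rw [← h1]; ring
  · exact ⟨by simp, (Frame.refl _ _).write (by simp) _ _⟩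
  · rintro - m' t ⟨⟨h1, h2⟩, h3⟩
    exact ⟨by simpa using h1, h2, by omega⟩

/-- Make the arrays `s, …, s + K - 1` fresh. -/
def clearFrom (s : ℕ) : ℕ → Prog
  | 0 => .skip
  | K + 1 => .seq (clearFrom s K) (.clear (K + s))

lemma impl_clearFrom (s K : ℕ) (m : Mem) :
    Impl (clearFrom s K) m (.leaf ()) fun _ m' t =>
      (∀ a < K, m' (a + s) = fun _ => 0) ∧ (∀ a < s, m' a = m a) ∧ t = K + 1 := by
  induction K with
  | zero => exact .skip ⟨by simp, fun _ _ => rfl, rfl⟩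
  | succ K ih =>
    refine ih.seq_left ?_
    rintro m₁ t₁ ⟨h1, h2, rfl⟩
    refine .clear ⟨fun a ha => ?_, fun a ha => ?_, rfl⟩
    · by_cases haK : a = K
      · simp [haK]
      · rw [Function.update_of_ne (by omega), h1 a (by omega)]
    · rw [Function.update_of_ne (by omega), h2 a ha]

/-! ### Sampling -/

/-- A number with `r` random binary digits. -/
def numTree (r : ℕ) : Tree ℕ :=
  .down (fun _ v => (Tree.flip .leaf).map fun c => v + v + c.toNat) r 0

/-- Independent samples, written into the first `n` entries of an array. -/
def arrTree {V : Type} (S : Tree V) (n : ℕ) (f : ℕ → V) : Tree (ℕ → V) :=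
  .down (fun j f => S.map fun v => Function.update f j v) n f

/-- `o[0] := ` a number with `e` random binary digits, with the counter `i` and the bit `c`. -/
def sampleNum (o i c : ℕ) (e : Expr) : Prog :=
  .seq (setReg o (.const 0)) (forDown i e
    (.seq (.coin c (.const 0)) (setReg o (((reg o).add (reg o)).add (reg c)))))

lemma impl_sampleNum {o i c x : ℕ} {e : Expr} (hoi : o ≠ i) (hoc : o ≠ c) (hic : i ≠ c) (m : Mem)
    (he : e.eval (write m o 0 0) = x) :
    Impl (sampleNum o i c e) m (numTree x) fun v m' t =>
      m' o 0 = v ∧ Frame [o, i, c] m m' ∧ t ≤ 4 * x + 3 := by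
  refine Impl.seq_left (Q := fun _ m' t => m' = write m o 0 0 ∧ t = 1) (.assign ⟨rfl, rfl⟩) ?_
  rintro m₁ t₁ ⟨rfl, rfl⟩
  refine (impl_forDown' (n := x) (τ := 2) (Inv := fun _ v m' => m' o 0 = v ∧
    Frame [o, i, c] m m') ?_ ?_ ?_ he).mono ?_
  · rintro j v m' z ⟨h1, h2⟩
    exact ⟨by rwa [write_of_ne _ _ _ hoi], h2.write (by simp) _ _⟩
  · rintro j v m' - ⟨h1, h2⟩ h3
    refine Impl.map (Impl.seq_right (Q := fun b m'' t => m'' = write m' c 0 b.toNat ∧ t = 1)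
      (.coin fun b => ⟨rfl, rfl⟩) ?_)
    rintro b m₁ t₁ ⟨rfl, rfl⟩
    refine .assign ⟨?_, ⟨?_, (h2.write (by simp) _ _).write (by simp) _ _⟩, le_rfl⟩
    · rwa [write_of_ne _ _ _ hoi.symm, write_of_ne _ _ _ hic]
    · simp [write_of_ne _ _ _ hoc, h1]
  · exact ⟨by simp, (Frame.refl _ _).write (by simp) _ _⟩
  · rintro v m' t ⟨⟨h1, h2⟩, h3⟩
    exact ⟨h1, h2, by omega⟩

end RAM

namespace RAM

/-! ### The registers and arrays of the distinguisher

The number of vertices is in `0[0]`; the simulated algorithm uses the arrays from `64` on. -/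

notation "vU" => 3
notation "vM" => 4
notation "vMin" => 5
notation "vB" => 6
notation "vUB" => 7
notation "vN" => 8
notation "vT" => 9
notation "vK" => 10
notation "vE" => 11
notation "vTup" => 12
notation "vH" => 13
notation "vRnd" => 14
notation "vPl" => 15
notation "vFound" => 16
notation "vPass" => 17
notation "vClock" => 18
notation "vRep" => 19
notation "vTrial" => 20
notation "vSize" => 21
notation "vStep" => 22
notation "vI" => 23
notation "vJ" => 24
notation "vA" => 25
notation "vC" => 26
notation "vP" => 27
notation "vS" => 28
notation "vX" => 29
notation "vY" => 30
notation "vZ" => 31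
notation "vOk" => 32
notation "vL" => 33
notation "vNL" => 34
notation "vCnt" => 35
notation "vEdg" => 36

/-- The predecessor of `a[0]`. -/
def pre (a : ℕ) : Expr := (reg a).sub (.const 1)

@[simp] lemma eval_pre (m : Mem) (a : ℕ) : (pre a).eval m = m a 0 - 1 := rfl

/-! ### Sampling tuples and graphs -/

/-- Sample the tuples, as one array; every entry has `d u` binary digits. -/
def sampleTuples (d : ℕ) : Prog :=
  .seq (setReg vL ((reg vB).scale (2 * d))) <| .seq (mulReg vNL vS vN vL) <| .seq (.clear vTup) <|
    forDown vI (reg vNL) <| .seq (sampleNum vX vC vY ((reg vU).scale d)) <|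
      .assign vTup (pre vI) (reg vX)

lemma impl_sampleTuples (d : ℕ) (m : Mem) {u b N : ℕ} (hu : m vU 0 = u) (hb : m vB 0 = b)
    (hN : m vN 0 = N) :
    Impl (sampleTuples d) m (arrTree (numTree (d * u)) (N * (2 * d * b)) fun _ => 0) fun f m' t =>
      m' vTup = f ∧ m' vL 0 = 2 * d * b ∧
      Frame [vL, vNL, vS, vTup, vI, vX, vC, vY] m m' ∧
      t ≤ 3 * N + 7 + N * (2 * d * b) * (4 * (d * u) + 6) := by
  refine Impl.seq_left (Q := fun _ m' t => m' = write m vL 0 (2 * d * b) ∧ t = 1)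
    (.assign ⟨by simp [hb], rfl⟩) ?_
  rintro m₁ t₁ ⟨rfl, rfl⟩
  refine (impl_mulReg (by decide) (by decide) (by decide) (by decide) (by decide) _).seq_left ?_
  rintro m₂ t₂ ⟨h1, h2, h3⟩
  simp only [write_of_ne _ _ _ (show (8 : ℕ) ≠ 33 by decide), hN, write_same] at h1 h3
  have hF : Frame [vL, vNL, vS, vTup, vI, vX, vC, vY] m m₂ :=
    (frame_write (by simp) _ _ _).trans (h2.mono (by simp))
  have hL : m₂ vL 0 = 2 * d * b := by rw [h2 _ (by decide) (by decide), write_same]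
  refine Impl.seq_left (Q := fun _ m' t => m' = Function.update m₂ vTup (fun _ => 0) ∧ t = 1)
    (.clear ⟨rfl, rfl⟩) ?_
  rintro m₃ t₃ ⟨rfl, rfl⟩
  refine (impl_forDown' (τ := 4 * (d * u) + 4) (Inv := fun _ f m' => m' vTup = f ∧
    m' vL 0 = 2 * d * b ∧ Frame [vL, vNL, vS, vTup, vI, vX, vC, vY] m m') ?_ ?_ ?_ ?_).mono ?_
  · rintro j f m' x ⟨h4, h5, h6⟩
    exact ⟨by rwa [write_of_ne _ _ _ (by decide)], by rwa [write_of_ne _ _ _ (by decide)],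
      h6.write (by simp) _ _⟩
  · rintro j f m' - ⟨h4, h5, h6⟩ h7
    refine Impl.map ((impl_sampleNum (x := d * u) (by decide) (by decide) (by decide) _
      ?_).seq_right ?_)
    · simp [write_of_ne, h6 vU (by decide) (by decide), hu]
    · rintro v m₄ t₄ ⟨h8, h9, h10⟩
      refine .assign ⟨?_, ⟨?_, ?_, ?_⟩, by omega⟩
      · rw [write_of_ne _ _ _ (by decide), h9 _ (by decide) (by decide), h7]
      · funext k
        rw [write_apply, Function.update_apply, eval_pre, h9 vI (by decide) (by decide), h7,
          h9 vTup (by decide) (by decide), h4, eval_reg, h8, Nat.add_sub_cancel]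
      · rw [write_of_ne _ _ _ (by decide), h9 _ (by decide) (by decide), h5]
      · exact (h6.trans (h9.mono (by simp))).write (by simp) _ _
  · refine ⟨by simp, by simp [hL], hF.trans (frame_clear (by simp) _)⟩
  · simp [h1]
  · rintro f m' t ⟨⟨h4, h5, h6⟩, h7⟩
    exact ⟨h4, h5, h6, by linarith⟩

/-- Sample the adjacency bits of a random graph. -/
def sampleBits : Prog :=
  .seq (mulReg vNL vS 0 0) <| .seq (.clear vRnd) <| forDown vI (reg vNL) <| .coin vRnd (pre vI)

/-- A random bit, as a number. -/
def bitTree : Tree ℕ := (Tree.flip .leaf).map Bool.toNat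

lemma impl_sampleBits (m : Mem) {n : ℕ} (hn : m 0 0 = n) :
    Impl sampleBits m (arrTree bitTree (n * n) fun _ => 0) fun f m' t =>
      m' vRnd = f ∧ Frame [vNL, vS, vI, vRnd] m m' ∧ t ≤ 3 * n + 6 + n * n * 3 := by
  refine (impl_mulReg (by decide) (by decide) (by decide) (by decide) (by decide) _).seq_left ?_
  rintro m₂ t₂ ⟨h1, h2, h3⟩
  rw [hn] at h1 h3
  refine Impl.seq_left (Q := fun _ m' t => m' = Function.update m₂ vRnd (fun _ => 0) ∧ t = 1)
    (.clear ⟨rfl, rfl⟩) ?_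
  rintro m₃ t₃ ⟨rfl, rfl⟩
  refine (impl_forDown' (τ := 1) (Inv := fun _ f m' => m' vRnd = f ∧
    Frame [vNL, vS, vI, vRnd] m m') ?_ ?_ ?_ ?_).mono ?_
  · rintro j f m' x ⟨h4, h6⟩
    exact ⟨by rwa [write_of_ne _ _ _ (by decide)], h6.write (by simp) _ _⟩
  · rintro j f m' - ⟨h4, h6⟩ h7
    refine Impl.map (Impl.map (.coin fun b => ⟨?_, ⟨?_, h6.write (by simp) _ _⟩, le_rfl⟩))
    · rwa [write_of_ne _ _ _ (by decide)]
    · funext k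
      rw [write_apply, Function.update_apply, eval_pre, h7, h4, Nat.add_sub_cancel]
  · exact ⟨by simp, (h2.mono (by simp)).trans (frame_clear (by simp) _)⟩
  · simp [h1]
  · rintro f m' t ⟨⟨h4, h6⟩, h7⟩
    exact ⟨h4, h6, by omega⟩

/-! ### Building the tuple graph -/

/-- The reflexive closure of adjacency, on numbers. -/
def ReflAdj {n : ℕ} (G : SimpleGraph (Fin n)) (x y : ℕ) : Prop :=
  ∃ (hx : x < n) (hy : y < n), x = y ∨ G.Adj ⟨x, hx⟩ ⟨y, hy⟩

lemma ReflAdj.symm {n : ℕ} {G : SimpleGraph (Fin n)} {x y : ℕ} (h : ReflAdj G x y) :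
    ReflAdj G y x := by
  obtain ⟨hx, hy, h⟩ := h
  exact ⟨hy, hx, h.imp Eq.symm SimpleGraph.Adj.symm⟩

/-- The graph on `N` tuples of length `L`, given by one array: two tuples are adjacent if every entry
of the one is equal or adjacent in `G` to every entry of the other. -/
def tupleGraph {n : ℕ} (G : SimpleGraph (Fin n)) (N L : ℕ) (f : ℕ → ℕ) : SimpleGraph (Fin N) where
  Adj i j := i ≠ j ∧ ∀ a < L, ∀ c < L, ReflAdj G (f (i * L + a)) (f (j * L + c))
  symm := ⟨fun _ _ h => ⟨h.1.symm, fun a ha c hc => (h.2 c hc a ha).symm⟩⟩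
  loopless := ⟨fun _ h => h.1 rfl⟩

/-- The bits `β` below the diagonal, with a clique planted on the first `p` vertices, give `G`. -/
def Represents {n : ℕ} (p : ℕ) (β : ℕ → ℕ) (G : SimpleGraph (Fin n)) : Prop :=
  ∀ x y, ReflAdj G x y ↔
    max x y < n ∧ (x = y ∨ max x y < p ∨ β (max x y * n + min x y) ≠ 0)

/-- `o[0] := ` the entry with index `a[0] - 1` of the tuple with index `i[0] - 1`. -/
def fetch (o i a : ℕ) : Prog :=
  .seq (setReg o (pre i)) <| .seq (mulReg vP vS o vL) <|
    setReg o (.read vTup ((reg vP).add (pre a)))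

lemma impl_fetch {o i a : ℕ} (ho : o = vX ∨ o = vY) (hi : i = vI ∨ i = vJ) (ha : a = vA ∨ a = vC)
    (m : Mem) : Impl (fetch o i a) m (.leaf ()) fun _ m' t =>
      m' o 0 = m vTup ((m i 0 - 1) * m vL 0 + (m a 0 - 1)) ∧ Frame [o, vP, vS] m m' ∧
      t ≤ 3 * m i 0 + 5 := by
  have ho' : o ∉ [vP, vS, vI, vJ, vL, vTup, vA, vC] := by rcases ho with rfl | rfl <;> decide
  have hi' : i < 64 ∧ i ∉ [o, vP, vS, vX, vY, vL, vTup, vA, vC] := by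
    rcases hi with rfl | rfl <;> rcases ho with rfl | rfl <;> decide
  have ha' : a < 64 ∧ a ∉ [o, vP, vS, vX, vY, vL, vTup, vI, vJ] := by
    rcases ha with rfl | rfl <;> rcases ho with rfl | rfl <;> decide
  simp only [List.mem_cons, not_or] at ho' hi' ha'
  refine Impl.seq_left (Q := fun _ m' t => m' = write m o 0 (m i 0 - 1) ∧ t = 1)
    (.assign ⟨rfl, rfl⟩) ?_
  rintro m₁ t₁ ⟨rfl, rfl⟩
  refine (impl_mulReg (by decide) (by tauto) (by decide) (by decide) (by decide) _).seq_left ?_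
  rintro m₂ t₂ ⟨h1, h2, h3⟩
  have hL : (vL : ℕ) ≠ o := by tauto
  rw [write_same, write_of_ne _ _ _ hL] at h1
  rw [write_same] at h3
  have hF : Frame [o, vP, vS] m m₂ := (frame_write (by simp) _ _ _).trans (h2.mono (by simp))
  refine .assign ⟨?_, hF.write (by simp) _ _, by omega⟩
  simp only [eval_const, write_same, eval_read, eval_add, eval_reg, eval_pre, h1]
  rw [hF a ha'.1 (by simp; tauto), hF vTup (by decide) (by simp; tauto)]

/-- Reset `vOk[0]` unless the chosen entries of the chosen tuples are equal or adjacent; the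
adjacency bits are in `g`. -/
def checkPair (g : ℕ) : Prog :=
  .seq (fetch vX vI vA) <| .seq (fetch vY vJ vC) <|
  .seq (setReg vZ ((reg vX).add ((reg vY).sub (reg vX)))) <| .seq (mulReg vP vS 0 vZ) <|
  .ite (((reg 0).sub (reg vZ)).and
    ((((Expr.const 1).sub ((reg vZ).sub ((reg vX).sub ((reg vX).sub (reg vY))))).add
      ((reg vPl).sub (reg vZ))).add
        (.read g ((reg vP).add ((reg vX).sub ((reg vX).sub (reg vY)))))))
    .skip (setReg vOk (.const 0))

/-- The facts about the memory that are used while the tuple graph is built. -/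
structure TupleEnv {n : ℕ} (G : SimpleGraph (Fin n)) (g N L : ℕ) (f : ℕ → ℕ) (m : Mem) : Prop where
  g_eq : g = 1 ∨ g = vRnd
  n_eq : m 0 0 = n
  N_eq : m vN 0 = N
  L_eq : m vL 0 = L
  f_eq : m vTup = f
  rep : Represents (m vPl 0) (m g) G

lemma TupleEnv.frame {n : ℕ} {G : SimpleGraph (Fin n)} {g N L : ℕ} {f : ℕ → ℕ} {m m' : Mem}
    (h : TupleEnv G g N L f m) {l : List ℕ} (hF : Frame l m m')
    (hl : ∀ a ∈ [0, 1, vRnd, vN, vL, vTup, vPl], a ∉ l) : TupleEnv G g N L f m' where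
  g_eq := h.g_eq
  n_eq := by rw [hF _ (by decide) (hl _ (by simp)), h.n_eq]
  N_eq := by rw [hF _ (by decide) (hl _ (by simp)), h.N_eq]
  L_eq := by rw [hF _ (by decide) (hl _ (by simp)), h.L_eq]
  f_eq := by rw [hF _ (by decide) (hl _ (by simp)), h.f_eq]
  rep := by
    have h1 : g < 64 ∧ g ∈ [0, 1, vRnd, vN, vL, vTup, vPl] := by
      rcases h.g_eq with rfl | rfl <;> decide
    rw [hF vPl (by decide) (hl _ (by simp)), hF g h1.1 (hl _ h1.2)]
    exact h.rep

lemma impl_checkPair {n : ℕ} {G : SimpleGraph (Fin n)} {g N L : ℕ} {f : ℕ → ℕ} {m : Mem}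
    (h : TupleEnv G g N L f m) {i j a c : ℕ} (hi : m vI 0 = i + 1) (hj : m vJ 0 = j + 1)
    (ha : m vA 0 = a + 1) (hc : m vC 0 = c + 1) :
    Impl (checkPair g) m (.leaf ()) fun _ m' t =>
      (m' vOk 0 ≠ 0 ↔ m vOk 0 ≠ 0 ∧ ReflAdj G (f (i * L + a)) (f (j * L + c))) ∧
      Frame [vX, vY, vZ, vP, vS, vOk] m m' ∧ t ≤ 3 * i + 3 * j + 3 * n + 22 := by
  refine (impl_fetch (.inl rfl) (.inl rfl) (.inl rfl) m).seq_left ?_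
  rintro m₁ t₁ ⟨h1, h2, h3⟩
  rw [hi, ha, h.L_eq, h.f_eq, Nat.add_sub_cancel, Nat.add_sub_cancel] at h1
  rw [hi] at h3
  have e₁ := h.frame h2 (by decide)
  refine (impl_fetch (.inr rfl) (.inr rfl) (.inr rfl) m₁).seq_left ?_
  rintro m₂ t₂ ⟨h4, h5, h6⟩
  rw [h2 vJ (by decide) (by decide), hj, h2 vC (by decide) (by decide), hc, e₁.L_eq, e₁.f_eq,
    Nat.add_sub_cancel, Nat.add_sub_cancel] at h4
  rw [h2 vJ (by decide) (by decide), hj] at h6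
  have e₂ := e₁.frame h5 (by decide)
  have hx : m₂ vX 0 = f (i * L + a) := by rw [h5 _ (by decide) (by decide), h1]
  set x := f (i * L + a) with hxdef
  set y := f (j * L + c) with hydef
  refine Impl.seq_left (Q := fun _ m' t => m' = write m₂ vZ 0 (max x y) ∧ t = 1)
    (.assign ⟨by congr 1; simp only [eval_add, eval_reg, eval_sub, hx, h4]; omega, rfl⟩) ?_
  rintro m₃ t₃ ⟨rfl, rfl⟩
  have h7 : Frame [vZ] m₂ (write m₂ vZ 0 (max x y)) := frame_write (by simp) _ _ _
  have e₃ := e₂.frame h7 (by decide)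
  refine (impl_mulReg (by decide) (by decide) (by decide) (by decide) (by decide) _).seq_left ?_
  rintro m₄ t₄ ⟨h8, h9, h10⟩
  have e₄ := e₃.frame h9 (by decide)
  rw [e₃.n_eq, write_same] at h8
  rw [e₃.n_eq] at h10
  have hx4 : m₄ vX 0 = x := by
    rw [h9 _ (by decide) (by decide), h7 _ (by decide) (by decide), hx]
  have hy4 : m₄ vY 0 = y := by
    rw [h9 _ (by decide) (by decide), h7 _ (by decide) (by decide), h4]
  have hz4 : m₄ vZ 0 = max x y := by rw [h9 _ (by decide) (by decide), write_same]
  have hF4 : Frame [vX, vY, vZ, vP, vS, vOk] m m₄ :=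
    (((h2.mono (by simp)).trans (h5.mono (by simp))).trans (h7.mono (by simp))).trans
      (h9.mono (by simp))
  have hok : m₄ vOk 0 = m vOk 0 := by
    rw [h9 _ (by decide) (by decide), h7 _ (by decide) (by decide), h5 _ (by decide) (by decide),
      h2 _ (by decide) (by decide)]
  have hmin : x - (x - y) = min x y := by omega
  -- Comparisons by truncated subtraction: `n - max` is nonzero if both entries are vertices, `1 -
  -- (max - min)` if they are equal, `pl - max` if both lie in the planted clique. A sum is nonzero
  -- if and only if some summand is.
  have hcond : (m₄ 0 0 - m₄ vZ 0 ≠ 0 ∧ (1 - (m₄ vZ 0 - (m₄ vX 0 - (m₄ vX 0 - m₄ vY 0)))) +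
      (m₄ vPl 0 - m₄ vZ 0) + m₄ g (m₄ vP 0 + (m₄ vX 0 - (m₄ vX 0 - m₄ vY 0))) ≠ 0) ↔
      ReflAdj G x y := by
    rw [e₄.rep x y, e₄.n_eq, hz4, hx4, hy4, h8, hmin, mul_comm n]
    refine and_congr (by omega) ?_
    generalize m₄ g (max x y * n + min x y) = z
    omega
  refine .ite (fun hp => ?_) (fun hp => ?_)
  · rw [eval_and_ne_zero] at hp
    simp only [eval_sub, eval_reg, eval_add, eval_const, eval_read] at hp
    rw [hcond] at hp
    exact .skip ⟨by rw [hok]; tauto, hF4, by omega⟩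
  · rw [eval_and_eq_zero] at hp
    simp only [eval_sub, eval_reg, eval_add, eval_const, eval_read] at hp
    rw [hcond] at hp
    exact .assign ⟨by simp; tauto, hF4.write (by simp) _ _, by omega⟩

/-- Set `vOk[0]` to a nonzero number if the chosen tuples are adjacent, and else to zero. -/
def checkTuples (g : ℕ) : Prog :=
  .seq (setReg vOk (((reg vI).sub (reg vJ)).add ((reg vJ).sub (reg vI)))) <|
    forDown vA (reg vL) <| forDown vC (reg vL) <| checkPair g

lemma impl_checkTuples {n : ℕ} {G : SimpleGraph (Fin n)} {g N L : ℕ} {f : ℕ → ℕ} {m : Mem}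
    (h : TupleEnv G g N L f m) {i j : Fin N} (hi : m vI 0 = i + 1) (hj : m vJ 0 = j + 1) :
    Impl (checkTuples g) m (.leaf ()) fun _ m' t =>
      (m' vOk 0 ≠ 0 ↔ (tupleGraph G N L f).Adj i j) ∧
      Frame [vX, vY, vZ, vP, vS, vOk, vA, vC] m m' ∧
      t ≤ 3 + L * (L * (6 * N + 3 * n + 24) + 4) := by
  -- The start value is the distance of the two indices, which is nonzero exactly if they differ.
  refine Impl.seq_left (Q := fun _ m' t =>
    m' = write m vOk 0 ((m vI 0 - m vJ 0) + (m vJ 0 - m vI 0)) ∧ t = 1) (.assign ⟨rfl, rfl⟩) ?_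
  rintro m₁ t₁ ⟨rfl, rfl⟩
  let P : ℕ → ℕ → Prop := fun a c => ReflAdj G (f (i * L + a)) (f (j * L + c))
  -- The counters run downwards, so the entries already compared are those with index at least `r`.
  refine (det_forDown (n := L) (τ := L * (6 * N + 3 * n + 24) + 2)
    (Inv := fun r m' => (m' vOk 0 ≠ 0 ↔ i ≠ j ∧ ∀ a < L, r ≤ a → ∀ c < L, P a c) ∧
      Frame [vX, vY, vZ, vP, vS, vOk, vA, vC] m m') ?_ ?_ ?_ ?_).mono ?_
  · rintro r m' x ⟨h1, h2⟩
    exact ⟨by rwa [write_of_ne _ _ _ (by decide)], h2.write (by simp) _ _⟩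
  · rintro a m' ha ⟨h1, h2⟩ h3
    refine (det_forDown (n := L) (τ := 6 * N + 3 * n + 22)
      (Inv := fun r m' => (m' vOk 0 ≠ 0 ↔ (i ≠ j ∧ ∀ a' < L, a + 1 ≤ a' → ∀ c < L, P a' c) ∧
        ∀ c < L, r ≤ c → P a c) ∧ m' vA 0 = a + 1 ∧
        Frame [vX, vY, vZ, vP, vS, vOk, vA, vC] m m') ?_ ?_ ?_ ?_).mono ?_
    · rintro r m' x ⟨h1, h2, h3⟩
      exact ⟨by rwa [write_of_ne _ _ _ (by decide)], by rwa [write_of_ne _ _ _ (by decide)],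
        h3.write (by simp) _ _⟩
    · rintro c m' hc ⟨h1, h2, h3⟩ h4
      refine (impl_checkPair (h.frame h3 (by decide)) (i := i) (j := j)
        (by rw [h3 _ (by decide) (by decide), hi]) (by rw [h3 _ (by decide) (by decide), hj])
        h2 h4).mono ?_
      rintro - m'' t ⟨h5, h6, h7⟩
      refine ⟨by rw [h6 _ (by decide) (by decide), h4], ⟨?_, ?_, h3.trans (h6.mono (by simp))⟩, ?_⟩
      · rw [h5, h1, and_assoc]
        refine and_congr Iff.rfl ⟨fun hh c' hc' hcc => ?_, fun hh => ⟨fun c' hc' hcc =>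
          hh c' hc' (by omega), hh c hc le_rfl⟩⟩
        rcases hcc.eq_or_lt with rfl | hlt
        · exact hh.2
        · exact hh.1 c' hc' hlt
      · rw [h6 _ (by decide) (by decide), h2]
      · have := i.2
        have := j.2
        omega
    · refine ⟨?_, h3, h2⟩
      rw [h1]
      exact ⟨fun hh => ⟨hh, fun c hc hcc => by omega⟩, fun hh => hh.1⟩
    · simp [(h.frame h2 (by decide)).L_eq]
    · rintro - m' t ⟨⟨h4, h5, h6⟩, h7⟩
      refine ⟨h5, ⟨?_, h6⟩, h7⟩
      rw [h4, and_assoc]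
      refine and_congr Iff.rfl ⟨fun hh a' ha' haa => ?_, fun hh => ⟨fun a' ha' haa =>
          hh a' ha' (by omega), fun c hc _ => hh a ha le_rfl c hc⟩⟩
      rcases haa.eq_or_lt with rfl | hlt
      · exact fun c hc => hh.2 c hc (Nat.zero_le _)
      · exact hh.1 a' ha' hlt
  · refine ⟨?_, frame_write (by simp) _ _ _⟩
    rw [write_same, hi, hj]
    have : i ≠ j ↔ (i : ℕ) ≠ j := by rw [Ne, Ne, Fin.ext_iff]
    rw [this]
    constructor
    · intro hh
      exact ⟨by omega, fun a ha haa => by omega⟩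
    · rintro ⟨hh, -⟩
      omega
  · simp [write_of_ne, h.L_eq]
  · rintro - m' t ⟨⟨h4, h5⟩, h6⟩
    refine ⟨?_, h5, by linarith⟩
    rw [h4]
    simp [tupleGraph, P]

end RAM

/-! ### The encoding of graphs in memory, and the simulation of the algorithm -/

namespace RAM

/-- The memory on the input `(G, k)`. -/
noncomputable def inputMem {n : ℕ} (G : SimpleGraph (Fin n)) (k : ℕ) : Mem :=
  (input G k fun _ => false).mem

lemma input_eq {n : ℕ} (G : SimpleGraph (Fin n)) (k : ℕ) (ω : ℕ → Bool) :
    input G k ω = ⟨inputMem G k, ω⟩ := rfl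

lemma mul_add_inj {n a b c d : ℕ} (hb : b < n) (hd : d < n) (h : a * n + b = c * n + d) :
    a = c ∧ b = d := by
  have h1 : (a * n + b) / n = a := by
    rw [mul_comm, Nat.mul_add_div (by omega), Nat.div_eq_of_lt hb, add_zero]
  have h2 : (c * n + d) / n = c := by
    rw [mul_comm, Nat.mul_add_div (by omega), Nat.div_eq_of_lt hd, add_zero]
  have h3 : a = c := by rw [← h1, h, h2]
  subst h3
  exact ⟨rfl, by omega⟩

open Classical in
lemma inputMem_one {n : ℕ} (G : SimpleGraph (Fin n)) (k : ℕ) (i j : Fin n) :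
    inputMem G k 1 (i * n + j) = if G.Adj i j then 1 else 0 := by
  simp only [inputMem, input, one_ne_zero, if_false, if_true]
  congr 1
  refine propext ⟨?_, fun h => ⟨i, j, h, rfl⟩⟩
  rintro ⟨u, v, h, huv⟩
  obtain ⟨h1, h2⟩ := mul_add_inj j.2 v.2 huv
  rwa [Fin.ext h1, Fin.ext h2]

lemma inputMem_one_of_le {n : ℕ} (G : SimpleGraph (Fin n)) (k : ℕ) {i : ℕ} (hi : n * n ≤ i) :
    inputMem G k 1 i = 0 := by
  simp only [inputMem, input, one_ne_zero, if_false, if_true, ite_eq_right_iff]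
  rintro ⟨u, v, -, rfl⟩
  have h1 : (u + 1 : ℕ) * n ≤ n * n := Nat.mul_le_mul_right _ u.2
  have h2 := v.2
  rw [Nat.succ_mul] at h1
  omega

/-! ### The adjacency matrix of the tuple graph -/

/-- Store `vOk[0]`, as a bit, at the chosen position of the matrix `vH`. -/
def storeEntry : Prog :=
  .seq (setReg vX (pre vI)) <| .seq (mulReg vP vS vX vN) <|
    .assign vH ((reg vP).add (pre vJ)) ((Expr.const 1).sub ((Expr.const 1).sub (reg vOk)))

/-- Compute the adjacency matrix of the tuple graph. -/
def buildMatrix (g : ℕ) : Prog :=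
  .seq (.clear vH) <| forDown vI (reg vN) <| forDown vJ (reg vN) <|
    .seq (checkTuples g) storeEntry

/-- The arrays changed by `buildMatrix`. -/
abbrev buildList : List ℕ := [vX, vY, vZ, vP, vS, vOk, vA, vC, vH, vI, vJ]

lemma impl_storeEntry {m : Mem} {i j N : ℕ} (hi : m vI 0 = i + 1) (hj : m vJ 0 = j + 1)
    (hN : m vN 0 = N) :
    Impl storeEntry m (.leaf ()) fun _ m' t =>
      m' vH = Function.update (m vH) (i * N + j) (1 - (1 - m vOk 0)) ∧
      Frame [vX, vP, vS, vH] m m' ∧ t ≤ 3 * i + 5 := by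
  refine Impl.seq_left (Q := fun _ m' t => m' = write m vX 0 i ∧ t = 1)
    (.assign ⟨by simp [hi], rfl⟩) ?_
  rintro m₁ t₁ ⟨rfl, rfl⟩
  refine (impl_mulReg (by decide) (by decide) (by decide) (by decide) (by decide) _).seq_left ?_
  rintro m₂ t₂ ⟨h1, h2, h3⟩
  rw [write_same, write_of_ne _ _ _ (by decide), hN] at h1
  rw [write_same] at h3
  have hF : Frame [vX, vP, vS, vH] m m₂ :=
    (frame_write (by simp) _ _ _).trans (h2.mono (by simp))
  refine .assign ⟨?_, hF.write (by simp) _ _, by omega⟩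
  have h4 : m₂ vH = m vH := by
    rw [h2 _ (by decide) (by decide), write_of_ne _ _ _ (by decide)]
  have h5 : m₂ vJ = m vJ := by
    rw [h2 _ (by decide) (by decide), write_of_ne _ _ _ (by decide)]
  have h6 : m₂ vOk = m vOk := by
    rw [h2 _ (by decide) (by decide), write_of_ne _ _ _ (by decide)]
  funext x
  simp only [write_apply, Function.update_apply, eval_add, eval_reg, eval_pre, h1, h5, hj, h4,
    Nat.add_sub_cancel, eval_sub, eval_const, h6]

lemma impl_buildMatrix {n : ℕ} {G : SimpleGraph (Fin n)} {g N L : ℕ} {f : ℕ → ℕ} {m : Mem}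
    (h : TupleEnv G g N L f m) (k : ℕ) :
    Impl (buildMatrix g) m (.leaf ()) fun _ m' t =>
      m' vH = inputMem (tupleGraph G N L f) k 1 ∧ Frame buildList m m' ∧
      t ≤ 3 + N * (N * (3 * N + 10 + L * (L * (6 * N + 3 * n + 24) + 4)) + 4) := by
  set τ := 3 * N + 8 + L * (L * (6 * N + 3 * n + 24) + 4) with hτ
  set F := inputMem (tupleGraph G N L f) k 1 with hFdef
  refine Impl.seq_left (Q := fun _ m' t => m' = Function.update m vH (fun _ => 0) ∧ t = 1)
    (.clear ⟨rfl, rfl⟩) ?_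
  rintro m₁ t₁ ⟨rfl, rfl⟩
  -- Rows are filled from the last to the first; positions before `r * N` are still zero.
  refine (det_forDown (n := N) (τ := N * (τ + 2) + 2)
    (Inv := fun r m' => (∀ x, m' vH x = if r * N ≤ x then F x else 0) ∧ Frame buildList m m')
    ?_ ?_ ?_ ?_).mono ?_
  · rintro r m' x ⟨h1, h2⟩
    exact ⟨by rwa [write_of_ne _ _ _ (by decide)], h2.write (by simp) _ _⟩
  · rintro i m' hi ⟨h1, h2⟩ h3
    refine (det_forDown (n := N) (τ := τ)
      (Inv := fun r m' => (∀ x, m' vH x = if i * N + r ≤ x then F x else 0) ∧ m' vI 0 = i + 1 ∧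
        Frame buildList m m') ?_ ?_ ?_ ?_).mono ?_
    · rintro r m' x ⟨h1, h2, h3⟩
      exact ⟨by rwa [write_of_ne _ _ _ (by decide)], by rwa [write_of_ne _ _ _ (by decide)],
        h3.write (by simp) _ _⟩
    · rintro j m' hj ⟨h1, h2, h3⟩ h4
      refine (impl_checkTuples (h.frame h3 (by decide)) (i := ⟨i, hi⟩) (j := ⟨j, hj⟩)
        h2 h4).seq_left ?_
      rintro m₂ t₂ ⟨h5, h6, h7⟩
      refine (impl_storeEntry (i := i) (j := j) (N := N)
        (by rw [h6 _ (by decide) (by decide), h2]) (by rw [h6 _ (by decide) (by decide), h4])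
        ((h.frame h3 (by decide)).frame h6 (by decide)).N_eq).mono ?_
      rintro - m₃ t₃ ⟨h8, h9, h10⟩
      refine ⟨by rw [h9 _ (by decide) (by decide), h6 _ (by decide) (by decide), h4],
        ⟨fun x => ?_, by rw [h9 _ (by decide) (by decide), h6 _ (by decide) (by decide), h2],
        (h3.trans (h6.mono (by simp))).trans (h9.mono (by simp))⟩, by linarith⟩
      rw [h8, Function.update_apply, h6 vH (by decide) (by decide), h1]
      split_ifs with hx hx1 hx2 hx2
      · subst hx
        rw [hFdef, inputMem_one (tupleGraph G N L f) k ⟨i, hi⟩ ⟨j, hj⟩]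
        by_cases hA : (tupleGraph G N L f).Adj ⟨i, hi⟩ ⟨j, hj⟩
        · rw [if_pos hA]
          have := h5.2 hA
          omega
        · rw [if_neg hA]
          have := mt h5.1 hA
          omega
      all_goals first | rfl | omega
    · refine ⟨fun x => ?_, h3, h2⟩
      rw [h1, Nat.succ_mul]
    · simp [(h.frame h2 (by decide)).N_eq]
    · rintro - m' t ⟨⟨h4, h5, h6⟩, h7⟩
      exact ⟨h5, ⟨by simpa using h4, h6⟩, h7⟩
  · refine ⟨fun x => ?_, frame_clear (by simp) _⟩
    -- Before the first round the array is zero, which is correct beyond the `N * N` matrix entries.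
    simp only [Function.update_self]
    split_ifs with hx
    · exact (inputMem_one_of_le _ _ hx).symm
    · rfl
  · simp [h.N_eq]
  · rintro - m' t ⟨⟨h4, h5⟩, h6⟩
    exact ⟨by funext x; simpa using h4 x, h5, by rw [hτ] at h6; linarith⟩

/-! ### Running the simulated algorithm -/

/-- Copy the first `vNL[0]` entries of `vH` into the input of the simulated algorithm. -/
def copyMatrix : Prog := forDown vI (reg vNL) (.assign 65 (pre vI) (.read vH (pre vI)))

lemma impl_copyMatrix {m : Mem} {r : ℕ} (hr : m vNL 0 = r) (h65 : m 65 = fun _ => 0)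
    (hH : ∀ x, r ≤ x → m vH x = 0) :
    Impl copyMatrix m (.leaf ()) fun _ m' t =>
      m' 65 = m vH ∧ (∀ a, a ≠ vI → a ≠ 65 → m' a = m a) ∧ t ≤ r * 3 + 2 := by
  refine (det_forDown (n := r) (τ := 1)
    (Inv := fun j m' => (∀ x, m' 65 x = if j ≤ x then m vH x else 0) ∧
      ∀ a, a ≠ vI → a ≠ 65 → m' a = m a) ?_ ?_ ?_ ?_).mono ?_
  · rintro j m' x ⟨h1, h2⟩
    exact ⟨by rwa [write_of_ne _ _ _ (by decide)],
      fun a ha ha' => by rw [write_of_ne _ _ _ ha, h2 a ha ha']⟩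
  · rintro j m' - ⟨h1, h2⟩ h3
    refine .assign ⟨by rwa [write_of_ne _ _ _ (by decide)], ⟨fun x => ?_, fun a ha ha' => by
      rw [write_of_ne _ _ _ ha', h2 a ha ha']⟩, le_rfl⟩
    rw [write_apply, h1, eval_pre, h3, Nat.add_sub_cancel, eval_read, eval_pre, h3,
      Nat.add_sub_cancel, h2 vH (by decide) (by decide)]
    split_ifs with hx hx1 hx2 hx2
    · rw [hx]
    all_goals first | rfl | omega
  · refine ⟨fun x => ?_, fun _ _ _ => rfl⟩
    rw [h65]
    split_ifs with hx
    · exact (hH x hx).symm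
    · rfl
  · simp [hr]
  · rintro - m' t ⟨⟨h1, h2⟩, h3⟩
    exact ⟨by funext x; simpa using h1 x, h2, h3⟩

/-- Run the clocked version of `A` on the graph with adjacency matrix `vH` and the number `vE[0]`. -/
def simulate (A : Prog) : Prog :=
  -- At least three arrays are made fresh, even if `A` mentions fewer: its arrays `0` and `1`
  -- receive the input, and its array `2` is read as output.
  .seq (mulReg vNL vS vN vN) <| .seq (clearFrom 64 (max A.bound 3)) <| .seq copyMatrix <|
    .seq (.assign 64 (.const 0) (reg vN)) <| .seq (.assign 64 (.const 1) (reg vE)) <|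
    .seq (setReg vClock (reg vT)) <| clocked 64 vClock A

lemma impl_simulate (A : Prog) {m : Mem} {N k T : ℕ} (H : SimpleGraph (Fin N)) (hN : m vN 0 = N)
    (hk : m vE 0 = k) (hT : m vT 0 = T) (hH : m vH = inputMem H k 1) :
    Impl (simulate A) m (interp A (inputMem H k, T)) fun y m' t =>
      m' 66 = y.1 2 ∧ Frame [vNL, vS, vI, vClock] m m' ∧
      t ≤ 3 * N + N * N * 3 + A.bound + 12 + clockedCost A * (T + 1) := by
  refine (impl_mulReg (by decide) (by decide) (by decide) (by decide) (by decide) _).seq_left ?_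
  rintro m₁ t₁ ⟨h1, h2, h3⟩
  rw [hN] at h1 h3
  refine (impl_clearFrom 64 (max A.bound 3) m₁).seq_left ?_
  rintro m₂ t₂ ⟨h4, h5, rfl⟩
  have hH₂ : m₂ vH = inputMem H k 1 := by
    rw [h5 _ (by decide), h2 _ (by decide) (by decide), hH]
  refine (impl_copyMatrix (r := N * N) (by rw [h5 _ (by decide), h1])
    (h4 1 (by simp)) (fun x hx => by rw [hH₂, inputMem_one_of_le _ _ hx])).seq_left ?_
  rintro m₃ t₃ ⟨h6, h7, h8⟩
  refine Impl.seq_left (Q := fun _ m' t => m' = write m₃ 64 0 N ∧ t = 1) (.assign ⟨?_, rfl⟩) ?_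
  · rw [eval_reg, h7 _ (by decide) (by decide), h5 _ (by decide), h2 _ (by decide) (by decide), hN,
      eval_const]
  rintro m₄ t₄ ⟨rfl, rfl⟩
  refine Impl.seq_left (Q := fun _ m' t => m' = write (write m₃ 64 0 N) 64 1 k ∧ t = 1)
    (.assign ⟨?_, rfl⟩) ?_
  · rw [eval_reg, write_of_ne _ _ _ (by decide), h7 _ (by decide) (by decide), h5 _ (by decide),
      h2 _ (by decide) (by decide), hk, eval_const]
  rintro m₅ t₅ ⟨rfl, rfl⟩
  refine Impl.seq_left (Q := fun _ m' t =>
    m' = write (write (write m₃ 64 0 N) 64 1 k) vClock 0 T ∧ t = 1) (.assign ⟨?_, rfl⟩) ?_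
  · rw [eval_reg, write_of_ne _ _ _ (by decide), write_of_ne _ _ _ (by decide),
      h7 _ (by decide) (by decide), h5 _ (by decide), h2 _ (by decide) (by decide), hT, eval_const]
  rintro m₆ t₆ ⟨rfl, rfl⟩
  have hS : Shifted 64 vClock (max A.bound 3) (inputMem H k, T)
      (write (write (write m₃ 64 0 N) 64 1 k) vClock 0 T) := by
    refine ⟨fun a ha => ?_, write_same _ _ _ _⟩
    rw [write_of_ne _ _ _ (by omega)]
    rcases a with _ | _ | a
    · funext x
      have h64 : m₃ 64 x = 0 := by
        rw [h7 _ (by decide) (by decide)]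
        have := congrFun (h4 0 (by simp)) x
        simpa using this
      simp only [Nat.zero_add, write_apply, h64]
      simp only [inputMem, input, if_true]
      by_cases hx0 : x = 0
      · simp [hx0]
      · simp [hx0]
    · rw [write_of_ne _ _ _ (by decide), write_of_ne _ _ _ (by decide)]
      exact h6.trans hH₂
    · rw [write_of_ne _ _ _ (by omega), write_of_ne _ _ _ (by omega), h7 _ (by omega) (by omega),
        h4 _ ha]
      simp [inputMem, input]
  refine (impl_clocked (by decide) A (le_max_left _ 3) _ _ hS).mono ?_
  rintro y m' t ⟨h9, h10, h11, h12⟩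
  refine ⟨h10.1 2 (by simp), fun a ha haL => ?_, ?_⟩
  · simp only [List.mem_cons, List.not_mem_nil, or_false, not_or] at haL
    rw [h11 a ha haL.2.2.2, write_of_ne _ _ _ haL.2.2.2, write_of_ne _ _ _ (by omega),
      write_of_ne _ _ _ (by omega), h7 a haL.2.2.1 (by omega), h5 a ha,
      h2 a ha (by simp; tauto)]
  · simp only at h12
    have h13 : clockedCost A * (T - y.2 + 1) ≤ clockedCost A * (T + 1) :=
      Nat.mul_le_mul_left _ (by omega)
    have h14 : max A.bound 3 ≤ A.bound + 3 := by omega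
    linarith

end RAM

namespace RAM

notation "vOut" => 37

/-! ### Checking the output -/

/-- Copy the output of the simulated algorithm into `vOut`. -/
def copyOutput : Prog := forDown vI (reg vN) (.assign vOut (pre vI) (.read 66 (pre vI)))

lemma impl_copyOutput {m : Mem} {N : ℕ} (hN : m vN 0 = N) :
    Impl copyOutput m (.leaf ()) fun _ m' t =>
      (∀ x < N, m' vOut x = m 66 x) ∧ Frame [vI, vOut] m m' ∧ t ≤ N * 3 + 2 := by
  refine (det_forDown (n := N) (τ := 1)
    (Inv := fun j m' => (∀ x < N, j ≤ x → m' vOut x = m 66 x) ∧ m' 66 = m 66 ∧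
      Frame [vI, vOut] m m') ?_ ?_ ?_ ?_).mono ?_
  · rintro j m' x ⟨h1, h2, h3⟩
    exact ⟨by rwa [write_of_ne _ _ _ (by decide)], by rwa [write_of_ne _ _ _ (by decide)],
      h3.write (by simp) _ _⟩
  · rintro j m' - ⟨h1, h2, h3⟩ h4
    refine .assign ⟨by rwa [write_of_ne _ _ _ (by decide)], ⟨fun x hxN hx => ?_,
      by rwa [write_of_ne _ _ _ (by decide)], h3.write (by simp) _ _⟩, le_rfl⟩
    rw [write_apply, eval_pre, h4, Nat.add_sub_cancel, eval_read, eval_pre, h4,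
      Nat.add_sub_cancel, h2]
    split_ifs with hxj
    · rw [hxj]
    · exact h1 x hxN (by omega)
  · exact ⟨fun x hx hx' => by omega, rfl, Frame.refl _ _⟩
  · simp [hN]
  · rintro - m' t ⟨⟨h1, h2, h3⟩, h4⟩
    exact ⟨fun x hx => h1 x hx (Nat.zero_le _), h3, h4⟩

/-- `o[0] := o[0] + 1` if `e` is nonzero. -/
def incIf (o : ℕ) (e : Expr) : Prog := .ite e (setReg o ((reg o).add (.const 1))) .skip

open Classical in
lemma impl_incIf {o : ℕ} {e : Expr} {P : Prop} {m : Mem} (he : e.eval m ≠ 0 ↔ P) :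
    Impl (incIf o e) m (.leaf ()) fun _ m' t =>
      m' o 0 = m o 0 + (if P then 1 else 0) ∧ Frame [o] m m' ∧ t ≤ 2 := by
  refine .ite (fun h => ?_) fun h => ?_
  · exact .assign ⟨by simp [if_pos (he.1 h)], frame_write (by simp) _ _ _, le_rfl⟩
  · have : ¬ P := fun hP => he.2 hP h
    exact .skip ⟨by simp [this], Frame.refl _ _, le_rfl⟩

/-- Count the vertices in the output. -/
def countVertices : Prog :=
  .seq (setReg vCnt (.const 0)) <| forDown vI (reg vN) <| incIf vCnt (.read vOut (pre vI))

/-- Count the ordered pairs of adjacent vertices in the output. -/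
def countEdges : Prog :=
  .seq (setReg vEdg (.const 0)) <| forDown vI (reg vN) <| forDown vJ (reg vN) <|
    .seq (setReg vX (pre vI)) <| .seq (mulReg vP vS vX vN) <|
      incIf vEdg ((Expr.read vOut (pre vI)).and
        ((Expr.read vOut (pre vJ)).and (.read vH ((reg vP).add (pre vJ)))))

open Classical in
lemma impl_countVertices {m : Mem} {N : ℕ} (hN : m vN 0 = N) :
    Impl countVertices m (.leaf ()) fun _ m' t =>
      m' vCnt 0 = ∑ i : Fin N, (if m vOut i ≠ 0 then 1 else 0) ∧ Frame [vI, vCnt] m m' ∧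
      t ≤ N * 4 + 3 := by
  refine Impl.seq_left (Q := fun _ m' t => m' = write m vCnt 0 0 ∧ t = 1) (.assign ⟨rfl, rfl⟩) ?_
  rintro m₁ t₁ ⟨rfl, rfl⟩
  set φ : ℕ → ℕ := fun i => if m vOut i ≠ 0 then 1 else 0 with hφ
  refine (det_forDown (n := N) (τ := 2) (Inv := fun j m' =>
    m' vCnt 0 + ∑ i ∈ Finset.range j, φ i = ∑ i ∈ Finset.range N, φ i ∧
      Frame [vI, vCnt] m m') ?_ ?_ ?_ ?_).mono ?_
  · rintro j m' x ⟨h1, h2⟩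
    exact ⟨by rwa [write_of_ne _ _ _ (by decide)], h2.write (by simp) _ _⟩
  · rintro j m' - ⟨h1, h2⟩ h3
    refine (impl_incIf (P := m vOut j ≠ 0) ?_).mono ?_
    · rw [eval_read, eval_pre, h3, Nat.add_sub_cancel, h2 _ (by decide) (by decide)]
    · rintro - m'' t ⟨h4, h5, h6⟩
      refine ⟨by rw [h5 _ (by decide) (by decide), h3], ⟨?_, h2.trans (h5.mono (by simp))⟩, h6⟩
      rw [h4, ← h1, Finset.sum_range_succ]
      simp only [hφ]
      ring_nf
  · exact ⟨by simp, frame_write (by simp) _ _ _⟩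
  · simp [write_of_ne, hN]
  · rintro - m' t ⟨⟨h1, h2⟩, h3⟩
    refine ⟨?_, h2, by omega⟩
    rw [Finset.sum_range_zero, add_zero] at h1
    rw [h1, Finset.sum_range]

open Classical in
lemma impl_countEdges {m : Mem} {N k : ℕ} {H : SimpleGraph (Fin N)} (hN : m vN 0 = N)
    (hH : m vH = inputMem H k 1) :
    Impl countEdges m (.leaf ()) fun _ m' t =>
      m' vEdg 0 = ∑ i : Fin N, ∑ j : Fin N,
        (if m vOut i ≠ 0 ∧ m vOut j ≠ 0 ∧ H.Adj i j then 1 else 0) ∧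
      Frame [vI, vJ, vX, vP, vS, vEdg] m m' ∧ t ≤ 3 + N * (N * (3 * N + 8) + 4) := by
  refine Impl.seq_left (Q := fun _ m' t => m' = write m vEdg 0 0 ∧ t = 1) (.assign ⟨rfl, rfl⟩) ?_
  rintro m₁ t₁ ⟨rfl, rfl⟩
  set φ : ℕ → ℕ → ℕ := fun i j =>
    if m vOut i ≠ 0 ∧ m vOut j ≠ 0 ∧ m vH (i * N + j) ≠ 0 then 1 else 0 with hφ
  refine (det_forDown (n := N) (τ := N * (3 * N + 8) + 2) (Inv := fun r m' =>
    m' vEdg 0 + ∑ i ∈ Finset.range r, ∑ j ∈ Finset.range N, φ i j =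
      ∑ i ∈ Finset.range N, ∑ j ∈ Finset.range N, φ i j ∧
      Frame [vI, vJ, vX, vP, vS, vEdg] m m') ?_ ?_ ?_ ?_).mono ?_
  · rintro j m' x ⟨h1, h2⟩
    exact ⟨by rwa [write_of_ne _ _ _ (by decide)], h2.write (by simp) _ _⟩
  · rintro i m' hi ⟨h1, h2⟩ h3
    refine (det_forDown (n := N) (τ := 3 * N + 6) (Inv := fun r m' =>
      m' vEdg 0 + ∑ j ∈ Finset.range r, φ i j + ∑ i ∈ Finset.range i, ∑ j ∈ Finset.range N, φ i j =
        ∑ i ∈ Finset.range N, ∑ j ∈ Finset.range N, φ i j ∧ m' vI 0 = i + 1 ∧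
        Frame [vI, vJ, vX, vP, vS, vEdg] m m') ?_ ?_ ?_ ?_).mono ?_
    · rintro j m' x ⟨h1, h2, h3⟩
      exact ⟨by rwa [write_of_ne _ _ _ (by decide)], by rwa [write_of_ne _ _ _ (by decide)],
        h3.write (by simp) _ _⟩
    · rintro j m' hj ⟨h1, h2, h3⟩ h4
      refine Impl.seq_left (Q := fun _ m'' t => m'' = write m' vX 0 i ∧ t = 1)
        (.assign ⟨by simp [h2], rfl⟩) ?_
      rintro m₁ t₁ ⟨rfl, rfl⟩
      refine (impl_mulReg (by decide) (by decide) (by decide) (by decide) (by decide)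
        _).seq_left ?_
      rintro m₂ t₂ ⟨h5, h6, h7⟩
      rw [write_same, write_of_ne _ _ _ (by decide), h3 vN (by decide) (by decide), hN] at h5
      rw [write_same] at h7
      have h8 : Frame [vX, vP, vS] m' m₂ :=
        (frame_write (by simp) _ _ _).trans (h6.mono (by simp))
      refine (impl_incIf (P := m vOut i ≠ 0 ∧ m vOut j ≠ 0 ∧ m vH (i * N + j) ≠ 0) ?_).mono ?_
      · rw [eval_and_ne_zero, eval_and_ne_zero]
        simp only [eval_read, eval_pre, eval_add, eval_reg]
        rw [h8 vI (by decide) (by decide), h8 vJ (by decide) (by decide),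
          h8 vH (by decide) (by decide), h8 vOut (by decide) (by decide), h2, h4, h5,
          h3 vH (by decide) (by decide), h3 vOut (by decide) (by decide), Nat.add_sub_cancel,
          Nat.add_sub_cancel]
      · rintro - m'' t ⟨h9, h10, h11⟩
        refine ⟨by rw [h10 _ (by decide) (by decide), h8 _ (by decide) (by decide), h4],
          ⟨?_, by rw [h10 _ (by decide) (by decide), h8 _ (by decide) (by decide), h2],
          (h3.trans (h8.mono (by simp))).trans (h10.mono (by simp))⟩, by omega⟩
        rw [h9, ← h1, Finset.sum_range_succ, h8 _ (by decide) (by decide)]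
        simp only [hφ]
        ring_nf
    · refine ⟨?_, h3, h2⟩
      rw [← h1, Finset.sum_range_succ]
      ring
    · rw [eval_reg, h2 _ (by decide) (by decide), hN]
    · rintro - m' t ⟨⟨h1, h2, h3⟩, h4⟩
      refine ⟨h2, ⟨?_, h3⟩, h4⟩
      simpa using h1
  · exact ⟨by simp, frame_write (by simp) _ _ _⟩
  · simp [write_of_ne, hN]
  · rintro - m' t ⟨⟨h1, h2⟩, h3⟩
    refine ⟨?_, h2, by linarith⟩
    rw [Finset.sum_range_zero, add_zero] at h1
    rw [h1, Finset.sum_range]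
    refine Finset.sum_congr rfl fun i _ => ?_
    rw [Finset.sum_range]
    refine Finset.sum_congr rfl fun j _ => ?_
    simp only [hφ, hH, inputMem_one]
    congr 1
    simp

open Classical in
/-- The array `o` describes a set of at most `k b / (4 d² u)` vertices that induces at least `k`
edges of `H`. -/
def Cert (d u b k : ℕ) {N : ℕ} (H : SimpleGraph (Fin N)) (o : Fin N → ℕ) : Prop :=
  -- The double sum counts ordered pairs, hence `2 * k`.
  2 * k ≤ ∑ i : Fin N, ∑ j : Fin N, (if o i ≠ 0 ∧ o j ≠ 0 ∧ H.Adj i j then 1 else 0) ∧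
    4 * d ^ 2 * (u * ∑ i : Fin N, (if o i ≠ 0 then 1 else 0)) ≤ k * b

/-- Set `vFound[0] := 1` if the output is a certificate. -/
def checkOutput (d : ℕ) : Prog :=
  .seq countVertices <| .seq countEdges <| .seq (mulReg vP vS vE vB) <|
    .seq (mulReg vX vS vU vCnt) <|
    -- The truncated difference `x + 1 - y` is nonzero exactly if `y ≤ x`.
    .ite ((((reg vEdg).add (.const 1)).sub ((reg vE).add (reg vE))).and
      (((reg vP).add (.const 1)).sub ((reg vX).scale (4 * d ^ 2))))
      (setReg vFound (.const 1)) .skip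

open Classical in
lemma impl_checkOutput (d : ℕ) {m : Mem} {N k u b : ℕ} {H : SimpleGraph (Fin N)} (hN : m vN 0 = N)
    (hk : m vE 0 = k) (hu : m vU 0 = u) (hb : m vB 0 = b) (hH : m vH = inputMem H k 1) :
    Impl (checkOutput d) m (.leaf ()) fun _ m' t =>
      m' vFound 0 = (if Cert d u b k H (fun i => m vOut i) then 1 else m vFound 0) ∧
      Frame [vI, vJ, vX, vP, vS, vEdg, vCnt, vFound] m m' ∧
      t ≤ N * 4 + 14 + N * (N * (3 * N + 8) + 4) + 3 * k + 3 * u := by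
  refine (impl_countVertices hN).seq_left ?_
  rintro m₁ t₁ ⟨h1, h2, h3⟩
  refine (impl_countEdges (H := H) (k := k) (by rw [h2 _ (by decide) (by decide), hN])
    (by rw [h2 _ (by decide) (by decide), hH])).seq_left ?_
  rintro m₂ t₂ ⟨h4, h5, h6⟩
  rw [h2 vOut (by decide) (by decide)] at h4
  refine (impl_mulReg (by decide) (by decide) (by decide) (by decide) (by decide) _).seq_left ?_
  rintro m₃ t₃ ⟨h7, h8, h9⟩
  rw [h5 vE (by decide) (by decide), h5 vB (by decide) (by decide),
    h2 vE (by decide) (by decide), h2 vB (by decide) (by decide), hk, hb] at h7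
  rw [h5 vE (by decide) (by decide), h2 vE (by decide) (by decide), hk] at h9
  refine (impl_mulReg (by decide) (by decide) (by decide) (by decide) (by decide) _).seq_left ?_
  rintro m₄ t₄ ⟨h10, h11, h12⟩
  rw [h8 vU (by decide) (by decide), h5 vU (by decide) (by decide),
    h2 vU (by decide) (by decide), hu] at h12
  rw [h8 vU (by decide) (by decide), h5 vU (by decide) (by decide),
    h2 vU (by decide) (by decide), hu, h8 vCnt (by decide) (by decide),
    h5 vCnt (by decide) (by decide), h1] at h10
  have hF : Frame [vI, vJ, vX, vP, vS, vEdg, vCnt, vFound] m m₄ :=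
    (((h2.mono (by simp)).trans (h5.mono (by simp))).trans (h8.mono (by simp))).trans
      (h11.mono (by simp))
  have hE : m₄ vEdg 0 = m₂ vEdg 0 := by
    rw [h11 _ (by decide) (by decide), h8 _ (by decide) (by decide)]
  have hP : m₄ vP 0 = k * b := by rw [h11 _ (by decide) (by decide), h7]
  have hk4 : m₄ vE 0 = k := by rw [hF _ (by decide) (by decide), hk]
  have hfound : m₄ vFound 0 = m vFound 0 := by
    rw [h11 _ (by decide) (by decide), h8 _ (by decide) (by decide),
      h5 _ (by decide) (by decide), h2 _ (by decide) (by decide)]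
  have hcond : (m₄ vEdg 0 + 1 - (m₄ vE 0 + m₄ vE 0) ≠ 0 ∧
      m₄ vP 0 + 1 - 4 * d ^ 2 * m₄ vX 0 ≠ 0) ↔ Cert d u b k H (fun i => m vOut i) := by
    rw [Cert, hE, h4, hk4, hP, h10]
    refine and_congr (by omega) (by omega)
  refine .ite (fun hc => ?_) fun hc => ?_
  · rw [eval_and_ne_zero] at hc
    simp only [eval_sub, eval_reg, eval_add, eval_const, eval_scale] at hc
    rw [hcond] at hc
    exact .assign ⟨by simp [hc], hF.write (by simp) _ _, by linarith⟩
  · rw [eval_and_eq_zero] at hc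
    simp only [eval_sub, eval_reg, eval_add, eval_const, eval_scale] at hc
    rw [hcond] at hc
    exact .skip ⟨by rw [if_neg hc, hfound], hF, by linarith⟩

/-! ### One attempt to find a certificate -/

/-- The number of tuples. -/
def numTuples (d u b : ℕ) : ℕ := 2 ^ ((d - 1) * (2 * d) * (u * b))

/-- The budget of the simulated algorithm. -/
def budget (e u b : ℕ) : ℕ := 2 ^ (e * (u * b))

open Classical in
/-- Sample tuples and run the clocked algorithm on the tuple graph; is the output a certificate? -/
noncomputable def attemptTree (A : Prog) (d e u b : ℕ) {n : ℕ} (G : SimpleGraph (Fin n)) (κ : ℕ) :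
    Tree Bool :=
  (arrTree (numTree (d * u)) (numTuples d u b * (2 * d * b)) fun _ => 0).bind fun f =>
    (interp A (inputMem (tupleGraph G (numTuples d u b) (2 * d * b) f) ((κ + 1).choose 2),
      budget e u b)).map fun y =>
        decide (Cert d u b ((κ + 1).choose 2)
          (tupleGraph G (numTuples d u b) (2 * d * b) f) fun i => y.1 2 i)

/-- The program for one attempt, with clique size `vK[0] + 1`. -/
def attempt (A : Prog) (d g : ℕ) : Prog :=
  -- The counter values `κ, …, 1` add up to `(κ+1 choose 2)`, the number of edges of a clique on `κ
  -- + 1` vertices.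
  .seq (setReg vE (.const 0)) <| .seq (forDown vI (reg vK) (setReg vE ((reg vE).add (reg vI)))) <|
    .seq (sampleTuples d) <| .seq (buildMatrix g) <| .seq (simulate A) <|
    .seq copyOutput <| checkOutput d

/-- The facts about the memory that are used in an attempt. -/
structure LevelEnv (d e u b : ℕ) {n : ℕ} (G : SimpleGraph (Fin n)) (g : ℕ) (m : Mem) : Prop where
  g_eq : g = 1 ∨ g = vRnd
  n_eq : m 0 0 = n
  u_eq : m vU 0 = u
  b_eq : m vB 0 = b
  N_eq : m vN 0 = numTuples d u b
  T_eq : m vT 0 = budget e u b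
  rep : Represents (m vPl 0) (m g) G

lemma LevelEnv.frame {d e u b n : ℕ} {G : SimpleGraph (Fin n)} {g : ℕ} {m m' : Mem}
    (h : LevelEnv d e u b G g m) {l : List ℕ} (hF : Frame l m m')
    (hl : ∀ a ∈ [0, 1, vRnd, vU, vB, vN, vT, vPl], a ∉ l) : LevelEnv d e u b G g m' where
  g_eq := h.g_eq
  n_eq := by rw [hF _ (by decide) (hl _ (by simp)), h.n_eq]
  u_eq := by rw [hF _ (by decide) (hl _ (by simp)), h.u_eq]
  b_eq := by rw [hF _ (by decide) (hl _ (by simp)), h.b_eq]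
  N_eq := by rw [hF _ (by decide) (hl _ (by simp)), h.N_eq]
  T_eq := by rw [hF _ (by decide) (hl _ (by simp)), h.T_eq]
  rep := by
    have h1 : g < 64 ∧ g ∈ [0, 1, vRnd, vU, vB, vN, vT, vPl] := by
      rcases h.g_eq with rfl | rfl <;> decide
    rw [hF vPl (by decide) (hl _ (by simp)), hF g h1.1 (hl _ h1.2)]
    exact h.rep

/-- The arrays changed by an attempt. -/
abbrev attemptList : List ℕ :=
  [vE, vI, vL, vNL, vS, vTup, vX, vC, vY, vZ, vP, vOk, vA, vH, vJ, vClock, vOut, vEdg, vCnt, vFound]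

/-- A bound for the number of steps of an attempt, in terms of the number `N` and the
length `L` of the tuples and the budget `T`. -/
def attemptSteps (A : Prog) (d u n κ N L T : ℕ) : ℕ :=
  (3 * κ + 3) + (3 * N + 7 + N * L * (4 * (d * u) + 6)) +
  (3 + N * (N * (3 * N + 10 + L * (L * (6 * N + 3 * n + 24) + 4)) + 4)) +
  (3 * N + N * N * 3 + A.bound + 12 + clockedCost A * (T + 1)) +
  (N * 3 + 2) +
  (N * 4 + 14 + N * (N * (3 * N + 8) + 4) + 3 * (κ + 1).choose 2 + 3 * u)

/-- A bound for the number of steps of an attempt, in terms of the level `b`. -/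
def attemptTime (A : Prog) (d e u b n κ : ℕ) : ℕ :=
  attemptSteps A d u n κ (numTuples d u b) (2 * d * b) (budget e u b)

open Classical in
lemma impl_attempt (A : Prog) {d e u b n : ℕ} {G : SimpleGraph (Fin n)} {g : ℕ} {m : Mem}
    (h : LevelEnv d e u b G g m) {κ : ℕ} (hκ : m vK 0 = κ) :
    Impl (attempt A d g) m (attemptTree A d e u b G κ) fun ok m' t =>
      m' vFound 0 = (if ok then 1 else m vFound 0) ∧ Frame attemptList m m' ∧
      t ≤ attemptTime A d e u b n κ := by
  refine Impl.seq_left (Q := fun _ m' t => m' = write m vE 0 0 ∧ t = 1) (.assign ⟨rfl, rfl⟩) ?_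
  rintro m₁ t₁ ⟨rfl, rfl⟩
  refine Impl.seq_left (det_forDown (n := κ) (τ := 1) (Inv := fun j m' =>
    m' vE 0 + (j + 1).choose 2 = (κ + 1).choose 2 ∧ Frame [vE, vI] m m') ?_ ?_ ?_ ?_) ?_
  · rintro j m' x ⟨h1, h2⟩
    exact ⟨by rwa [write_of_ne _ _ _ (by decide)], h2.write (by simp) _ _⟩
  · rintro j m' - ⟨h1, h2⟩ h3
    refine .assign ⟨by rwa [write_of_ne _ _ _ (by decide)], ⟨?_, h2.write (by simp) _ _⟩, le_rfl⟩
    rw [eval_const, write_same, eval_add, eval_reg, eval_reg, h3, ← h1,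
      Nat.choose_succ_succ' (j + 1) 1, Nat.choose_one_right]
    ring
  · exact ⟨by simp, frame_write (by simp) _ _ _⟩
  · simp [write_of_ne, hκ]
  rintro m₂ t₂ ⟨⟨h1, h2⟩, h3⟩
  replace h1 : m₂ vE 0 = (κ + 1).choose 2 := by simpa using h1
  have e₂ := h.frame h2 (by decide)
  refine (impl_sampleTuples d m₂ e₂.u_eq e₂.b_eq e₂.N_eq).seq ?_
  rintro f m₃ t₃ ⟨h4, h5, h6, h7⟩
  have e₃ := e₂.frame h6 (by decide)
  set N := numTuples d u b with hN
  set L := 2 * d * b with hL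
  set H := tupleGraph G N L f with hH
  refine (impl_buildMatrix (G := G) (N := N) (L := L) (f := f)
    ⟨h.g_eq, e₃.n_eq, e₃.N_eq, h5, h4, e₃.rep⟩ ((κ + 1).choose 2)).seq_left ?_
  rintro m₄ t₄ ⟨h8, h9, h10⟩
  have e₄ := e₃.frame h9 (by decide)
  have hk₄ : m₄ vE 0 = (κ + 1).choose 2 := by
    rw [h9 _ (by decide) (by decide), h6 _ (by decide) (by decide), h1]
  refine Impl.map ((impl_simulate A H e₄.N_eq hk₄ e₄.T_eq h8).seq_right ?_)
  rintro y m₅ t₅ ⟨h11, h12, h13⟩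
  have e₅ := e₄.frame h12 (by decide)
  refine (impl_copyOutput e₅.N_eq).seq_left ?_
  rintro m₆ t₆ ⟨h14, h15, h16⟩
  have e₆ := e₅.frame h15 (by decide)
  refine (impl_checkOutput d (H := H) e₆.N_eq (by
    rw [h15 _ (by decide) (by decide), h12 _ (by decide) (by decide), hk₄]) e₆.u_eq e₆.b_eq (by
    rw [h15 _ (by decide) (by decide), h12 _ (by decide) (by decide), h8])).mono ?_
  rintro - m₇ t₇ ⟨h17, h18, h19⟩
  refine ⟨?_, ?_, ?_⟩
  · rw [h17, h15 vFound (by decide) (by decide), h12 _ (by decide) (by decide),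
      h9 _ (by decide) (by decide), h6 _ (by decide) (by decide), h2 _ (by decide) (by decide)]
    have : (fun i : Fin N => m₆ vOut i) = fun i : Fin N => y.1 2 i :=
      funext fun i => by rw [h14 i i.2, h11]
    rw [this]
    by_cases hC : Cert d u b ((κ + 1).choose 2) H fun i => y.1 2 i
    · rw [if_pos hC, if_pos (decide_eq_true hC)]
    · rw [if_neg hC, if_neg fun h => hC (of_decide_eq_true h)]
  · exact (((((h2.mono (by simp)).trans (h6.mono (by simp))).trans (h9.mono (by simp))).trans
      (h12.mono (by simp))).trans (h15.mono (by simp))).trans (h18.mono (by simp))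
  · rw [attemptTime, ← hN, ← hL, attemptSteps]
    linarith

end RAM

namespace RAM

/-! ### Repeated attempts -/

/-- `n` rounds of attempts with all clique sizes `2, …, b + 1`: is a certificate found? -/
noncomputable def tryTree (A : Prog) (d e u b : ℕ) {n : ℕ} (G : SimpleGraph (Fin n)) : Tree Bool :=
  .down (fun _ x => .down (fun κ x => (attemptTree A d e u b G (κ + 1)).map (x || ·)) b x) n false

/-- The program for `tryTree`; the adjacency bits are in `g`. -/
def tryAll (A : Prog) (d g : ℕ) : Prog :=
  .seq (setReg vFound (.const 0)) <| forDown vRep (reg 0) <| forDown vK (reg vB) <| attempt A d g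

/-- A bound for the number of steps of `tryAll`. -/
def tryTime (A : Prog) (d e u b n : ℕ) : ℕ := 3 + n * (b * (attemptTime A d e u b n b + 2) + 4)

/-- The arrays changed by `tryAll`. -/
abbrev tryList : List ℕ :=
  [vE, vI, vL, vNL, vS, vTup, vX, vC, vY, vZ, vP, vOk, vA, vH, vJ, vClock, vOut, vEdg, vCnt, vFound,
    vRep, vK]

/-- One bound, that of the largest clique size, then serves for all rounds of the loop over clique
sizes. -/
lemma attemptTime_mono (A : Prog) (d e u b n : ℕ) {κ κ' : ℕ} (h : κ ≤ κ') :
    attemptTime A d e u b n κ ≤ attemptTime A d e u b n κ' := by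
  have h1 : (κ + 1).choose 2 ≤ (κ' + 1).choose 2 := Nat.choose_le_choose 2 (by omega)
  simp only [attemptTime, attemptSteps]
  omega

lemma impl_tryAll (A : Prog) {d e u b n : ℕ} {G : SimpleGraph (Fin n)} {g : ℕ} {m : Mem}
    (h : LevelEnv d e u b G g m) :
    Impl (tryAll A d g) m (tryTree A d e u b G) fun x m' t =>
      m' vFound 0 = x.toNat ∧ Frame tryList m m' ∧ t ≤ tryTime A d e u b n := by
  refine Impl.seq_left (Q := fun _ m' t => m' = write m vFound 0 0 ∧ t = 1) (.assign ⟨rfl, rfl⟩) ?_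
  rintro m₁ t₁ ⟨rfl, rfl⟩
  refine (impl_forDown' (n := n) (τ := b * (attemptTime A d e u b n b + 2) + 2)
    (Inv := fun _ x m' => m' vFound 0 = x.toNat ∧ Frame tryList m m') ?_ ?_ ?_ ?_).mono ?_
  · rintro j x m' y ⟨h1, h2⟩
    exact ⟨by rwa [write_of_ne _ _ _ (by decide)], h2.write (by simp) _ _⟩
  · rintro j x m' - ⟨h1, h2⟩ h3
    refine (impl_forDown' (n := b) (τ := attemptTime A d e u b n b)
      (Inv := fun _ x m' => m' vFound 0 = x.toNat ∧ m' vRep 0 = j + 1 ∧ Frame tryList m m')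
      ?_ ?_ ?_ ?_).mono ?_
    · rintro j x m' y ⟨h1, h2, h3⟩
      exact ⟨by rwa [write_of_ne _ _ _ (by decide)], by rwa [write_of_ne _ _ _ (by decide)],
        h3.write (by simp) _ _⟩
    · rintro κ x m' hκ ⟨h1, h2, h3⟩ h4
      refine Impl.map ((impl_attempt A (h.frame h3 (by decide)) h4).mono ?_)
      rintro ok m'' t ⟨h5, h6, h7⟩
      refine ⟨by rw [h6 _ (by decide) (by decide), h4], ⟨?_,
        by rw [h6 _ (by decide) (by decide), h2], h3.trans (h6.mono (by simp))⟩,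
        h7.trans (attemptTime_mono _ _ _ _ _ _ hκ)⟩
      rw [h5, h1]
      cases ok <;> cases x <;> rfl
    · exact ⟨h1, h3, h2⟩
    · rw [eval_reg, (h.frame h2 (by decide)).b_eq]
    · rintro x m' t ⟨⟨h4, h5, h6⟩, h7⟩
      exact ⟨h5, ⟨h4, h6⟩, h7⟩
  · exact ⟨by simp, frame_write (by simp) _ _ _⟩
  · simp [write_of_ne, h.n_eq]
  · rintro x m' t ⟨⟨h4, h5⟩, h6⟩
    refine ⟨h4, h5, ?_⟩
    rw [tryTime]
    linarith

/-! ### The self-test of a level -/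

/-- The graph given by the bits `β` below the diagonal, with a clique planted on the first `p`
vertices. -/
def bitGraph (n p : ℕ) (β : ℕ → ℕ) : SimpleGraph (Fin n) where
  Adj x y := x ≠ y ∧ (max (x : ℕ) y < p ∨ β (max (x : ℕ) y * n + min (x : ℕ) y) ≠ 0)
  symm := ⟨fun x y h => ⟨h.1.symm, by rw [max_comm, min_comm]; exact h.2⟩⟩
  loopless := ⟨fun _ h => h.1 rfl⟩

lemma represents_bitGraph (n p : ℕ) (β : ℕ → ℕ) : Represents p β (bitGraph n p β) := by
  intro x y
  simp only [ReflAdj, bitGraph, ne_eq, Fin.mk.injEq, max_lt_iff]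
  constructor
  · rintro ⟨hx, hy, h⟩
    tauto
  · rintro ⟨⟨hx, hy⟩, h⟩
    exact ⟨hx, hy, by tauto⟩

lemma represents_input {n : ℕ} (G : SimpleGraph (Fin n)) (k : ℕ) :
    Represents 0 (inputMem G k 1) G := by
  intro x y
  simp only [ReflAdj, max_lt_iff, Nat.not_lt_zero, and_self, false_or]
  have key : ∀ (hx : x < n) (hy : y < n),
      inputMem G k 1 (max x y * n + min x y) ≠ 0 ↔ G.Adj ⟨x, hx⟩ ⟨y, hy⟩ := by
    intro hx hy
    rcases le_total x y with hxy | hxy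
    · rw [max_eq_right hxy, min_eq_left hxy, inputMem_one G k ⟨y, hy⟩ ⟨x, hx⟩, G.adj_comm]
      simp
    · rw [max_eq_left hxy, min_eq_right hxy, inputMem_one G k ⟨x, hx⟩ ⟨y, hy⟩]
      simp
  constructor
  · rintro ⟨hx, hy, h⟩
    exact ⟨⟨hx, hy⟩, h.imp_right (key hx hy).2⟩
  · rintro ⟨⟨hx, hy⟩, h⟩
    exact ⟨hx, hy, h.imp_right (key hx hy).1⟩

/-- A random graph with a clique on the first `p` vertices. -/
def plantedTree (n p : ℕ) : Tree (SimpleGraph (Fin n)) :=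
  (arrTree bitTree (n * n) fun _ => 0).map (bitGraph n p)

/-- Test `n` times, for every clique size from `q` to `n`, whether a certificate is found. -/
noncomputable def testTree (A : Prog) (d e u b n q : ℕ) : Tree Bool :=
  .down (fun c x => .down (fun _ x => (plantedTree n (q + c)).bind fun G =>
    (tryTree A d e u b G).map (x && ·)) n x) (n + 1 - q) true

/-- One trial on a random graph with a planted clique. -/
def trial (A : Prog) (d : ℕ) : Prog :=
  .seq (setReg vPl ((reg vMin).add (pre vSize))) <| .seq sampleBits <|
    .seq (tryAll A d vRnd) <| .ite (reg vFound) .skip (setReg vPass (.const 0))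

/-- The program for `testTree`. -/
def testAll (A : Prog) (d : ℕ) : Prog :=
  .seq (setReg vPass (.const 1)) <|
    forDown vSize (((reg 0).add (.const 1)).sub (reg vMin)) <| forDown vTrial (reg 0) <| trial A d

/-- A bound for the number of steps of `testAll`. -/
def testTime (A : Prog) (d e u b n : ℕ) : ℕ :=
  3 + (n + 1) * (n * (3 * n + 11 + n * n * 3 + tryTime A d e u b n) + 4)

/-- The arrays changed by `trial`, except for `vPass`. -/
abbrev trialList : List ℕ :=
  [vE, vI, vL, vNL, vS, vTup, vX, vC, vY, vZ, vP, vOk, vA, vH, vJ, vClock, vOut, vEdg, vCnt, vFound,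
    vRep, vK, vRnd, vPl]

/-- The arrays changed by `testAll`. -/
abbrev testList : List ℕ :=
  [vE, vI, vL, vNL, vS, vTup, vX, vC, vY, vZ, vP, vOk, vA, vH, vJ, vClock, vOut, vEdg, vCnt, vFound,
    vRep, vK, vRnd, vPl, vPass, vSize, vTrial]

/-- The facts about the memory that are used in the search for a level. -/
structure SearchEnv (d e u b n q : ℕ) (m : Mem) : Prop where
  n_eq : m 0 0 = n
  u_eq : m vU 0 = u
  q_eq : m vMin 0 = q
  b_eq : m vB 0 = b
  ub_eq : m vUB 0 = u * b
  N_eq : m vN 0 = numTuples d u b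
  T_eq : m vT 0 = budget e u b

lemma SearchEnv.frame {d e u b n q : ℕ} {m m' : Mem}
    (h : SearchEnv d e u b n q m) {l : List ℕ} (hF : Frame l m m')
    (hl : ∀ a ∈ [0, vU, vMin, vB, vUB, vN, vT], a ∉ l) : SearchEnv d e u b n q m' where
  n_eq := by rw [hF _ (by decide) (hl _ (by simp)), h.n_eq]
  u_eq := by rw [hF _ (by decide) (hl _ (by simp)), h.u_eq]
  q_eq := by rw [hF _ (by decide) (hl _ (by simp)), h.q_eq]
  b_eq := by rw [hF _ (by decide) (hl _ (by simp)), h.b_eq]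
  ub_eq := by rw [hF _ (by decide) (hl _ (by simp)), h.ub_eq]
  N_eq := by rw [hF _ (by decide) (hl _ (by simp)), h.N_eq]
  T_eq := by rw [hF _ (by decide) (hl _ (by simp)), h.T_eq]

lemma impl_trial (A : Prog) {d e u b n q : ℕ} {m : Mem} (h : SearchEnv d e u b n q m) {c : ℕ}
    (hc : m vSize 0 = c + 1) {x : Bool} (hx : m vPass 0 = x.toNat) :
    Impl (trial A d) m ((plantedTree n (q + c)).bind fun G => (tryTree A d e u b G).map (x && ·))
      fun y m' t => m' vPass 0 = y.toNat ∧ Frame (vPass :: trialList) m m' ∧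
        t ≤ 3 * n + 9 + n * n * 3 + tryTime A d e u b n := by
  refine Impl.seq_left (Q := fun _ m'' t => m'' = write m vPl 0 (q + c) ∧ t = 1)
    (.assign ⟨by simp [hc, h.q_eq], rfl⟩) ?_
  rintro m₁ t₁ ⟨rfl, rfl⟩
  have h5 : Frame [vPl] m (write m vPl 0 (q + c)) := frame_write (by simp) _ _ _
  have e₂ := h.frame h5 (by decide)
  rw [plantedTree, Tree.map, Tree.bind_assoc]
  refine (impl_sampleBits _ e₂.n_eq).seq ?_
  rintro β m₂ t₂ ⟨h6, h7, h8⟩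
  have e₃ := e₂.frame h7 (by decide)
  rw [Tree.bind_leaf]
  have hl : LevelEnv d e u b (bitGraph n (q + c) β) vRnd m₂ :=
    ⟨.inr rfl, e₃.n_eq, e₃.u_eq, e₃.b_eq, e₃.N_eq, e₃.T_eq, by
      rw [h6, h7 _ (by decide) (by decide), write_same]
      exact represents_bitGraph _ _ _⟩
  refine Impl.map ((impl_tryAll A hl).seq_right ?_)
  rintro y m₃ t₃ ⟨h9, h10, h11⟩
  have hF : Frame trialList m m₃ := ((h5.mono (by simp)).trans
    (h7.mono (by simp))).trans (h10.mono (by simp))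
  have h13 : m₃ vPass = m vPass := hF vPass (by decide) (by decide)
  have hF' : Frame (vPass :: trialList) m m₃ := hF.mono (List.subset_cons_self _ _)
  refine .ite (fun hy => ?_) fun hy => ?_
  · rw [eval_reg, h9] at hy
    obtain rfl : y = true := by cases y <;> simp_all
    exact .skip ⟨by rw [h13, hx, Bool.and_true], hF', by linarith⟩
  · rw [eval_reg, h9] at hy
    obtain rfl : y = false := by cases y <;> simp_all
    exact .assign ⟨by simp, hF'.write (by simp) _ _, by linarith⟩

lemma impl_testAll (A : Prog) {d e u b n q : ℕ} {m : Mem} (h : SearchEnv d e u b n q m) :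
    Impl (testAll A d) m (testTree A d e u b n q) fun x m' t =>
      m' vPass 0 = x.toNat ∧ Frame testList m m' ∧ t ≤ testTime A d e u b n := by
  refine Impl.seq_left (Q := fun _ m' t => m' = write m vPass 0 1 ∧ t = 1) (.assign ⟨rfl, rfl⟩) ?_
  rintro m₁ t₁ ⟨rfl, rfl⟩
  set τ := 3 * n + 9 + n * n * 3 + tryTime A d e u b n with hτ
  refine (impl_forDown' (n := n + 1 - q) (τ := n * (τ + 2) + 2)
    (Inv := fun _ x m' => m' vPass 0 = x.toNat ∧ Frame testList m m') ?_ ?_ ?_ ?_).mono ?_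
  · rintro j x m' y ⟨h1, h2⟩
    exact ⟨by rwa [write_of_ne _ _ _ (by decide)], h2.write (by simp) _ _⟩
  · rintro c x m' - ⟨h1, h2⟩ h3
    refine (impl_forDown' (n := n) (τ := τ)
      (Inv := fun _ x m' => m' vPass 0 = x.toNat ∧ m' vSize 0 = c + 1 ∧ Frame testList m m')
      ?_ ?_ ?_ ?_).mono ?_
    · rintro j x m' y ⟨h1, h2, h3⟩
      exact ⟨by rwa [write_of_ne _ _ _ (by decide)], by rwa [write_of_ne _ _ _ (by decide)],
        h3.write (by simp) _ _⟩
    · rintro j x m' hκ ⟨h1, h2, h3⟩ h4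
      refine (impl_trial A (h.frame h3 (by decide)) h2 h1).mono ?_
      rintro y m'' t ⟨h5, h6, h7⟩
      exact ⟨by rw [h6 _ (by decide) (by decide), h4], ⟨h5,
        by rw [h6 _ (by decide) (by decide), h2], h3.trans (h6.mono (by simp))⟩, h7⟩
    · exact ⟨h1, h3, h2⟩
    · rw [eval_reg, (h.frame h2 (by decide)).n_eq]
    · rintro x m' t ⟨⟨h4, h5, h6⟩, h7⟩
      exact ⟨h5, ⟨h4, h6⟩, h7⟩
  · exact ⟨by simp, frame_write (by simp) _ _ _⟩
  · simp [write_of_ne, h.n_eq, h.q_eq]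
  · rintro x m' t ⟨⟨h4, h5⟩, h6⟩
    refine ⟨h4, h5, ?_⟩
    have h7 : (n + 1 - q) * (n * (τ + 2) + 2 + 2) ≤ (n + 1) * (n * (τ + 2) + 2 + 2) :=
      Nat.mul_le_mul_right _ (by omega)
    rw [testTime]
    rw [hτ] at h6 h7
    linarith

/-! ### The search for a level -/

/-- Starting after the level `b₀`, the first level that passes its test, among `u` levels; the bit
tells whether the test was passed. -/
noncomputable def searchTree (A : Prog) (d e u b₀ n q : ℕ) : Tree (ℕ × Bool) :=
  .down (fun _ x => if x.2 then .leaf x else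
    (testTree A d e u (x.1 + 1) n q).map fun ok => (x.1 + 1, ok)) u (b₀, false)

/-- Compute the number of tuples and the budget. -/
def computeLevel (d e : ℕ) : Prog :=
  .seq (powReg vN vS ((reg vUB).scale ((d - 1) * (2 * d)))) <|
    powReg vT vS ((reg vUB).scale e)

/-- A bound for the number of steps of `computeLevel`. -/
def computeTime (d e u b : ℕ) : ℕ := 3 * ((d - 1) * (2 * d) * (u * b)) + 3 * (e * (u * b)) + 6

lemma impl_computeLevel {d e u b : ℕ} {m : Mem} (h : m vUB 0 = u * b) :
    Impl (computeLevel d e) m (.leaf ()) fun _ m' t =>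
      m' vN 0 = numTuples d u b ∧ m' vT 0 = budget e u b ∧ Frame [vN, vT, vS] m m' ∧
      t ≤ computeTime d e u b := by
  refine (impl_powReg (x := (d - 1) * (2 * d) * (u * b)) (by decide) m
    (by simp [write_of_ne, h])).seq_left ?_
  rintro m₁ t₁ ⟨h1, h2, h3⟩
  refine (impl_powReg (x := e * (u * b)) (by decide) m₁
    (by simp [write_of_ne, h2 vUB (by decide) (by decide), h])).mono ?_
  rintro - m₂ t₂ ⟨h4, h5, h6⟩
  refine ⟨by rw [h5 _ (by decide) (by decide), h1, numTuples], by rw [h4, budget],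
    (h2.mono (by simp)).trans (h5.mono (by simp)), ?_⟩
  rw [computeTime]
  omega

/-- Search for a level. -/
def search (A : Prog) (d e : ℕ) : Prog :=
  forDown vStep (reg vU) <| .ite (reg vPass) .skip <|
    .seq (setReg vB ((reg vB).add (.const 1))) <| .seq (setReg vUB ((reg vUB).add (reg vU))) <|
    .seq (computeLevel d e) <| testAll A d

/-- A bound for the number of steps spent at a level. -/
def levelTime (A : Prog) (d e u n b : ℕ) : ℕ := computeTime d e u b + testTime A d e u b n + 3

/-- The arrays changed by `search`. -/
abbrev searchList : List ℕ :=
  [vE, vI, vL, vNL, vS, vTup, vX, vC, vY, vZ, vP, vOk, vA, vH, vJ, vClock, vOut, vEdg, vCnt, vFound,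
    vRep, vK, vRnd, vPl, vPass, vSize, vTrial, vB, vUB, vN, vT, vStep]

/-- The potential is the total cost of the levels up to the current one: testing a new level raises
it by the cost of that level, and rounds after a success take constantly many steps. So the bound
depends on the level reached, not on the number of levels available. -/
lemma impl_search (A : Prog) {d e u b₀ n q : ℕ} {m : Mem} (h : SearchEnv d e u b₀ n q m)
    (hp : m vPass 0 = 0) :
    Impl (search A d e) m (searchTree A d e u b₀ n q) fun x m' t =>
      SearchEnv d e u x.1 n q m' ∧ Frame searchList m m' ∧
      t ≤ u * 4 + 2 + ∑ i ∈ Finset.range (x.1 + 1), levelTime A d e u n i := by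
  refine (impl_forDown (fun x => ∑ i ∈ Finset.range (x.1 + 1), levelTime A d e u n i)
    (n := u) (τ := 2) (Inv := fun _ x m' => m' vPass 0 = x.2.toNat ∧ SearchEnv d e u x.1 n q m' ∧
      Frame searchList m m') ?_ ?_ ?_ ?_).mono ?_
  · rintro j x m' y ⟨h1, h2, h3⟩
    exact ⟨by rwa [write_of_ne _ _ _ (by decide)],
      h2.frame (frame_write (L := [vStep]) (by simp) _ _ _) (by decide), h3.write (by simp) _ _⟩
  · rintro j ⟨b, x⟩ m' - ⟨h1, h2, h3⟩ h4
    simp only at h1 h2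
    refine .ite (fun hx => ?_) fun hx => ?_
    · rw [eval_reg, h1] at hx
      obtain rfl : x = true := by cases x <;> simp_all
      exact .skip ⟨h4, ⟨h1, h2, h3⟩, by simp⟩
    · rw [eval_reg, h1] at hx
      obtain rfl : x = false := by cases x <;> simp_all
      simp only [Bool.false_eq_true, if_false]
      refine Impl.seq_left (Q := fun _ m'' t => m'' = write m' vB 0 (b + 1) ∧ t = 1)
        (.assign ⟨by simp [h2.b_eq], rfl⟩) ?_
      rintro m₁ t₁ ⟨rfl, rfl⟩
      refine Impl.seq_left (Q := fun _ m'' t =>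
        m'' = write (write m' vB 0 (b + 1)) vUB 0 (u * (b + 1)) ∧ t = 1) (.assign ⟨?_, rfl⟩) ?_
      · simp [write_of_ne, h2.ub_eq, h2.u_eq, Nat.mul_succ]
      rintro m₁ t₁ ⟨rfl, rfl⟩
      have h5 : Frame [vB, vUB] m' (write (write m' vB 0 (b + 1)) vUB 0 (u * (b + 1))) :=
        (frame_write (by simp) _ _ _).write (by simp) _ _
      refine (impl_computeLevel (write_same _ _ _ _)).seq_left ?_
      rintro m₂ t₂ ⟨h6, h7, h8, h9⟩
      have hF : Frame [vB, vUB, vN, vT, vS] m' m₂ :=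
        (h5.mono (by simp)).trans (h8.mono (by simp))
      have e₂ : SearchEnv d e u (b + 1) n q m₂ :=
        ⟨by rw [hF _ (by decide) (by decide), h2.n_eq],
          by rw [hF _ (by decide) (by decide), h2.u_eq],
          by rw [hF _ (by decide) (by decide), h2.q_eq],
          by rw [h8 _ (by decide) (by decide), write_of_ne _ _ _ (by decide), write_same],
          by rw [h8 _ (by decide) (by decide), write_same], h6, h7⟩
      refine Impl.map ((impl_testAll A e₂).mono ?_)
      rintro x m₃ t₃ ⟨h10, h11, h12⟩
      refine ⟨by rw [h11 _ (by decide) (by decide), hF _ (by decide) (by decide), h4],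
        ⟨h10, e₂.frame h11 (by decide),
        (h3.trans (hF.mono (by simp))).trans (h11.mono (by simp))⟩, ?_⟩
      rw [Finset.sum_range_succ _ (b + 1), levelTime]
      omega
  · exact ⟨hp, h, Frame.refl _ _⟩
  · rw [eval_reg, h.u_eq]
  · rintro x m' t ⟨⟨h1, h2, h3⟩, h4⟩
    exact ⟨h2, h3, by omega⟩

/-! ### The distinguisher -/

/-- Compute the parameters that depend only on the number of vertices. -/
def prepare (d e b₀ : ℕ) : Prog :=
  .seq (setReg vU (.const 0)) <| .seq (setReg vM (.const 1)) <|
  .seq (forDown vI (reg 0) <| .ite ((reg 0).sub (reg vM))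
    (.seq (setReg vM ((reg vM).scale (2 ^ d))) (setReg vU ((reg vU).add (.const 1)))) .skip) <|
  .seq (powReg vMin vS ((reg vU).add (reg vU))) <| .seq (setReg vB (.const b₀)) <|
  .seq (setReg vUB ((reg vU).scale b₀)) <| .seq (computeLevel d e) <| setReg vPass (.const 0)

/-- A bound for the number of steps of `prepare`. -/
def prepareTime (d e u b₀ n : ℕ) : ℕ := n * 5 + 6 * u + 10 + computeTime d e u b₀

/-- The number of multiplications by `2 ^ d` that bring `1` up to at least `n` is `Nat.clog (2 ^ d)
n`. This is at most `n`, so `n` rounds suffice, and the superfluous ones do nothing. -/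
lemma impl_prepare {d : ℕ} (hd : 0 < d) (e b₀ : ℕ) {m : Mem} {n u : ℕ} (hn : m 0 0 = n)
    (hu : Nat.clog (2 ^ d) n = u) :
    Impl (prepare d e b₀) m (.leaf ()) fun _ m' t =>
      SearchEnv d e u b₀ n (2 ^ (2 * u)) m' ∧ m' vPass 0 = 0 ∧ m' 1 = m 1 ∧
      t ≤ prepareTime d e u b₀ n := by
  have hd1 : 1 < 2 ^ d := Nat.one_lt_two_pow hd.ne'
  refine Impl.seq_left (Q := fun _ m' t => m' = write m vU 0 0 ∧ t = 1) (.assign ⟨rfl, rfl⟩) ?_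
  rintro m₁ t₁ ⟨rfl, rfl⟩
  refine Impl.seq_left (Q := fun _ m' t => m' = write (write m vU 0 0) vM 0 1 ∧ t = 1)
    (.assign ⟨rfl, rfl⟩) ?_
  rintro m₁ t₁ ⟨rfl, rfl⟩
  refine Impl.seq_left (det_forDown (n := n) (τ := 3) (Inv := fun j m' =>
    m' vM 0 = (2 ^ d) ^ m' vU 0 ∧ m' vU 0 ≤ u ∧ u ≤ m' vU 0 + j ∧
      Frame [vU, vM, vI] m m') ?_ ?_ ?_ ?_) ?_
  · rintro j m' x ⟨h1, h2, h3, h4⟩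
    rw [write_of_ne _ _ _ (by decide), write_of_ne _ _ _ (by decide)]
    exact ⟨h1, h2, h3, h4.write (by simp) _ _⟩
  · rintro j m' - ⟨h1, h2, h3, h4⟩ h5
    refine .ite (fun hc => ?_) fun hc => ?_
    · refine Impl.seq_left (Q := fun _ m'' t => m'' = write m' vM 0 ((2 ^ d) ^ (m' vU 0 + 1)) ∧
        t = 1) (.assign ⟨by simp [h1, pow_succ, mul_comm], rfl⟩) ?_
      rintro m₁ t₁ ⟨rfl, rfl⟩
      simp only [eval_sub, eval_reg, h4 0 (by decide) (by decide), hn, h1] at hc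
      have h6 : m' vU 0 < u := by
        rw [← hu, Nat.lt_clog_iff_pow_lt hd1]
        omega
      refine .assign ⟨?_, ⟨?_, ?_, ?_, (h4.write (by simp) _ _).write (by simp) _ _⟩, le_rfl⟩
      · simpa [write_of_ne] using h5
      · simp [write_of_ne]
      · simpa [write_of_ne] using h6
      · simp only [eval_const, eval_add, eval_reg, write_same]
        rw [write_of_ne _ _ _ (by decide)]
        omega
    · simp only [eval_sub, eval_reg, h4 0 (by decide) (by decide), hn, h1] at hc
      have h6 : u ≤ m' vU 0 := by
        rw [← hu]
        exact Nat.clog_le_of_le_pow (by omega)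
      exact .skip ⟨h5, ⟨h1, h2, by omega, h4⟩, by omega⟩
  · refine ⟨by simp [write_of_ne], by simp [write_of_ne], ?_,
      (frame_write (by simp) _ _ _).write (by simp) _ _⟩
    have : u ≤ n := by
      rw [← hu]
      exact Nat.clog_le_of_le_pow (Nat.lt_pow_self hd1).le
    omega
  · simp [write_of_ne, hn]
  rintro m₂ t₂ ⟨⟨-, h2, h3, h4⟩, h5⟩
  have h6 : m₂ vU 0 = u := by omega
  refine (impl_powReg (x := 2 * u) (by decide) m₂ (by simp [write_of_ne, h6, two_mul])).seq_left ?_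
  rintro m₃ t₃ ⟨h7, h8, h9⟩
  refine Impl.seq_left (Q := fun _ m' t => m' = write m₃ vB 0 b₀ ∧ t = 1) (.assign ⟨rfl, rfl⟩) ?_
  rintro m₁ t₁ ⟨rfl, rfl⟩
  refine Impl.seq_left (Q := fun _ m' t => m' = write (write m₃ vB 0 b₀) vUB 0 (u * b₀) ∧ t = 1)
    (.assign ⟨?_, rfl⟩) ?_
  · simp [write_of_ne, h8 vU (by decide) (by decide), h6, mul_comm]
  rintro m₁ t₁ ⟨rfl, rfl⟩
  refine (impl_computeLevel (write_same _ _ _ _)).seq_left ?_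
  rintro m₄ t₄ ⟨h10, h11, h12, h13⟩
  have hF : Frame [vMin, vS, vB, vUB, vN, vT] m₂ m₄ :=
    (((h8.mono (by simp)).write (by simp) _ _).write (by simp) _ _).trans (h12.mono (by simp))
  have hs : SearchEnv d e u b₀ n (2 ^ (2 * u)) m₄ :=
    ⟨by rw [hF _ (by decide) (by decide), h4 _ (by decide) (by decide), hn],
      by rw [hF _ (by decide) (by decide), h6],
      by rw [h12 _ (by decide) (by decide), write_of_ne _ _ _ (by decide),
        write_of_ne _ _ _ (by decide), h7],
      by rw [h12 _ (by decide) (by decide), write_of_ne _ _ _ (by decide), write_same],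
      by rw [h12 _ (by decide) (by decide), write_same], h10, h11⟩
  refine .assign ⟨hs.frame (frame_write (L := [vPass]) (by simp) _ _ _) (by decide), by simp, ?_, ?_⟩
  · rw [write_of_ne _ _ _ (by decide), hF _ (by decide) (by decide),
      h4 _ (by decide) (by decide)]
  · rw [prepareTime]
    omega

/-- The distinguisher: find a level by self-tests, then look for a certificate in the input. -/
def distinguisher (A : Prog) (d e b₀ : ℕ) : Prog :=
  .seq (prepare d e b₀) <| .seq (search A d e) <| .seq (setReg vPl (.const 0)) <|
    .seq (tryAll A d 1) <| setReg 2 (reg vFound)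

/-- The behaviour of the distinguisher: the level, and whether it accepts. -/
noncomputable def distTree (A : Prog) (d e b₀ : ℕ) {n : ℕ} (G : SimpleGraph (Fin n)) :
    Tree (ℕ × Bool) :=
  (searchTree A d e (Nat.clog (2 ^ d) n) b₀ n (2 ^ (2 * Nat.clog (2 ^ d) n))).bind fun x =>
    (tryTree A d e (Nat.clog (2 ^ d) n) x.1 G).map fun y => (x.1, y)

/-- A bound for the number of steps of the distinguisher, in terms of the level. -/
def distTime (A : Prog) (d e b₀ n b : ℕ) : ℕ :=
  let u := Nat.clog (2 ^ d) n
  prepareTime d e u b₀ n + (u * 4 + 2 + ∑ i ∈ Finset.range (b + 1), levelTime A d e u n i) +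
    tryTime A d e u b n + 2

lemma impl_distinguisher (A : Prog) {d : ℕ} (hd : 0 < d) (e b₀ : ℕ) {n : ℕ}
    (G : SimpleGraph (Fin n)) :
    Impl (distinguisher A d e b₀) (inputMem G 0) (distTree A d e b₀ G) fun x m' t =>
      m' 2 0 = x.2.toNat ∧ t ≤ distTime A d e b₀ n x.1 := by
  set u := Nat.clog (2 ^ d) n with hu
  refine (impl_prepare hd e b₀ (n := n) (by simp [inputMem, input]) hu.symm).seq_left ?_
  rintro m₁ t₁ ⟨h1, h2, h3, h4⟩
  refine (impl_search A h1 h2).seq ?_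
  rintro ⟨b, x⟩ m₂ t₂ ⟨h5, h6, h7⟩
  refine Impl.seq_left (Q := fun _ m' t => m' = write m₂ vPl 0 0 ∧ t = 1) (.assign ⟨rfl, rfl⟩) ?_
  rintro m₃ t₃ ⟨rfl, rfl⟩
  have e₃ := h5.frame (frame_write (L := [vPl]) (a := vPl) (by simp) m₂ 0 0) (by decide)
  have hl : LevelEnv d e u b G 1 (write m₂ vPl 0 0) :=
    ⟨.inl rfl, e₃.n_eq, e₃.u_eq, e₃.b_eq, e₃.N_eq, e₃.T_eq, by
      rw [write_same, write_of_ne _ _ _ (by decide), h6 _ (by decide) (by decide), h3]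
      exact represents_input G 0⟩
  refine Impl.map ((impl_tryAll A hl).seq_right ?_)
  rintro y m₄ t₄ ⟨h8, h9, h10⟩
  refine .assign ⟨by simp [h8], ?_⟩
  simp only at h7
  simp only [distTime, ← hu]
  omega

end RAM

/-! ### Probability analysis of the trees -/

namespace RAM

open scoped BigOperators symmDiff

/-! ### Uniform distributions -/

lemma avg_numTree (r : ℕ) (F : ℕ → ℝ) : (numTree r).avg F = 𝔼 v : Fin (2 ^ r), F v := by
  -- Generalized to an arbitrary value `v` of the digits read so far: `r` further digits `w` turn it
  -- into `v * 2 ^ r + w`.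
  have key : ∀ r v : ℕ, (Tree.down (fun _ v => (Tree.flip .leaf).map fun c : Bool =>
      v + v + c.toNat) r v).avg F = (∑ w ∈ Finset.range (2 ^ r), F (v * 2 ^ r + w)) / 2 ^ r := by
    intro r
    induction r with
    | zero => simp [Tree.down]
    | succ r ih =>
      intro v
      rw [Tree.down, Tree.avg_bind, Tree.avg_map]
      simp only [Tree.avg, ih, Bool.toNat_true, Bool.toNat_false]
      rw [pow_succ, mul_two, Finset.sum_range_add, ← add_div, div_div, pow_succ, add_comm]
      congr 2
      · exact Finset.sum_congr rfl fun w _ => by ring_nf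
      · exact Finset.sum_congr rfl fun w _ => by ring_nf
  rw [numTree, key, Fintype.expect_eq_sum_div_card, Fintype.card_fin, Finset.sum_range]
  simp

lemma avg_bitTree (F : ℕ → ℝ) : bitTree.avg F = 𝔼 c : Bool, F c.toNat := by
  rw [bitTree, Tree.avg_map, Fintype.expect_eq_sum_div_card]
  simp [Tree.avg]

/-- The array with first entries `ι (g 0), ι (g 1), …` and further entries as in `f`. -/
def extend {V X : Type} (ι : X → V) (f : ℕ → V) {n : ℕ} (g : Fin n → X) : ℕ → V :=
  fun j => if h : j < n then ι (g ⟨j, h⟩) else f j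

/-- Independent uniform samples are jointly uniform. The highest index is sampled first, so the
induction splits off the last coordinate. -/
lemma avg_arrTree {V X : Type} [Fintype X] {S : Tree V} {ι : X → V}
    (hS : ∀ F, S.avg F = 𝔼 x, F (ι x)) (n : ℕ) (f : ℕ → V) (F : (ℕ → V) → ℝ) :
    (arrTree S n f).avg F = 𝔼 g : Fin n → X, F (extend ι f g) := by
  rw [arrTree]
  induction n generalizing f with
  | zero =>
    have h : ∀ g : Fin 0 → X, extend ι f g = f := fun g => by
      funext j
      simp [extend]
    simp [Tree.down, h]
  | succ n ih =>
    rw [Tree.down, Tree.avg_bind, Tree.avg_map]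
    simp only [ih]
    rw [hS, ← Finset.expect_product' Finset.univ Finset.univ
      fun x (g : Fin n → X) => F (extend ι (Function.update f n (ι x)) g),
      Finset.univ_product_univ]
    refine Fintype.expect_equiv (Fin.snocEquiv fun _ : Fin (n + 1) => X) _ _ fun x => ?_
    congr 1
    funext j
    simp only [extend, Fin.snocEquiv, Equiv.coe_fn_mk, Fin.snoc, Function.update_apply]
    by_cases h1 : j < n
    · simp [h1, h1.trans (Nat.lt_succ_self n)]
    · by_cases h2 : j = n
      · subst h2
        simp
      · have h3 : ¬ j < n + 1 := by omega
        simp [h1, h2, h3]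

/-! ### Random graphs -/

section
variable {n : ℕ}

lemma expect_symmDiff (F : SimpleGraph (Fin n) → ℝ) (H : SimpleGraph (Fin n)) :
    𝔼 G, F (H ∆ G) = 𝔼 G, F G :=
  Fintype.expect_equiv (Function.Involutive.toPerm (H ∆ ·) (symmDiff_symmDiff_cancel_left H)) _ _
    fun _ => rfl

/-- The vertices `0, …, p - 1`. -/
def firstVertices (n p : ℕ) : Finset (Fin n) := Finset.univ.filter fun v => (v : ℕ) < p

lemma bitGraph_eq_sup (p : ℕ) (β : ℕ → ℕ) :
    bitGraph n p β = bitGraph n 0 β ⊔ PlantedClique.cliqueOn (firstVertices n p) := by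
  ext x y
  simp only [bitGraph, SimpleGraph.sup_adj, PlantedClique.cliqueOn, firstVertices,
    Finset.mem_filter, Finset.mem_univ, true_and, max_lt_iff]
  tauto

lemma mul_add_lt_mul_self {n x y : ℕ} (hx : x < n) (hy : y < n) : x * n + y < n * n := by
  have : (x + 1) * n ≤ n * n := Nat.mul_le_mul_right _ hx
  rw [Nat.succ_mul] at this
  omega

/-- Only the bits below the diagonal matter, so the map `π` from bits to graphs is many-to-one; its
fibres need not be counted. Flipping the bits by `σ G` permutes the bit arrays and turns `π g` into
`π g ∆ G`. Averaging over `G` as well makes the graph uniform for each fixed `g`. -/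
lemma expect_bitGraph (F : SimpleGraph (Fin n) → ℝ) :
    𝔼 g : Fin (n * n) → Bool, F (bitGraph n 0 (extend Bool.toNat (fun _ => 0) g)) = 𝔼 G, F G := by
  classical
  let π : (Fin (n * n) → Bool) → SimpleGraph (Fin n) := fun g =>
    bitGraph n 0 (extend Bool.toNat (fun _ => 0) g)
  let σ : SimpleGraph (Fin n) → Fin (n * n) → Bool := fun G z =>
    decide (∃ x y : Fin n, G.Adj x y ∧ (z : ℕ) = x * n + y)
  have hadj : ∀ g (x y : Fin n), (π g).Adj x y ↔ x ≠ y ∧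
      g ⟨max (x : ℕ) y * n + min (x : ℕ) y,
        mul_add_lt_mul_self (by omega) (by omega)⟩ = true := by
    intro g x y
    have h : max (x : ℕ) y * n + min (x : ℕ) y < n * n :=
      mul_add_lt_mul_self (by omega) (by omega)
    simp only [π, bitGraph, extend, h, dif_pos, Nat.not_lt_zero, false_or]
    refine and_congr Iff.rfl ?_
    cases g ⟨max (x : ℕ) y * n + min (x : ℕ) y, h⟩ <;> simp
  have hσ : ∀ G (x y : Fin n), σ G ⟨max (x : ℕ) y * n + min (x : ℕ) y,
      mul_add_lt_mul_self (by omega) (by omega)⟩ = true ↔ G.Adj x y := by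
    intro G x y
    simp only [σ, decide_eq_true_eq]
    constructor
    · rintro ⟨x', y', h, he⟩
      obtain ⟨h1, h2⟩ := mul_add_inj (by omega) y'.2 he
      rcases le_total (x : ℕ) y with hxy | hxy
      · rw [max_eq_right hxy] at h1
        rw [min_eq_left hxy] at h2
        rw [Fin.ext h1, Fin.ext h2]
        exact h.symm
      · rw [max_eq_left hxy] at h1
        rw [min_eq_right hxy] at h2
        rwa [Fin.ext h1, Fin.ext h2]
    · intro h
      rcases le_total (x : ℕ) y with hxy | hxy
      · exact ⟨y, x, h.symm, by rw [max_eq_right hxy, min_eq_left hxy]⟩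
      · exact ⟨x, y, h, by rw [max_eq_left hxy, min_eq_right hxy]⟩
  have hxor : ∀ g G, π (fun z => xor (g z) (σ G z)) = π g ∆ G := by
    intro g G
    ext x y
    rw [hadj, symmDiff_def, SimpleGraph.sup_adj, SimpleGraph.sdiff_adj, SimpleGraph.sdiff_adj, hadj,
      ← hσ G x y]
    by_cases hxy : x = y
    · subst hxy
      have := (hσ G x x).not.2 (SimpleGraph.irrefl G)
      simp only [ne_eq, not_true_eq_false, false_and, this]
      simp
    · simp only [ne_eq, hxy, not_false_iff, true_and]
      cases g ⟨max (x : ℕ) y * n + min (x : ℕ) y, mul_add_lt_mul_self (by omega) (by omega)⟩ <;>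
      cases σ G ⟨max (x : ℕ) y * n + min (x : ℕ) y, mul_add_lt_mul_self (by omega) (by omega)⟩ <;>
      simp
  have h1 : ∀ G, 𝔼 g, F (π g) = 𝔼 g, F (π g ∆ G) := by
    intro G
    symm
    have hinv : Function.Involutive fun (g : Fin (n * n) → Bool) z => xor (g z) (σ G z) := by
      intro g
      funext z
      simp
    exact Fintype.expect_equiv hinv.toPerm _ _ fun g => by
      rw [← hxor]
      rfl
  calc 𝔼 g, F (π g) = 𝔼 _G : SimpleGraph (Fin n), 𝔼 g, F (π g) := (Fintype.expect_const _).symm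
    _ = 𝔼 G : SimpleGraph (Fin n), 𝔼 g, F (π g ∆ G) :=
        Finset.expect_congr rfl fun G _ => h1 G
    _ = 𝔼 g, 𝔼 G : SimpleGraph (Fin n), F (π g ∆ G) := Finset.expect_comm _ _ _
    _ = 𝔼 _g : Fin (n * n) → Bool, 𝔼 G : SimpleGraph (Fin n), F G :=
        Finset.expect_congr rfl fun g _ => expect_symmDiff F _
    _ = 𝔼 G, F G := Fintype.expect_const _

lemma avg_plantedTree (p : ℕ) (F : SimpleGraph (Fin n) → ℝ) :
    (plantedTree n p).avg F = 𝔼 G, F (G ⊔ PlantedClique.cliqueOn (firstVertices n p)) := by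
  rw [plantedTree, Tree.avg_map, avg_arrTree avg_bitTree, ← expect_bitGraph]
  simp only [bitGraph_eq_sup p]

open Classical in
/-- A random graph contains `r` given edges with probability at most `2 ^ (-r)`. -/
lemma expect_edges_le (E : Finset (Sym2 (Fin n))) (hE : ∀ x ∈ E, ¬ x.IsDiag) :
    𝔼 G : SimpleGraph (Fin n), (if ∀ x ∈ E, x ∈ G.edgeSet then (1 : ℝ) else 0) ≤
      (1 / 2) ^ E.card := by
  set P := 𝔼 G : SimpleGraph (Fin n), (if ∀ x ∈ E, x ∈ G.edgeSet then (1 : ℝ) else 0) with hP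
  -- Each of the `2 ^ E.card` shifts by a set `T` of edges from `E` preserves the probability, while
  -- a given `G` satisfies the shifted condition only for `T = E \ G`. So `2 ^ E.card` equal
  -- probabilities add up to at most one.
  have h1 : ∀ T ∈ E.powerset, 𝔼 G : SimpleGraph (Fin n),
      (if ∀ x ∈ E, x ∈ (SimpleGraph.fromEdgeSet (T : Set (Sym2 (Fin n))) ∆ G).edgeSet
        then (1 : ℝ) else 0) = P := fun T _ =>
    expect_symmDiff (fun G => if ∀ x ∈ E, x ∈ G.edgeSet then (1 : ℝ) else 0) _
  have h2 : ∑ T ∈ E.powerset, 𝔼 G : SimpleGraph (Fin n),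
      (if ∀ x ∈ E, x ∈ (SimpleGraph.fromEdgeSet (T : Set (Sym2 (Fin n))) ∆ G).edgeSet
        then (1 : ℝ) else 0) ≤ 1 := by
    rw [← Finset.expect_sum_comm]
    refine Finset.expect_le Finset.univ_nonempty fun G _ => ?_
    rw [← Finset.sum_filter, Finset.sum_const, nsmul_eq_mul, mul_one]
    norm_cast
    refine Finset.card_le_one.2 fun T hT T' hT' => ?_
    have key : ∀ T ∈ E.powerset.filter (fun T : Finset (Sym2 (Fin n)) =>
        ∀ x ∈ E, x ∈ (SimpleGraph.fromEdgeSet (T : Set (Sym2 (Fin n))) ∆ G).edgeSet),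
        T = E.filter fun x => x ∉ G.edgeSet := by
      intro T hT
      rw [Finset.mem_filter, Finset.mem_powerset] at hT
      ext x
      rw [Finset.mem_filter]
      have hx : x ∈ E → (x ∈ T ↔ x ∉ G.edgeSet) := by
        intro hxE
        have h := hT.2 x hxE
        have hd := hE x hxE
        induction x using Sym2.ind with
        | _ v w =>
          rw [SimpleGraph.mem_edgeSet, symmDiff_def, SimpleGraph.sup_adj, SimpleGraph.sdiff_adj,
            SimpleGraph.sdiff_adj, SimpleGraph.fromEdgeSet_adj] at h
          rw [SimpleGraph.mem_edgeSet]
          rw [Sym2.mk_isDiag_iff] at hd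
          simp only [Finset.mem_coe] at h
          tauto
      constructor
      · intro hxT
        exact ⟨hT.1 hxT, (hx (hT.1 hxT)).1 hxT⟩
      · rintro ⟨hxE, hxG⟩
        exact (hx hxE).2 hxG
    rw [key T hT, key T' hT']
  rw [Finset.sum_congr rfl h1, Finset.sum_const, Finset.card_powerset, nsmul_eq_mul] at h2
  rw [one_div, inv_pow, ← one_div, le_div_iff₀ (by positivity), mul_comm]
  simpa using h2

end

/-! ### Random tuples -/

/-- The tuple graph, for typed tuples. -/
def tupGraph {n : ℕ} (G : SimpleGraph (Fin n)) {N L M : ℕ} (τ : Fin N → Fin L → Fin M) :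
    SimpleGraph (Fin N) where
  Adj i j := i ≠ j ∧ ∀ a c, ReflAdj G (τ i a) (τ j c)
  symm := ⟨fun _ _ h => ⟨h.1.symm, fun a c => (h.2 c a).symm⟩⟩
  loopless := ⟨fun _ h => h.1 rfl⟩

lemma avg_tuples {n : ℕ} (G : SimpleGraph (Fin n)) (N L r : ℕ)
    (F : SimpleGraph (Fin N) → ℝ) :
    ((arrTree (numTree r) (N * L) fun _ => 0).avg fun f => F (tupleGraph G N L f)) =
      𝔼 τ : Fin N → Fin L → Fin (2 ^ r), F (tupGraph G τ) := by
  rw [avg_arrTree (avg_numTree r)]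
  let e : (Fin (N * L) → Fin (2 ^ r)) ≃ (Fin N → Fin L → Fin (2 ^ r)) :=
    (Equiv.arrowCongr finProdFinEquiv.symm (Equiv.refl _)).trans (Equiv.curry _ _ _)
  refine Fintype.expect_equiv e _ _ fun g => ?_
  congr 1
  have h : ∀ (i : Fin N) (a : ℕ) (ha : a < L),
      extend (fun v : Fin (2 ^ r) => (v : ℕ)) (fun _ => 0) g (i * L + a) = e g i ⟨a, ha⟩ := by
    intro i a ha
    have hlt : (i : ℕ) * L + a < N * L := by
      have : ((i : ℕ) + 1) * L ≤ N * L := Nat.mul_le_mul_right _ i.2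
      rw [Nat.succ_mul] at this
      omega
    simp only [extend, hlt, dif_pos]
    congr 2
    ext
    simp [finProdFinEquiv, add_comm, mul_comm]
  ext i j
  simp only [tupleGraph, tupGraph]
  refine and_congr Iff.rfl ⟨fun hh a c => ?_, fun hh a ha c hc => ?_⟩
  · have := hh a a.2 c c.2
    rwa [h, h] at this
  · rw [h i a ha, h j c hc]
    exact hh _ _

end RAM

namespace RAM

open scoped BigOperators

/-! ### Soundness: random graphs have no certificates -/

/-- The union bound, for indicators. -/
lemma ite_le_sum {ι : Type*} {P : Prop} [Decidable P] (s : Finset ι) (Q : ι → Prop)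
    [DecidablePred Q]
    (h : P → ∃ x ∈ s, Q x) : (if P then (1 : ℝ) else 0) ≤ ∑ x ∈ s, if Q x then 1 else 0 := by
  split_ifs with hP
  · obtain ⟨x, hx, hQ⟩ := h hP
    calc (1 : ℝ) = if Q x then 1 else 0 := (if_pos hQ).symm
      _ ≤ _ := Finset.single_le_sum (f := fun x => if Q x then (1 : ℝ) else 0)
        (fun y _ => by split_ifs <;> norm_num) hx
  · exact Finset.sum_nonneg fun y _ => by split_ifs <;> norm_num

open Classical in
lemma expect_pi {ι X : Type*} [Fintype ι] [DecidableEq ι] [Fintype X] (B : ι → Finset X) :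
    𝔼 τ : ι → X, (if ∀ i, τ i ∈ B i then (1 : ℝ) else 0) =
      ∏ i, ((B i).card / Fintype.card X : ℝ) := by
  rw [Fintype.expect_eq_sum_div_card, ← Finset.sum_filter, Finset.sum_const, nsmul_eq_mul, mul_one,
    Finset.prod_div_distrib, Finset.prod_const, Finset.card_univ, Fintype.card_fun]
  have : Finset.univ.filter (fun τ : ι → X => ∀ i, τ i ∈ B i) = Fintype.piFinset B := by
    ext τ
    simp
  rw [this, Fintype.card_piFinset]
  push_cast
  rfl

/-- Any `s ≤ t` of the tuples have at least `b s` different entries. -/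
def Spread {N L M : ℕ} (b t : ℕ) (τ : Fin N → Fin L → Fin M) : Prop :=
  ∀ S : Finset (Fin N), S.card ≤ t →
    b * S.card ≤ (S.biUnion fun i => Finset.univ.image (τ i)).card

/-- Small sets of values are encoded by sequences of a fixed length, padded with the default `0`;
the union bound can then run over `M ^ c` functions. -/
lemma exists_cover {M c : ℕ} (hM : 0 < M) (U : Finset (Fin M)) (hU : U.card ≤ c) :
    ∃ w : Fin c → Fin M, ∀ x ∈ U, ∃ y, w y = x := by
  refine ⟨fun y => if h : (y : ℕ) < U.card then (U.equivFin.symm ⟨y, h⟩ : Fin M) else ⟨0, hM⟩,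
    fun x hx => ⟨⟨U.equivFin ⟨x, hx⟩, (U.equivFin ⟨x, hx⟩).2.trans_le hU⟩, ?_⟩⟩
  simp

open Classical in
lemma expect_covered_le {N L M c : ℕ} (S : Finset (Fin N)) (w : Fin c → Fin M) :
    𝔼 τ : Fin N → Fin L → Fin M, (if ∀ i ∈ S, ∀ a, ∃ y, w y = τ i a then (1 : ℝ) else 0) ≤
      ((c / M : ℝ) ^ L) ^ S.card := by
  let W : Finset (Fin M) := Finset.univ.image w
  let B : Fin N → Finset (Fin L → Fin M) := fun i =>
    if i ∈ S then Fintype.piFinset fun _ => W else Finset.univ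
  have h1 : ∀ τ : Fin N → Fin L → Fin M,
      (∀ i ∈ S, ∀ a, ∃ y, w y = τ i a) ↔ ∀ i, τ i ∈ B i := by
    intro τ
    refine forall_congr' fun i => ?_
    by_cases hi : i ∈ S <;> simp [B, hi, W]
  have h0 : 𝔼 τ : Fin N → Fin L → Fin M,
      (if ∀ i ∈ S, ∀ a, ∃ y, w y = τ i a then (1 : ℝ) else 0) =
      ∏ i, ((B i).card / Fintype.card (Fin L → Fin M) : ℝ) := by
    refine (Finset.expect_congr rfl fun τ _ => ?_).trans (expect_pi B)
    by_cases h : ∀ i, τ i ∈ B i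
    · rw [if_pos h, if_pos ((h1 τ).2 h)]
    · rw [if_neg h, if_neg (mt (h1 τ).1 h)]
  rw [h0]
  have hW : (W.card : ℝ) ≤ c := by
    have : W.card ≤ c := Finset.card_image_le.trans (by simp)
    exact_mod_cast this
  have h2 : ∀ i, ((B i).card / Fintype.card (Fin L → Fin M) : ℝ) ≤
      if i ∈ S then (c / M : ℝ) ^ L else 1 := by
    intro i
    by_cases hi : i ∈ S
    · simp only [B, hi, if_true, Fintype.card_piFinset, Finset.prod_const, Finset.card_univ,
        Fintype.card_fin, Fintype.card_fun]
      push_cast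
      rw [← div_pow]
      gcongr
    · simp only [B, hi, if_false, Finset.card_univ]
      exact div_self_le_one _
  refine (Finset.prod_le_prod (fun i _ => by positivity) fun i _ => h2 i).trans ?_
  rw [Finset.prod_ite, Finset.prod_const, Finset.prod_const_one, mul_one]
  simp

open Classical in
-- If spreading fails, the entries of some `s` tuples are all covered by a sequence of `b * s`
-- values. In the union bound `N ^ s` counts the sets of tuples, the power of `M` counts the
-- sequences, and the last factor bounds the probability that the given sequence covers the given
-- tuples.
lemma expect_not_spread_le {N L M : ℕ} (hM : 0 < M) (b t : ℕ) :
    𝔼 τ : Fin N → Fin L → Fin M, (if ¬ Spread b t τ then (1 : ℝ) else 0) ≤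
      ∑ s ∈ Finset.Icc 1 t, (N : ℝ) ^ s * ((M : ℝ) ^ (b * s) * (((b * s : ℕ) / M : ℝ) ^ L) ^ s) := by
  have h1 : ∀ τ : Fin N → Fin L → Fin M, (if ¬ Spread b t τ then (1 : ℝ) else 0) ≤
      ∑ s ∈ Finset.Icc 1 t, ∑ S ∈ (Finset.univ : Finset (Fin N)).powersetCard s,
        ∑ w : Fin (b * s) → Fin M,
          if ∀ i ∈ S, ∀ a, ∃ y, w y = τ i a then (1 : ℝ) else 0 := by
    intro τ
    have h2 := ite_le_sum (P := ¬ Spread b t τ)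
      ((Finset.Icc 1 t).sigma fun s => ((Finset.univ : Finset (Fin N)).powersetCard s ×ˢ
        (Finset.univ : Finset (Fin (b * s) → Fin M))))
      (fun x => ∀ i ∈ x.2.1, ∀ a, ∃ y, x.2.2 y = τ i a) ?_
    · rw [Finset.sum_sigma] at h2
      simp only [Finset.sum_product] at h2
      exact h2
    · intro h
      simp only [Spread, not_forall, not_le] at h
      obtain ⟨S, hS, hlt⟩ := h
      obtain ⟨w, hw⟩ := exists_cover hM _ hlt.le
      refine ⟨⟨S.card, S, w⟩, ?_, fun i hi a => hw _ ?_⟩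
      · simp only [Finset.mem_sigma, Finset.mem_Icc, Finset.mem_product, Finset.mem_powersetCard,
          Finset.subset_univ, Finset.mem_univ, and_true]
        refine ⟨?_, hS⟩
        by_contra h0
        have : S.card = 0 := by omega
        simp [this] at hlt
      · exact Finset.mem_biUnion.2 ⟨i, hi, Finset.mem_image_of_mem _ (Finset.mem_univ a)⟩
  refine (Finset.expect_le_expect fun τ _ => h1 τ).trans ?_
  rw [Finset.expect_sum_comm]
  refine Finset.sum_le_sum fun s _ => ?_
  rw [Finset.expect_sum_comm]
  have h3 : ∀ S ∈ (Finset.univ : Finset (Fin N)).powersetCard s,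
      𝔼 τ : Fin N → Fin L → Fin M, ∑ w : Fin (b * s) → Fin M,
        (if ∀ i ∈ S, ∀ a, ∃ y, w y = τ i a then (1 : ℝ) else 0) ≤
      (M : ℝ) ^ (b * s) * (((b * s : ℕ) / M : ℝ) ^ L) ^ s := by
    intro S hS
    rw [Finset.mem_powersetCard] at hS
    rw [Finset.expect_sum_comm]
    refine (Finset.sum_le_sum fun w _ => expect_covered_le S w).trans ?_
    rw [Finset.sum_const, Finset.card_univ, Fintype.card_fun, Fintype.card_fin, Fintype.card_fin,
      nsmul_eq_mul, hS.2]
    push_cast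
    exact le_rfl
  refine (Finset.sum_le_sum h3).trans ?_
  rw [Finset.sum_const, Finset.card_powersetCard, Finset.card_univ, Fintype.card_fin, nsmul_eq_mul]
  gcongr
  exact_mod_cast Nat.choose_le_pow N s

/-- By Hall's theorem, spread tuples have disjoint sets of `b` entries each. -/
lemma Spread.exists_injective {N L M b t : ℕ} {τ : Fin N → Fin L → Fin M} (h : Spread b t τ)
    (S : Finset (Fin N)) (hS : S.card ≤ t) :
    ∃ c : S × Fin b → Fin M, Function.Injective c ∧ ∀ x, ∃ a, τ x.1 a = c x := by
  classical
  -- Hall's theorem with `b` demands `(i, y)` per tuple, each asking for an entry of the tuple `i`.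
  -- A set of demands involves at least a `b`-th part as many tuples, and these have enough
  -- different entries.
  have key := (Finset.all_card_le_biUnion_card_iff_exists_injective
    (fun x : S × Fin b => Finset.univ.image (τ x.1))).1 ?_
  · obtain ⟨c, hc, hc'⟩ := key
    exact ⟨c, hc, fun x => by simpa using hc' x⟩
  · intro X
    let S' : Finset (Fin N) := X.image fun x => (x.1 : Fin N)
    have hS' : S' ⊆ S := by
      intro i hi
      obtain ⟨x, -, rfl⟩ := Finset.mem_image.1 hi
      exact x.1.2
    have h1 : X.card ≤ b * S'.card := by
      have h2 : X.card ≤ (S' ×ˢ (Finset.univ : Finset (Fin b))).card := by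
        refine Finset.card_le_card_of_injOn (fun x => ((x.1 : Fin N), x.2)) (fun x hx => ?_)
          fun x _ y _ hxy => ?_
        · simp only [Finset.coe_product, Set.mem_prod, Finset.mem_coe, Finset.mem_univ, and_true]
          exact Finset.mem_image_of_mem (fun x : S × Fin b => (x.1 : Fin N)) hx
        · simp only [Prod.mk.injEq] at hxy
          exact Prod.ext (Subtype.ext hxy.1) hxy.2
      rw [Finset.card_product, Finset.card_univ, Fintype.card_fin, mul_comm] at h2
      exact h2
    refine h1.trans ((h S' ((Finset.card_le_card hS').trans hS)).trans (Finset.card_le_card ?_))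
    intro y hy
    obtain ⟨i, hi, hy⟩ := Finset.mem_biUnion.1 hy
    obtain ⟨x, hx, rfl⟩ := Finset.mem_image.1 hi
    exact Finset.mem_biUnion.2 ⟨x, hx, hy⟩

open Classical in
/-- Given edges between few spread tuples are unlikely. -/
lemma expect_pairs_le {n N L M b t : ℕ} {τ : Fin N → Fin L → Fin M} (h : Spread b t τ)
    (S : Finset (Fin N)) (hS : S.card ≤ t) (E : Finset (Fin N × Fin N))
    (hE : ∀ x ∈ E, x.1 ∈ S ∧ x.2 ∈ S ∧ x.1 < x.2) :
    𝔼 G : SimpleGraph (Fin n), (if ∀ x ∈ E, (tupGraph G τ).Adj x.1 x.2 then (1 : ℝ) else 0) ≤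
      (1 / 2) ^ (E.card * b ^ 2) := by
  obtain ⟨c, hc, hcτ⟩ := h.exists_injective S hS
  have hadj : ∀ G : SimpleGraph (Fin n), (∀ x ∈ E, (tupGraph G τ).Adj x.1 x.2) →
      ∀ x (hx : x ∈ E) (y z : Fin b), ∃ (h₁ : (c (⟨x.1, (hE x hx).1⟩, y) : ℕ) < n)
        (h₂ : (c (⟨x.2, (hE x hx).2.1⟩, z) : ℕ) < n), G.Adj ⟨_, h₁⟩ ⟨_, h₂⟩ := by
    intro G hG x hx y z
    obtain ⟨a, ha⟩ := hcτ (⟨x.1, (hE x hx).1⟩, y)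
    obtain ⟨a', ha'⟩ := hcτ (⟨x.2, (hE x hx).2.1⟩, z)
    obtain ⟨h₁, h₂, h₃⟩ := (hG x hx).2 a a'
    simp only at ha ha'
    simp only [ha, ha'] at h₁ h₂ h₃
    refine ⟨h₁, h₂, h₃.resolve_left fun heq => ?_⟩
    have := hc (Fin.ext heq)
    simp only [Prod.mk.injEq, Subtype.mk.injEq] at this
    exact (hE x hx).2.2.ne this.1
  -- A graph `G₀` in the event shows that the chosen entries are vertices, which is needed to write
  -- down the `b²` edges that each pair of tuples forces. Without such a graph the probability is
  -- zero.
  by_cases hbad : ∃ G : SimpleGraph (Fin n), ∀ x ∈ E, (tupGraph G τ).Adj x.1 x.2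
  · obtain ⟨G₀, hG₀⟩ := hbad
    let φ : E × Fin b × Fin b → Sym2 (Fin n) := fun x =>
      s(⟨_, (hadj G₀ hG₀ x.1 x.1.2 x.2.1 x.2.2).1⟩,
        ⟨_, (hadj G₀ hG₀ x.1 x.1.2 x.2.1 x.2.2).2.1⟩)
    have hφ : Function.Injective φ := by
      rintro ⟨⟨x, hx⟩, y, z⟩ ⟨⟨x', hx'⟩, y', z'⟩ heq
      simp only [φ, Sym2.eq_iff, Fin.mk.injEq] at heq
      rcases heq with ⟨h1, h2⟩ | ⟨h1, h2⟩
      · have h3 := hc (Fin.ext h1)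
        have h4 := hc (Fin.ext h2)
        simp only [Prod.mk.injEq, Subtype.mk.injEq] at h3 h4
        simp only [Prod.mk.injEq, Subtype.mk.injEq]
        exact ⟨Prod.ext h3.1 h4.1, h3.2, h4.2⟩
      -- Edges can only coincide crosswise if the two pairs of tuples are reversals of each other,
      -- which the orientation `x.1 < x.2` excludes.
      · have h3 := hc (Fin.ext h1)
        have h4 := hc (Fin.ext h2)
        simp only [Prod.mk.injEq, Subtype.mk.injEq] at h3 h4
        have h5 := (hE x hx).2.2
        have h6 := (hE x' hx').2.2
        rw [h3.1, h4.1] at h5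
        exact absurd (h5.trans h6) (lt_irrefl _)
    let D : Finset (Sym2 (Fin n)) := Finset.univ.image φ
    have hD : D.card = E.card * b ^ 2 := by
      rw [Finset.card_image_of_injective _ hφ, Finset.card_univ]
      simp [sq]
    rw [← hD]
    refine le_trans (Finset.expect_le_expect fun G _ => ?_) (expect_edges_le D ?_)
    · have himp : (∀ x ∈ E, (tupGraph G τ).Adj x.1 x.2) → ∀ x ∈ D, x ∈ G.edgeSet := by
        intro hG x hx
        obtain ⟨⟨⟨x, hx'⟩, y, z⟩, -, rfl⟩ := Finset.mem_image.1 hx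
        exact (hadj G hG x hx' y z).2.2
      split_ifs with h1 h2 h2
      · exact le_rfl
      · exact absurd (himp h1) h2
      · norm_num
      · exact le_rfl
    · intro x hx
      obtain ⟨⟨⟨x, hx'⟩, y, z⟩, -, rfl⟩ := Finset.mem_image.1 hx
      simp only [φ, Sym2.mk_isDiag_iff]
      exact (hadj G₀ hG₀ x hx' y z).2.2.ne
  · push Not at hbad
    have : ∀ G : SimpleGraph (Fin n), ¬ ∀ x ∈ E, (tupGraph G τ).Adj x.1 x.2 := fun G hG => by
      obtain ⟨x, hx, hx'⟩ := hbad G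
      exact hx' (hG x hx)
    simp only [this, if_false, Finset.expect_const_zero]
    positivity

/-- Keeping the increasing pairs halves the symmetric count. The set of pairs is cut down to exactly
`k`, so that all terms of the later union bound have the same exponent. -/
lemma Cert.exists_pairs {d u b k N : ℕ} {H : SimpleGraph (Fin N)} {o : Fin N → ℕ}
    (h : Cert d u b k H o) : ∃ (S : Finset (Fin N)) (E : Finset (Fin N × Fin N)),
      4 * d ^ 2 * (u * S.card) ≤ k * b ∧ E.card = k ∧
      (∀ x ∈ E, x.1 ∈ S ∧ x.2 ∈ S ∧ x.1 < x.2) ∧ ∀ x ∈ E, H.Adj x.1 x.2 := by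
  classical
  obtain ⟨h1, h2⟩ := h
  let S : Finset (Fin N) := Finset.univ.filter fun i => o i ≠ 0
  let P : Finset (Fin N × Fin N) := Finset.univ.filter fun x =>
    x.1 ∈ S ∧ x.2 ∈ S ∧ x.1 < x.2 ∧ H.Adj x.1 x.2
  let P' : Finset (Fin N × Fin N) := Finset.univ.filter fun x =>
    x.1 ∈ S ∧ x.2 ∈ S ∧ x.2 < x.1 ∧ H.Adj x.1 x.2
  have hcard : P'.card = P.card := by
    refine Finset.card_bij' (fun x _ => x.swap) (fun x _ => x.swap) ?_ ?_ ?_ ?_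
    · intro x hx
      simp only [P, P', Finset.mem_filter, Finset.mem_univ, true_and, Prod.fst_swap,
        Prod.snd_swap] at hx ⊢
      exact ⟨hx.2.1, hx.1, hx.2.2.1, hx.2.2.2.symm⟩
    · intro x hx
      simp only [P, P', Finset.mem_filter, Finset.mem_univ, true_and, Prod.fst_swap,
        Prod.snd_swap] at hx ⊢
      exact ⟨hx.2.1, hx.1, hx.2.2.1, hx.2.2.2.symm⟩
    · simp
    · simp
  have hk : k ≤ P.card := by
    have h3 : ∑ i : Fin N, ∑ j : Fin N, (if o i ≠ 0 ∧ o j ≠ 0 ∧ H.Adj i j then 1 else 0) ≤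
        (P ∪ P').card := by
      rw [← Finset.sum_product', Finset.univ_product_univ, ← Finset.card_filter]
      refine Finset.card_le_card fun x hx => ?_
      simp only [P, P', S, Finset.mem_union, Finset.mem_filter, Finset.mem_univ, true_and] at hx ⊢
      rcases lt_or_gt_of_ne hx.2.2.ne with h | h
      · exact Or.inl ⟨hx.1, hx.2.1, h, hx.2.2⟩
      · exact Or.inr ⟨hx.1, hx.2.1, h, hx.2.2⟩
    have h4 := Finset.card_union_le P P'
    have h5 := h1.trans (le_of_eq_of_le (by congr!) h3)
    omega
  obtain ⟨E, hE, hEk⟩ := Finset.exists_subset_card_eq hk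
  refine ⟨S, E, ?_, hEk, fun x hx => ?_, fun x hx => ?_⟩
  · rw [Finset.card_filter]
    convert h2
  · have := (Finset.mem_filter.1 (hE hx)).2
    exact ⟨this.1, this.2.1, this.2.2.1⟩
  · exact (Finset.mem_filter.1 (hE hx)).2.2.2.2

open Classical in
-- Union bound over the size `s`, the set of tuples and the `k` pairs: for each `s` there are at
-- most `N^s 2^(s²)` choices, of probability at most `2^(-kb²)` each. The size condition gives `kb²
-- ≥ 4d²ubs`, at least twice the exponent of `N^s`; the surplus pays for `s²` and for the final
-- bound. The sum over `s` costs the factor `k`.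
lemma expect_cert_le_of_spread {n N L M d u b k : ℕ} {τ : Fin N → Fin L → Fin M}
    (h : Spread b k τ) (hk : 0 < k) (hkb : k ≤ b ^ 2) (hd : 0 < d) (hu : 0 < u) (hb : b ≤ 2 * u)
    (hN : N ≤ 2 ^ ((d - 1) * (2 * d) * (u * b))) :
    𝔼 G : SimpleGraph (Fin n), (if ∃ o, Cert d u b k (tupGraph G τ) o then (1 : ℝ) else 0) ≤
      k * (1 / 2) ^ (d ^ 2 * (u * b)) := by
  have hub : 0 < u * b := by
    refine Nat.mul_pos hu (Nat.pos_of_ne_zero ?_)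
    rintro rfl
    omega
  let I : Finset (Σ _ : ℕ, Finset (Fin N) × Finset (Fin N × Fin N)) :=
    ((Finset.Icc 1 k).filter fun s => 4 * d ^ 2 * (u * s) ≤ k * b).sigma fun s =>
      ((Finset.univ : Finset (Fin N)).powersetCard s ×ˢ Finset.univ).filter fun x =>
        x.2.card = k ∧ ∀ y ∈ x.2, y.1 ∈ x.1 ∧ y.2 ∈ x.1 ∧ y.1 < y.2
  have h1 : ∀ G : SimpleGraph (Fin n),
      (if ∃ o, Cert d u b k (tupGraph G τ) o then (1 : ℝ) else 0) ≤
      ∑ x ∈ I, if ∀ y ∈ x.2.2, (tupGraph G τ).Adj y.1 y.2 then 1 else 0 := by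
    intro G
    refine ite_le_sum I (fun x => ∀ y ∈ x.2.2, (tupGraph G τ).Adj y.1 y.2) ?_
    rintro ⟨o, ho⟩
    obtain ⟨S, E, h1, h2, h3, h4⟩ := ho.exists_pairs
    refine ⟨⟨S.card, S, E⟩, ?_, h4⟩
    simp only [I, Finset.mem_sigma, Finset.mem_filter, Finset.mem_Icc, Finset.mem_product,
      Finset.mem_powersetCard, Finset.subset_univ, Finset.mem_univ, and_true, true_and]
    refine ⟨⟨⟨?_, ?_⟩, h1⟩, h2, h3⟩
    · obtain ⟨x, hx⟩ := Finset.card_pos.1 (h2 ▸ hk)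
      exact Finset.card_pos.2 ⟨_, (h3 x hx).1⟩
    -- From `4d²us ≤ kb` and `b ≤ 2u` follows `s ≤ k`, so the spreading hypothesis applies to `S`.
    · have h5 : u * S.card ≤ d ^ 2 * (u * S.card) := Nat.le_mul_of_pos_left _ (by positivity)
      have h6 : k * b ≤ k * (2 * u) := Nat.mul_le_mul_left _ hb
      by_contra hlt
      have h7 : u * k < u * S.card := Nat.mul_lt_mul_of_pos_left (not_le.1 hlt) hu
      nlinarith
  refine (Finset.expect_le_expect fun G _ => h1 G).trans ?_
  rw [Finset.expect_sum_comm]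
  have h2 : ∀ x ∈ I, 𝔼 G : SimpleGraph (Fin n),
      (if ∀ y ∈ x.2.2, (tupGraph G τ).Adj y.1 y.2 then (1 : ℝ) else 0) ≤ (1 / 2) ^ (k * b ^ 2) := by
    intro x hx
    simp only [I, Finset.mem_sigma, Finset.mem_filter, Finset.mem_Icc, Finset.mem_product,
      Finset.mem_powersetCard] at hx
    have := expect_pairs_le (n := n) h x.2.1 (by omega) x.2.2 hx.2.2.2
    rwa [hx.2.2.1] at this
  refine (Finset.sum_le_sum h2).trans ?_
  rw [Finset.sum_sigma]
  have h3 : ∀ s ∈ (Finset.Icc 1 k).filter fun s => 4 * d ^ 2 * (u * s) ≤ k * b,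
      ∑ _x ∈ ((Finset.univ : Finset (Fin N)).powersetCard s ×ˢ
        (Finset.univ : Finset (Finset (Fin N × Fin N)))).filter (fun x =>
        x.2.card = k ∧ ∀ y ∈ x.2, y.1 ∈ x.1 ∧ y.2 ∈ x.1 ∧ y.1 < y.2), (1 / 2 : ℝ) ^ (k * b ^ 2) ≤
      (1 / 2) ^ (d ^ 2 * (u * b)) := by
    intro s hs
    simp only [Finset.mem_filter, Finset.mem_Icc] at hs
    obtain ⟨⟨hs1, hsk⟩, hs4⟩ := hs
    rw [Finset.sum_const, nsmul_eq_mul]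
    have h4 : (((Finset.univ : Finset (Fin N)).powersetCard s ×ˢ
        (Finset.univ : Finset (Finset (Fin N × Fin N)))).filter fun x =>
        x.2.card = k ∧ ∀ y ∈ x.2, y.1 ∈ x.1 ∧ y.2 ∈ x.1 ∧ y.1 < y.2).card ≤
        2 ^ ((d - 1) * (2 * d) * (u * b) * s + s * s) := by
      calc _ ≤ (((Finset.univ : Finset (Fin N)).powersetCard s).biUnion fun S =>
            (S ×ˢ S).powerset.image fun E => (S, E)).card := by
            refine Finset.card_le_card fun x hx => ?_
            simp only [Finset.mem_filter, Finset.mem_product, Finset.mem_biUnion,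
              Finset.mem_image, Finset.mem_powerset] at hx ⊢
            exact ⟨x.1, hx.1.1, x.2, fun y hy =>
              Finset.mem_product.2 ⟨(hx.2.2 y hy).1, (hx.2.2 y hy).2.1⟩, rfl⟩
        _ ≤ ((Finset.univ : Finset (Fin N)).powersetCard s).card * 2 ^ (s * s) := by
            refine Finset.card_biUnion_le_card_mul _ _ _ fun S hS => ?_
            refine Finset.card_image_le.trans ?_
            rw [Finset.card_powerset, Finset.card_product, (Finset.mem_powersetCard.1 hS).2]
        _ ≤ _ := by
            rw [pow_add, pow_mul _ ((d - 1) * (2 * d) * (u * b))]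
            refine Nat.mul_le_mul_right _ ?_
            rw [Finset.card_powersetCard, Finset.card_univ, Fintype.card_fin]
            exact (Nat.choose_le_pow N s).trans (Nat.pow_le_pow_left hN s)
    -- Since `1 ≤ s ≤ d²ub`, both `s²` and `d²ub` are at most `d²ubs`; the sum is at most `(4d² -
    -- 2d)ubs`, while `kb² ≥ 4d²ubs`.
    have h5 : (d - 1) * (2 * d) * (u * b) * s + s * s + d ^ 2 * (u * b) ≤ k * b ^ 2 := by
      obtain ⟨d, rfl⟩ : ∃ d', d = d' + 1 := ⟨d - 1, by omega⟩
      rw [Nat.add_sub_cancel]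
      have h6 : s ≤ (d + 1) ^ 2 * (u * b) := by
        have h7 : k * b ≤ b ^ 2 * b := Nat.mul_le_mul_right _ hkb
        have h8 : b * b ≤ (2 * u) * (2 * u) := Nat.mul_le_mul hb hb
        have h9 : b * b * b ≤ (2 * u) * (2 * u) * b := Nat.mul_le_mul_right _ h8
        have h10 : u * s ≤ u * (u * b) := by
          have : u * s ≤ (d + 1) ^ 2 * (u * s) := Nat.le_mul_of_pos_left _ (by positivity)
          nlinarith
        have h11 : s ≤ u * b := Nat.le_of_mul_le_mul_left h10 hu
        exact h11.trans (Nat.le_mul_of_pos_left _ (by positivity))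
      have h7 : s * s ≤ (d + 1) ^ 2 * (u * b) * s := Nat.mul_le_mul_right _ h6
      have h8 : (d + 1) ^ 2 * (u * b) * 1 ≤ (d + 1) ^ 2 * (u * b) * s := Nat.mul_le_mul_left _ hs1
      have h9 : 4 * (d + 1) ^ 2 * (u * s) * b ≤ k * b * b := Nat.mul_le_mul_right _ hs4
      nlinarith [Nat.zero_le ((d + 1) * (u * b) * s)]
    calc _ ≤ ((2 : ℝ) ^ ((d - 1) * (2 * d) * (u * b) * s + s * s)) * (1 / 2) ^ (k * b ^ 2) := by
          gcongr
          exact_mod_cast h4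
      _ ≤ ((2 : ℝ) ^ ((d - 1) * (2 * d) * (u * b) * s + s * s)) *
          (1 / 2) ^ ((d - 1) * (2 * d) * (u * b) * s + s * s + d ^ 2 * (u * b)) := by
          gcongr ?_ * ?_
          exact pow_le_pow_of_le_one (by norm_num) (by norm_num) h5
      _ = _ := by
          rw [pow_add (1 / 2 : ℝ) (_ + _), ← mul_assoc, ← mul_pow]
          norm_num
  refine (Finset.sum_le_sum h3).trans ?_
  rw [Finset.sum_const, nsmul_eq_mul]
  gcongr
  exact (Finset.card_filter_le _ _).trans (by simp)

/-- In binary logarithms, length `2db` and number `2^(2d(d-1)ub)` of the tuples leave a surplus of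
`dubs` after `N^s` and `M^(bs)` are paid for. One half covers the powers of `bs ≤ b³ ≤ 2^(3w)`, as
`12w ≤ u`; the other half is at least `8ud`, as `bs ≥ 16`. -/
lemma not_spread_term_le {d u b w s : ℕ} (hd : 0 < d) (hb : 16 ≤ b) (hw : b ≤ 2 ^ w)
    (hwu : 12 * w ≤ u) (hs : 1 ≤ s) (hsb : s ≤ b ^ 2) :
    ((2 ^ ((d - 1) * (2 * d) * (u * b)) : ℕ) : ℝ) ^ s * (((2 ^ (d * u) : ℕ) : ℝ) ^ (b * s) *
      (((b * s : ℕ) / (2 ^ (d * u) : ℕ) : ℝ) ^ (2 * d * b)) ^ s) ≤ (1 / 2) ^ (4 * u * d) := by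
  have h1 : ((b * s : ℕ) : ℝ) ≤ 2 ^ (3 * w) := by
    have : b * s ≤ 2 ^ (3 * w) := by
      calc b * s ≤ b * b ^ 2 := Nat.mul_le_mul_left _ hsb
        _ = b ^ 3 := by ring
        _ ≤ (2 ^ w) ^ 3 := Nat.pow_le_pow_left hw 3
        _ = 2 ^ (3 * w) := by rw [← pow_mul, mul_comm]
    exact_mod_cast this
  have h2 : (d - 1) * (2 * d) * (u * b) * s + d * u * (b * s) + 3 * w * (2 * d * b) * s +
      4 * u * d ≤ d * u * (2 * d * b) * s := by
    obtain ⟨d, rfl⟩ : ∃ d', d = d' + 1 := ⟨d - 1, by omega⟩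
    rw [Nat.add_sub_cancel]
    have h3 : 12 * w * ((d + 1) * b * s) ≤ u * ((d + 1) * b * s) := Nat.mul_le_mul_right _ hwu
    have h4 : 16 * 1 ≤ b * s := Nat.mul_le_mul hb hs
    have h5 : u * (d + 1) * (16 * 1) ≤ u * (d + 1) * (b * s) := Nat.mul_le_mul_left _ h4
    nlinarith
  have h3 : (((b * s : ℕ) / (2 ^ (d * u) : ℕ) : ℝ) ^ (2 * d * b)) ^ s ≤
      2 ^ (3 * w * (2 * d * b) * s) / 2 ^ (d * u * (2 * d * b) * s) := by
    rw [← pow_mul, div_pow, mul_assoc (3 * w), pow_mul _ (3 * w), mul_assoc (d * u),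
      pow_mul _ (d * u)]
    push_cast
    push_cast at h1
    gcongr
  calc _ ≤ ((2 ^ ((d - 1) * (2 * d) * (u * b)) : ℕ) : ℝ) ^ s * (((2 ^ (d * u) : ℕ) : ℝ) ^ (b * s) *
        (2 ^ (3 * w * (2 * d * b) * s) / 2 ^ (d * u * (2 * d * b) * s))) := by gcongr
    _ = 2 ^ ((d - 1) * (2 * d) * (u * b) * s + d * u * (b * s) + 3 * w * (2 * d * b) * s) /
        2 ^ (d * u * (2 * d * b) * s) := by
        push_cast
        rw [← pow_mul, ← pow_mul, pow_add, pow_add]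
        ring
    _ ≤ _ := by
        rw [div_le_iff₀ (by positivity), one_div, inv_pow, ← div_eq_inv_mul,
          le_div_iff₀ (by positivity), ← pow_add]
        exact pow_le_pow_right₀ (by norm_num) h2

open Classical in
/-- A random graph with random tuples has a certificate with very small probability. -/
lemma expect_cert_le {n d u b k w : ℕ} (hk : 0 < k) (hkb : k ≤ b ^ 2) (hd : 0 < d) (hu : 0 < u)
    (hb : b ≤ 2 * u) (hb16 : 16 ≤ b) (hw : b ≤ 2 ^ w) (hwu : 12 * w ≤ u) :
    𝔼 G : SimpleGraph (Fin n), 𝔼 τ : Fin (numTuples d u b) → Fin (2 * d * b) → Fin (2 ^ (d * u)),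
      (if ∃ o, Cert d u b k (tupGraph G τ) o then (1 : ℝ) else 0) ≤
      2 * b ^ 2 * (1 / 2) ^ (4 * u * d) := by
  -- The tuples are fixed first; the randomness of `G` is used only if they are spread.
  rw [Finset.expect_comm]
  have hp : (1 / 2 : ℝ) ^ (d ^ 2 * (u * b)) ≤ (1 / 2) ^ (4 * u * d) := by
    refine pow_le_pow_of_le_one (by norm_num) (by norm_num) ?_
    have h1 : u * d * 16 ≤ u * d * b := Nat.mul_le_mul_left _ hb16
    have h2 : u * d * b * 1 ≤ u * d * b * d := Nat.mul_le_mul_left _ hd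
    nlinarith
  have hkr : (k : ℝ) ≤ b ^ 2 := by exact_mod_cast hkb
  have h1 : ∀ τ : Fin (numTuples d u b) → Fin (2 * d * b) → Fin (2 ^ (d * u)),
      𝔼 G : SimpleGraph (Fin n), (if ∃ o, Cert d u b k (tupGraph G τ) o then (1 : ℝ) else 0) ≤
      b ^ 2 * (1 / 2) ^ (4 * u * d) + if ¬ Spread b k τ then 1 else 0 := by
    intro τ
    by_cases hS : Spread b k τ
    · rw [if_neg (not_not.2 hS), add_zero]
      refine (expect_cert_le_of_spread hS hk hkb hd hu hb le_rfl).trans ?_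
      gcongr
    · rw [if_pos hS]
      refine le_trans (Finset.expect_le Finset.univ_nonempty fun G _ => ?_)
        (le_add_of_nonneg_left (by positivity))
      split_ifs <;> norm_num
  refine (Finset.expect_le_expect fun τ _ => h1 τ).trans ?_
  rw [Finset.expect_add_distrib]
  have : Nonempty (Fin (numTuples d u b) → Fin (2 * d * b) → Fin (2 ^ (d * u))) :=
    ⟨fun _ _ => ⟨0, by positivity⟩⟩
  rw [Fintype.expect_const]
  have h2 := expect_not_spread_le (N := numTuples d u b) (L := 2 * d * b) (M := 2 ^ (d * u))
    (by positivity) b k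
  have h3 : ∑ s ∈ Finset.Icc 1 k, ((numTuples d u b : ℕ) : ℝ) ^ s * (((2 ^ (d * u) : ℕ) : ℝ) ^ (b * s) *
      (((b * s : ℕ) / (2 ^ (d * u) : ℕ) : ℝ) ^ (2 * d * b)) ^ s) ≤ b ^ 2 * (1 / 2) ^ (4 * u * d) := by
    refine (Finset.sum_le_sum fun s hs => not_spread_term_le hd hb16 hw hwu
      (Finset.mem_Icc.1 hs).1 ((Finset.mem_Icc.1 hs).2.trans hkb)).trans ?_
    rw [Finset.sum_const, Nat.card_Icc, Nat.add_sub_cancel, nsmul_eq_mul]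
    gcongr
  have h4 := h2.trans h3
  calc _ ≤ b ^ 2 * (1 / 2 : ℝ) ^ (4 * u * d) + b ^ 2 * (1 / 2 : ℝ) ^ (4 * u * d) :=
        add_le_add le_rfl (by convert h4)
    _ = _ := by ring

end RAM

namespace RAM

open scoped BigOperators

/-! ### Success probabilities -/

namespace Tree

/-- The probability that the value is `true`. -/
noncomputable def pr (c : Tree Bool) : ℝ := c.avg fun x => if x then 1 else 0

lemma pr_nonneg (c : Tree Bool) : 0 ≤ c.pr := c.avg_nonneg fun a => by split_ifs <;> norm_num

lemma pr_le_one (c : Tree Bool) : c.pr ≤ 1 := by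
  have := c.avg_mono (F := fun x => if x then 1 else 0) (F' := fun _ => 1)
    fun a => by split_ifs <;> norm_num
  rwa [avg_const] at this

lemma avg_false (c : Tree Bool) : (c.avg fun x => if x then 0 else 1) = 1 - c.pr := by
  rw [pr, ← c.avg_const 1, ← avg_sub, avg_const]
  congr 1
  funext x
  cases x <;> simp

/-- If a round multiplies the average of `F` by a factor that does not depend on the state, the
factors multiply over the loop. For indicators of success or failure this expresses the independence
of the rounds. -/
lemma avg_down_mul {α : Type} {s : ℕ → α → Tree α} {F : α → ℝ} {c : ℕ → ℝ}
    (h : ∀ j x, (s j x).avg F = F x * c j) (n : ℕ) (x : α) :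
    (down s n x).avg F = F x * ∏ j ∈ Finset.range n, c j := by
  induction n generalizing x with
  | zero => simp [down]
  | succ n ih =>
    rw [down, avg_bind]
    simp only [ih, avg_mul_right, h]
    rw [Finset.prod_range_succ]
    ring

end Tree

lemma one_sub_pr_tryTree (A : Prog) (d e u b : ℕ) {n : ℕ} (G : SimpleGraph (Fin n)) :
    1 - (tryTree A d e u b G).pr =
      (∏ κ ∈ Finset.range b, (1 - (attemptTree A d e u b G (κ + 1)).pr)) ^ n := by
  rw [← Tree.avg_false, tryTree, Tree.avg_down_mul (c := fun _ => ∏ κ ∈ Finset.range b,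
    (1 - (attemptTree A d e u b G (κ + 1)).pr))]
  · simp
  · intro _ x
    refine Tree.avg_down_mul (fun κ x => ?_) b x
    rw [Tree.avg_map, ← Tree.avg_false]
    cases x
    · simp
    · simp [Tree.avg_const]

lemma one_sub_sum_le_prod {ι : Type*} (s : Finset ι) {p : ι → ℝ} (h0 : ∀ i ∈ s, 0 ≤ p i)
    (h1 : ∀ i ∈ s, p i ≤ 1) : 1 - ∑ i ∈ s, p i ≤ ∏ i ∈ s, (1 - p i) := by
  classical
  induction s using Finset.induction_on with
  | empty => simp
  | insert a s ha ih =>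
    rw [Finset.sum_insert ha, Finset.prod_insert ha]
    have h2 := ih (fun i hi => h0 i (Finset.mem_insert_of_mem hi))
      fun i hi => h1 i (Finset.mem_insert_of_mem hi)
    have h3 := h0 a (Finset.mem_insert_self a s)
    have h4 : ∏ i ∈ s, (1 - p i) ≤ 1 :=
      Finset.prod_le_one (fun i hi => sub_nonneg.2 (h1 i (Finset.mem_insert_of_mem hi)))
        fun i hi => sub_le_self _ (h0 i (Finset.mem_insert_of_mem hi))
    nlinarith

/-- The union bound over all rounds and clique sizes, obtained from the product formula by
Bernoulli's inequality. -/
lemma pr_tryTree_le (A : Prog) (d e u b : ℕ) {n : ℕ} (G : SimpleGraph (Fin n)) :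
    (tryTree A d e u b G).pr ≤
      n * ∑ κ ∈ Finset.range b, (attemptTree A d e u b G (κ + 1)).pr := by
  have h1 : 1 - ∑ κ ∈ Finset.range b, (attemptTree A d e u b G (κ + 1)).pr ≤
      ∏ κ ∈ Finset.range b, (1 - (attemptTree A d e u b G (κ + 1)).pr) :=
    one_sub_sum_le_prod _ (fun _ _ => Tree.pr_nonneg _) fun _ _ => Tree.pr_le_one _
  have h2 : 0 ≤ ∏ κ ∈ Finset.range b, (1 - (attemptTree A d e u b G (κ + 1)).pr) :=
    Finset.prod_nonneg fun _ _ => sub_nonneg.2 (Tree.pr_le_one _)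
  set P := ∏ κ ∈ Finset.range b, (1 - (attemptTree A d e u b G (κ + 1)).pr) with hP
  have h3 : 1 + (n : ℝ) * (P - 1) ≤ (1 + (P - 1)) ^ n :=
    one_add_mul_le_pow (by linarith) n
  have h4 := one_sub_pr_tryTree A d e u b G
  rw [← hP] at h4
  rw [add_sub_cancel] at h3
  have h5 : (n : ℝ) * (1 - P) ≤
      n * ∑ κ ∈ Finset.range b, (attemptTree A d e u b G (κ + 1)).pr := by
    gcongr
    linarith
  linarith

/-- All other factors of the failure probability are at most one, so a single good clique size
suffices, and the program need not know which one it is. -/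
lemma le_pr_tryTree (A : Prog) (d e u : ℕ) {b n κ : ℕ} (G : SimpleGraph (Fin n)) (hκ : κ < b)
    (h : 1 / 3 ≤ (attemptTree A d e u b G (κ + 1)).pr) :
    1 - (2 / 3) ^ n ≤ (tryTree A d e u b G).pr := by
  have h1 : ∏ κ ∈ Finset.range b, (1 - (attemptTree A d e u b G (κ + 1)).pr) ≤ 2 / 3 := by
    rw [← Finset.mul_prod_erase _ _ (Finset.mem_range.2 hκ)]
    have : ∏ x ∈ (Finset.range b).erase κ, (1 - (attemptTree A d e u b G (x + 1)).pr) ≤ 1 :=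
      Finset.prod_le_one (fun _ _ => sub_nonneg.2 (Tree.pr_le_one _))
        fun _ _ => sub_le_self _ (Tree.pr_nonneg _)
    have h0 := Tree.pr_le_one (attemptTree A d e u b G (κ + 1))
    nlinarith
  have h2 := one_sub_pr_tryTree A d e u b G
  have h3 := pow_le_pow_left₀ (Finset.prod_nonneg fun κ _ =>
    sub_nonneg.2 (Tree.pr_le_one (attemptTree A d e u b G (κ + 1)))) h1 n
  linarith

/-- The probability that a certificate is found if the clique on `C` is added to a random graph. -/
noncomputable def plantedPr (A : Prog) (d e u b : ℕ) {n : ℕ} (C : Finset (Fin n)) : ℝ :=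
  𝔼 G, (tryTree A d e u b (G ⊔ PlantedClique.cliqueOn C)).pr

lemma plantedPr_nonneg (A : Prog) (d e u b : ℕ) {n : ℕ} (C : Finset (Fin n)) :
    0 ≤ plantedPr A d e u b C := Finset.expect_nonneg fun _ _ => Tree.pr_nonneg _

lemma plantedPr_le_one (A : Prog) (d e u b : ℕ) {n : ℕ} (C : Finset (Fin n)) :
    plantedPr A d e u b C ≤ 1 :=
  Finset.expect_le Finset.univ_nonempty fun _ _ => Tree.pr_le_one _

lemma pr_testTree (A : Prog) (d e u b n q : ℕ) :
    (testTree A d e u b n q).pr =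
      ∏ c ∈ Finset.range (n + 1 - q), plantedPr A d e u b (firstVertices n (q + c)) ^ n := by
  rw [testTree, Tree.pr, Tree.avg_down_mul (c := fun c =>
    plantedPr A d e u b (firstVertices n (q + c)) ^ n)]
  · simp
  · intro c x
    rw [Tree.avg_down_mul (c := fun _ => plantedPr A d e u b (firstVertices n (q + c)))]
    · simp
    · intro _ x
      rw [Tree.avg_bind, avg_plantedTree, plantedPr, Finset.mul_expect]
      refine Finset.expect_congr rfl fun G _ => ?_
      rw [Tree.avg_map]
      cases x
      · simp [Tree.avg_const]
      · simp [Tree.pr]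

/-- The probability that the algorithm finds a certificate in `H`, within its budget. -/
noncomputable def certPr (A : Prog) (d e u b κ : ℕ) {N : ℕ} (H : SimpleGraph (Fin N)) : ℝ :=
  open Classical in
  (interp A (inputMem H ((κ + 1).choose 2), budget e u b)).avg fun y =>
    if Cert d u b ((κ + 1).choose 2) H (fun i => y.1 2 i) then 1 else 0

lemma pr_attemptTree (A : Prog) (d e u b : ℕ) {n : ℕ} (G : SimpleGraph (Fin n)) (κ : ℕ) :
    (attemptTree A d e u b G κ).pr =
      𝔼 τ : Fin (numTuples d u b) → Fin (2 * d * b) → Fin (2 ^ (d * u)),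
        certPr A d e u b κ (tupGraph G τ) := by
  rw [← avg_tuples, Tree.pr, attemptTree, Tree.avg_bind]
  simp only [Tree.avg_map, certPr]
  congr! 5
  simp

open Classical in
-- The output is verified, so success requires that a certificate exists. This is why soundness
-- needs no assumption on `A`.
lemma certPr_le (A : Prog) (d e u b κ : ℕ) {N : ℕ} (H : SimpleGraph (Fin N)) :
    certPr A d e u b κ H ≤ if ∃ o, Cert d u b ((κ + 1).choose 2) H o then 1 else 0 := by
  rw [← Tree.avg_const (interp A (inputMem H ((κ + 1).choose 2), budget e u b))
    (if ∃ o, Cert d u b ((κ + 1).choose 2) H o then 1 else 0)]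
  refine Tree.avg_mono _ fun y => ?_
  split_ifs with h1 h2
  · exact le_rfl
  · exact absurd ⟨_, h1⟩ h2
  · norm_num
  · exact le_rfl

lemma choose_two_pos {κ : ℕ} (h : 0 < κ) : 0 < (κ + 1).choose 2 := Nat.choose_pos (by omega)

lemma choose_two_le_sq {κ b : ℕ} (h0 : 0 < b) (h : κ ≤ b) : (κ + 1).choose 2 ≤ b ^ 2 := by
  rw [Nat.choose_two_right, Nat.add_sub_cancel]
  refine Nat.div_le_of_le_mul ?_
  have : (κ + 1) * κ ≤ (b + 1) * b := Nat.mul_le_mul (by omega) h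
  nlinarith

/-- Soundness: on a random graph, a certificate is found with small probability only. -/
lemma expect_tryTree_le (A : Prog) {d e u b n w : ℕ} (hd : 0 < d) (hu : 0 < u) (hb : b ≤ 2 * u)
    (hb16 : 16 ≤ b) (hw : b ≤ 2 ^ w) (hwu : 12 * w ≤ u) :
    𝔼 G : SimpleGraph (Fin n), (tryTree A d e u b G).pr ≤
      n * (b * (2 * b ^ 2 * (1 / 2) ^ (4 * u * d))) := by
  classical
  refine (Finset.expect_le_expect fun G _ => pr_tryTree_le A d e u b G).trans ?_
  rw [← Finset.mul_expect, Finset.expect_sum_comm]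
  gcongr
  refine (Finset.sum_le_sum (g := fun _ => 2 * (b : ℝ) ^ 2 * (1 / 2) ^ (4 * u * d))
    fun κ hκ => ?_).trans (by simp)
  refine le_trans (Finset.expect_le_expect fun G _ => ?_)
    (expect_cert_le (n := n) (choose_two_pos (κ := κ + 1) (by omega))
      (choose_two_le_sq (by omega) (Nat.succ_le_of_lt (Finset.mem_range.1 hκ))) hd hu hb hb16 hw hwu)
  rw [pr_attemptTree]
  exact Finset.expect_le_expect fun τ _ => certPr_le _ _ _ _ _ _ _

/-! ### Invariance under relabelling -/

/-- The permutation is extended by the identity to the numbers that are not vertices. Relabelling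
`G` then amounts to relabelling the entries of the tuples, which preserves their uniform law. -/
lemma tupGraph_comap {n N L M : ℕ} (hn : n ≤ M) (G : SimpleGraph (Fin n)) (σ : Equiv.Perm (Fin n))
    (τ : Fin N → Fin L → Fin M) :
    tupGraph (G.comap σ) τ =
      tupGraph G fun i a => σ.viaFintypeEmbedding (Fin.castLEEmb hn) (τ i a) := by
  have h1 : ∀ x : Fin M, (hx : (x : ℕ) < n) →
      σ.viaFintypeEmbedding (Fin.castLEEmb hn) x = Fin.castLE hn (σ ⟨x, hx⟩) := fun x hx =>
    Equiv.Perm.viaFintypeEmbedding_apply_image σ (Fin.castLEEmb hn) ⟨x, hx⟩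
  have h2 : ∀ x : Fin M, ¬ (x : ℕ) < n → σ.viaFintypeEmbedding (Fin.castLEEmb hn) x = x := by
    intro x hx
    refine Equiv.Perm.viaFintypeEmbedding_apply_notMem_range _ _ ?_
    rintro ⟨y, rfl⟩
    exact hx y.2
  have h3 : ∀ x y : Fin M, ReflAdj (G.comap σ) x y ↔
      ReflAdj G (σ.viaFintypeEmbedding (Fin.castLEEmb hn) x : ℕ)
        (σ.viaFintypeEmbedding (Fin.castLEEmb hn) y) := by
    intro x y
    by_cases hx : (x : ℕ) < n
    · by_cases hy : (y : ℕ) < n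
      · rw [h1 x hx, h1 y hy]
        simp only [ReflAdj, hx, hy, exists_true_left, Fin.val_castLE, Fin.is_lt,
          SimpleGraph.comap_adj, Fin.eta]
        refine or_congr ?_ Iff.rfl
        rw [Fin.val_inj (a := σ _), σ.injective.eq_iff, Fin.mk.injEq]
      · rw [h2 y hy]
        exact ⟨fun h => absurd h.2.1 hy, fun h => absurd h.2.1 hy⟩
    · rw [h2 x hx]
      exact ⟨fun h => absurd h.1 hx, fun h => absurd h.1 hx⟩
  ext i j
  simp only [tupGraph, h3]

lemma pr_tryTree_comap (A : Prog) {d e u b n : ℕ} (hn : n ≤ 2 ^ (d * u)) (G : SimpleGraph (Fin n))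
    (σ : Equiv.Perm (Fin n)) : (tryTree A d e u b (G.comap σ)).pr = (tryTree A d e u b G).pr := by
  have h : ∀ κ, (attemptTree A d e u b (G.comap σ) κ).pr = (attemptTree A d e u b G κ).pr := by
    intro κ
    simp only [pr_attemptTree, tupGraph_comap hn]
    exact Fintype.expect_equiv (Equiv.piCongrRight fun _ => Equiv.piCongrRight fun _ =>
      σ.viaFintypeEmbedding (Fin.castLEEmb hn)) _ _ fun τ => rfl
  have h1 := one_sub_pr_tryTree A d e u b (G.comap σ)
  simp only [h] at h1
  linarith [one_sub_pr_tryTree A d e u b G]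

/-- The self-tests plant their cliques on the first vertices only. Since random graphs and random
tuples are invariant under relabelling, the outcome applies to every clique of the same size. -/
lemma plantedPr_eq (A : Prog) {d e u b n : ℕ} (hn : n ≤ 2 ^ (d * u)) {C C' : Finset (Fin n)}
    (h : C.card = C'.card) : plantedPr A d e u b C = plantedPr A d e u b C' := by
  classical
  let σ : Equiv.Perm (Fin n) := (Finset.equivOfCardEq h).extendSubtype
  have hσ : ∀ x, σ x ∈ C' ↔ x ∈ C := fun x =>
    ⟨fun hx => by_contra fun hx' => (Finset.equivOfCardEq h).extendSubtype_not_mem x hx' hx,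
      fun hx => (Finset.equivOfCardEq h).extendSubtype_mem x hx⟩
  rw [plantedPr, plantedPr]
  symm
  refine Fintype.expect_equiv σ.symm.simpleGraph _ _ fun G => ?_
  rw [← pr_tryTree_comap A hn _ σ]
  congr 2
  ext x y
  simp [PlantedClique.cliqueOn, hσ, Equiv.simpleGraph]

end RAM

namespace RAM

open scoped BigOperators

/-! ### Completeness: graphs with a large clique have certificates -/

open Classical in
/-- With few exceptions, more than `κ` tuples lie in the set `C`. -/
lemma expect_few_tuples_le {N L M κ : ℕ} (hκ : κ ≤ N) (C : Finset (Fin M)) :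
    𝔼 τ : Fin N → Fin L → Fin M,
      (if ∃ S : Finset (Fin N), S.card = κ + 1 ∧ ∀ i ∈ S, ∀ a, τ i a ∈ C then (0 : ℝ) else 1) ≤
      (N : ℝ) ^ κ * (1 - (C.card / M : ℝ) ^ L) ^ (N - κ) := by
  -- If there are no families of tuples at all, the average is zero by convention, and the
  -- right-hand side only has to be nonnegative.
  rcases Nat.eq_zero_or_pos (Fintype.card (Fin N → Fin L → Fin M)) with h0 | h0
  · have := Fintype.card_eq_zero_iff.1 h0
    rw [Fintype.expect_eq_sum_div_card, Finset.univ_eq_empty, Finset.sum_empty, zero_div]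
    have hC : (C.card / M : ℝ) ≤ 1 := by
      refine div_le_one_of_le₀ ?_ (by positivity)
      exact_mod_cast (Finset.card_le_univ C).trans (by simp)
    have : (0 : ℝ) ≤ 1 - (C.card / M : ℝ) ^ L := sub_nonneg.2 (pow_le_one₀ (by positivity) hC)
    positivity
  let good : Finset (Fin L → Fin M) := Fintype.piFinset fun _ => C
  let B : Finset (Fin N) → Fin N → Finset (Fin L → Fin M) := fun S i =>
    if i ∈ S then Finset.univ else goodᶜ
  -- If at most `κ` tuples lie in `C`, some set `S` of exactly `κ` indices contains all of theirs,
  -- and every tuple outside `S` misses `good`: a union bound over `S`.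
  have h1 : ∀ τ : Fin N → Fin L → Fin M,
      (if ∃ S : Finset (Fin N), S.card = κ + 1 ∧ ∀ i ∈ S, ∀ a, τ i a ∈ C then (0 : ℝ) else 1) ≤
      ∑ S ∈ (Finset.univ : Finset (Fin N)).powersetCard κ, if ∀ i, τ i ∈ B S i then 1 else 0 := by
    intro τ
    rw [← ite_not]
    refine ite_le_sum _ (fun S => ∀ i, τ i ∈ B S i) fun h => ?_
    let F : Finset (Fin N) := Finset.univ.filter fun i => τ i ∈ good
    have hF : F.card ≤ κ := by
      by_contra hlt
      obtain ⟨S, hS, hS'⟩ := Finset.exists_subset_card_eq (show κ + 1 ≤ F.card by omega)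
      exact h ⟨S, hS', fun i hi a =>
        Fintype.mem_piFinset.1 (Finset.mem_filter.1 (hS hi)).2 a⟩
    obtain ⟨S, hFS, -, hS⟩ := Finset.exists_subsuperset_card_eq (Finset.subset_univ F) hF
      (by simpa using hκ)
    refine ⟨S, Finset.mem_powersetCard.2 ⟨Finset.subset_univ _, hS⟩, fun i => ?_⟩
    by_cases hi : i ∈ S
    · simp [B, hi]
    · simp only [B, hi, if_false, Finset.mem_compl]
      exact fun hg => hi (hFS (Finset.mem_filter.2 ⟨Finset.mem_univ i, hg⟩))
  refine (Finset.expect_le_expect fun τ _ => h1 τ).trans ?_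
  rw [Finset.expect_sum_comm]
  have h2 : ∀ S ∈ (Finset.univ : Finset (Fin N)).powersetCard κ,
      𝔼 τ : Fin N → Fin L → Fin M, (if ∀ i, τ i ∈ B S i then (1 : ℝ) else 0) ≤
        (1 - (C.card / M : ℝ) ^ L) ^ (N - κ) := by
    intro S hS
    have h3 := expect_pi (B S)
    refine le_of_eq (Eq.trans (by congr!) (h3.trans ?_))
    have h4 : ∀ i, ((B S i).card / Fintype.card (Fin L → Fin M) : ℝ) =
        if i ∈ S then 1 else 1 - (C.card / M : ℝ) ^ L := by
      intro i
      have h5 : (Fintype.card (Fin L → Fin M) : ℝ) ≠ 0 := by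
        have : Nonempty (Fin L → Fin M) :=
          (Fintype.card_pos_iff.1 h0).elim fun τ => ⟨τ i⟩
        exact_mod_cast Fintype.card_ne_zero
      by_cases hi : i ∈ S
      · simp only [B, hi, if_true, Finset.card_univ]
        exact div_self h5
      · simp only [B, hi, if_false, Finset.card_compl]
        rw [Nat.cast_sub (Finset.card_le_univ _), sub_div, div_self h5]
        simp [good, div_pow]
    rw [Finset.prod_congr rfl fun i _ => h4 i, Finset.prod_ite, Finset.prod_const_one, one_mul,
      Finset.prod_const]
    congr 1
    have := (Finset.mem_powersetCard.1 hS).2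
    rw [Finset.filter_not, Finset.card_sdiff]
    simp [this]
  refine (Finset.sum_le_sum h2).trans ?_
  rw [Finset.sum_const, Finset.card_powersetCard, Finset.card_univ, Fintype.card_fin, nsmul_eq_mul]
  have hC : (C.card / M : ℝ) ≤ 1 := by
    refine div_le_one_of_le₀ ?_ (by positivity)
    exact_mod_cast (Finset.card_le_univ C).trans (by simp)
  have : (0 : ℝ) ≤ 1 - (C.card / M : ℝ) ^ L := sub_nonneg.2 (pow_le_one₀ (by positivity) hC)
  gcongr
  exact_mod_cast Nat.choose_le_pow N κ

lemma sq_add_le_two_pow {z : ℕ} (hz : 8 ≤ z) : z ^ 2 + z + 9 ≤ 2 ^ z := by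
  induction z, hz using Nat.le_induction with
  | base => norm_num
  | succ z hz ih =>
    rw [pow_succ 2 z]
    nlinarith

/-- Put `z = 2dub`. The expected number of tuples inside the clique is at least `2^z`, whereas the
union bound costs only `N^κ ≤ 2^(z²)`. What remains is at most `exp(z² + κ - 2^z) ≤ exp(-9)`,
because `κ ≤ z` and `z ≥ 8`. -/
lemma few_tuples_term_le {d u b κ m : ℕ} (hd : 2 ≤ d) (hu : 0 < u) (hb : 2 ≤ b) (hκ : κ ≤ b)
    (hm : 2 ^ (2 * u) ≤ m) (hm' : m ≤ 2 ^ (d * u)) :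
    (numTuples d u b : ℝ) ^ κ * (1 - (m / (2 ^ (d * u) : ℕ) : ℝ) ^ (2 * d * b)) ^
      (numTuples d u b - κ) ≤ 1 / 10 := by
  set N := numTuples d u b with hN
  set p := (m / (2 ^ (d * u) : ℕ) : ℝ) ^ (2 * d * b) with hp
  have hp0 : 0 ≤ p := by positivity
  have hp1 : p ≤ 1 := by
    refine pow_le_one₀ (by positivity) (div_le_one_of_le₀ ?_ (by positivity))
    exact_mod_cast hm'
  obtain ⟨c, rfl⟩ : ∃ c, d = c + 2 := ⟨d - 2, by omega⟩
  have hpN : (2 : ℝ) ^ (2 * (c + 2) * (u * b)) ≤ p * N := by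
    have h1 : (1 / 2 : ℝ) ^ (c * u) ≤ m / (2 ^ ((c + 2) * u) : ℕ) := by
      rw [le_div_iff₀ (by positivity)]
      push_cast
      rw [add_mul, pow_add, ← mul_assoc, ← mul_pow]
      norm_num
      exact_mod_cast hm
    have h2 : ((1 / 2 : ℝ) ^ (c * u)) ^ (2 * (c + 2) * b) ≤ p := by
      rw [hp]
      gcongr
    calc (2 : ℝ) ^ (2 * (c + 2) * (u * b)) =
        ((1 / 2 : ℝ) ^ (c * u)) ^ (2 * (c + 2) * b) * N := by
          rw [hN, numTuples, ← pow_mul]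
          have h3 : (c + 2 - 1) * (2 * (c + 2)) * (u * b) =
              c * u * (2 * (c + 2) * b) + 2 * (c + 2) * (u * b) := by
            rw [show c + 2 - 1 = c + 1 by omega]
            ring
          rw [h3]
          push_cast
          rw [pow_add, ← mul_assoc (_ ^ _), ← mul_pow]
          norm_num
      _ ≤ p * N := by gcongr
  have hNle : (N : ℝ) ^ κ ≤ Real.exp ((2 * (c + 2) * (u * b) : ℕ) ^ 2) := by
    have h2 : (N : ℝ) ^ κ ≤ 2 ^ ((2 * (c + 2) * (u * b)) ^ 2) := by
      have h3 : N ^ κ ≤ 2 ^ ((2 * (c + 2) * (u * b)) ^ 2) := by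
        rw [hN, numTuples, ← pow_mul]
        refine Nat.pow_le_pow_right (by norm_num) ?_
        rw [show c + 2 - 1 = c + 1 by omega]
        have h4 : κ ≤ u * b := hκ.trans (Nat.le_mul_of_pos_left _ hu)
        calc (c + 1) * (2 * (c + 2)) * (u * b) * κ
            ≤ (2 * (c + 2)) * (2 * (c + 2)) * (u * b) * (u * b) := by
              gcongr
              omega
          _ = _ := by ring
      exact_mod_cast h3
    refine h2.trans ?_
    have h3 : (2 : ℝ) ≤ Real.exp 1 := by
      have := Real.add_one_le_exp (1 : ℝ)
      linarith
    calc (2 : ℝ) ^ ((2 * (c + 2) * (u * b)) ^ 2) ≤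
        Real.exp 1 ^ ((2 * (c + 2) * (u * b)) ^ 2) := by gcongr
      _ = _ := by
        rw [← Real.exp_nat_mul]
        push_cast
        ring_nf
  have hpow : (1 - p) ^ (N - κ) ≤ Real.exp (κ - p * N) := by
    calc (1 - p) ^ (N - κ) ≤ Real.exp (-p) ^ (N - κ) :=
          pow_le_pow_left₀ (sub_nonneg.2 hp1) (Real.one_sub_le_exp_neg p) _
      _ = Real.exp ((N - κ : ℕ) * -p) := by rw [← Real.exp_nat_mul]
      _ ≤ _ := by
        refine Real.exp_le_exp.2 ?_
        have h1 : (N : ℝ) - κ ≤ (N - κ : ℕ) := by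
          rw [sub_le_iff_le_add]
          exact_mod_cast (by omega : N ≤ N - κ + κ)
        nlinarith [(Nat.cast_nonneg κ : (0 : ℝ) ≤ κ)]
  calc (N : ℝ) ^ κ * (1 - p) ^ (N - κ)
      ≤ Real.exp ((2 * (c + 2) * (u * b) : ℕ) ^ 2) * Real.exp (κ - p * N) := by
        gcongr
    _ = Real.exp ((2 * (c + 2) * (u * b) : ℕ) ^ 2 + (κ - p * N)) := (Real.exp_add _ _).symm
    _ ≤ Real.exp (-9) := by
        refine Real.exp_le_exp.2 ?_
        have h0 : 2 ≤ u * b := hb.trans (Nat.le_mul_of_pos_left _ hu)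
        have h1 : 8 ≤ 2 * (c + 2) * (u * b) := by nlinarith
        have h2 := sq_add_le_two_pow h1
        have h3 : κ ≤ 2 * (c + 2) * (u * b) := by
          have : κ ≤ u * b := hκ.trans (Nat.le_mul_of_pos_left _ hu)
          exact this.trans (Nat.le_mul_of_pos_left _ (by omega))
        have h4 : (2 * (c + 2) * (u * b)) ^ 2 + κ + 9 ≤ 2 ^ (2 * (c + 2) * (u * b)) := by omega
        have h5 : (((2 * (c + 2) * (u * b)) ^ 2 + κ + 9 : ℕ) : ℝ) ≤
            ((2 ^ (2 * (c + 2) * (u * b)) : ℕ) : ℝ) := by exact_mod_cast h4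
        push_cast at h5 hpN ⊢
        linarith
    _ ≤ 1 / 10 := by
        have h9 := Real.add_one_le_exp (9 : ℝ)
        rw [Real.exp_neg, ← one_div]
        refine one_div_le_one_div_of_le (by norm_num) (by linarith)

open SmallestEdgeSubgraph

/-- Tuples inside a clique may share entries; for this reason equality counts as adjacency between
entries. -/
lemma exists_isNClique_tupGraph {n N L M κ : ℕ} {G : SimpleGraph (Fin n)} {C : Finset (Fin n)}
    (hC : G.IsClique C) {τ : Fin N → Fin L → Fin M} {S : Finset (Fin N)} (hS : S.card = κ)
    (hτ : ∀ i ∈ S, ∀ a, ∃ v ∈ C, (v : ℕ) = τ i a) :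
    (tupGraph G τ).IsNClique κ S := by
  refine ⟨fun i hi j hj hij => ⟨hij, fun a c => ?_⟩, hS⟩
  obtain ⟨v, hv, hv'⟩ := hτ i hi a
  obtain ⟨w, hw, hw'⟩ := hτ j hj c
  rw [← hv', ← hw']
  refine ⟨v.2, w.2, ?_⟩
  by_cases h : v = w
  · exact Or.inl (by rw [h])
  · exact Or.inr (hC hv hw h)

open Classical in
lemma two_mul_ncard_edgeSet_induce {N : ℕ} (H : SimpleGraph (Fin N)) (S : Finset (Fin N)) :
    2 * (H.induce (S : Set (Fin N))).edgeSet.ncard =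
      ∑ i : Fin N, ∑ j : Fin N, if i ∈ S ∧ j ∈ S ∧ H.Adj i j then 1 else 0 := by
  have h1 := (H.induce (S : Set (Fin N))).sum_degrees_eq_twice_card_edges
  rw [Set.ncard_eq_toFinset_card', ← SimpleGraph.edgeFinset, ← h1]
  simp only [← SimpleGraph.card_neighborFinset_eq_degree, SimpleGraph.neighborFinset_eq_filter,
    Finset.card_filter]
  have h2 : ∀ i : Fin N, (∑ j : Fin N, if i ∈ S ∧ j ∈ S ∧ H.Adj i j then 1 else 0) =
      if i ∈ S then ∑ j ∈ S, if H.Adj i j then 1 else 0 else 0 := by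
    intro i
    by_cases hi : i ∈ S
    · simp only [hi, true_and, if_true]
      rw [← Finset.sum_filter, ← Finset.sum_filter, ← Finset.filter_filter]
      congr 2
      ext; simp
    · simp [hi]
  simp only [h2]
  rw [← Finset.sum_filter, Finset.filter_mem_eq_inter, Finset.univ_inter,
    ← Finset.sum_coe_sort S]
  refine Finset.sum_congr rfl fun i _ => ?_
  rw [← Finset.sum_coe_sort S]
  rfl

lemma feasible_of_isNClique {N κ : ℕ} {H : SimpleGraph (Fin N)} {S : Finset (Fin N)}
    (h : H.IsNClique κ S) : Feasible H (κ.choose 2) S := by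
  classical
  rw [Feasible, SimpleGraph.induce_eq_top.2 h.1, Set.ncard_eq_toFinset_card',
    ← SimpleGraph.edgeFinset, SimpleGraph.card_edgeFinset_top_eq_card_choose_two]
  simp [h.2]

lemma opt_le_of_isNClique {N κ : ℕ} {H : SimpleGraph (Fin N)} {S : Finset (Fin N)}
    (h : H.IsNClique κ S) : opt H (κ.choose 2) ≤ κ :=
  Nat.sInf_le ⟨S, feasible_of_isNClique h, h.2⟩

lemma isPerfectInstance_of_isNClique {N κ : ℕ} {H : SimpleGraph (Fin N)} {S : Finset (Fin N)}
    (h : H.IsNClique (κ + 1) S) (hκ : 0 < κ) : IsPerfectInstance H ((κ + 1).choose 2) :=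
  ⟨choose_two_pos hκ, κ + 1, rfl, S, h⟩

/-- The clique alone supplies `k` edges. Hence an algorithm for all instances also covers the
perfect completeness case, and only the latter has to be refuted. -/
lemma IsPerfectInstance.isInstance {N k : ℕ} {H : SimpleGraph (Fin N)}
    (h : IsPerfectInstance H k) : IsInstance H k := by
  obtain ⟨h0, κ, rfl, C, hC⟩ := h
  refine ⟨h0, (feasible_of_isNClique hC).trans ?_⟩
  rw [← Nat.card_coe_set_eq, ← Nat.card_coe_set_eq]
  exact Nat.card_le_card_of_injective _
    (SimpleGraph.Embedding.induce (G := H) (C : Set (Fin N))).mapEdgeSet.injective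

open Classical in
/-- The clocked run rarely exhausts its budget. -/
lemma avg_exhausted_le (A : Prog) {N : ℕ} (H : SimpleGraph (Fin N)) (k : ℕ) {T t : ℕ} (hT : 0 < T)
    (ht : expectedTime A H k ≤ t) :
    ((interp A (inputMem H k, T)).avg fun y => if y.2 = 0 then 1 else 0) ≤ t / T := by
  -- Markov's inequality: a run that exhausts the budget takes at least `T` steps, or does not halt.
  have h1 : ∀ ω, ENNReal.ofReal (T * if ((interp A (inputMem H k, T)).eval ω).1.2 = 0 then 1 else 0) ≤
      runtime A (input H k ω) := by
    intro ω
    split_ifs with h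
    · rw [mul_one, ENNReal.ofReal_natCast]
      refine le_iInf fun t' => le_iInf fun s' => le_iInf fun hE => ?_
      by_contra hlt
      have hlt : t' < T := by exact_mod_cast not_le.1 hlt
      have h3 := hE.interp_eval T hlt
      rw [input_eq] at h3
      simp only at h3
      rw [h3] at h
      simp only at h
      omega
    · simp
  have h2 := (lintegral_mono h1).trans ht
  rw [Tree.lintegral_eval (interp A (inputMem H k, T)) (F := fun y => T * if y.2 = 0 then 1 else 0)
    (fun y => by split_ifs <;> positivity), ← ENNReal.ofReal_natCast t,
    ENNReal.ofReal_le_ofReal_iff (by positivity), Tree.avg_mul_left] at h2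
  rwa [le_div_iff₀ (by exact_mod_cast hT), mul_comm]

/-- A correct output within the budget is a certificate: the optimum is at most `κ + 1`, and `hg`
compares `|g(k)|(κ + 1)` with the permitted size. The loss `1/10` is the probability of an exhausted
budget, a tenth because `hT` makes the budget ten times the expected time. -/
lemma le_certPr {A : Prog} {g : ℕ → ℝ} {f : ℕ → ℕ} {q : Polynomial ℕ}
    (hA : Approximates A IsPerfectInstance g f q) {d e u b κ N : ℕ} {H : SimpleGraph (Fin N)}
    {S : Finset (Fin N)} (hS : H.IsNClique (κ + 1) S) (hκ : 0 < κ)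
    (hg : 4 * d ^ 2 * (u * (|g ((κ + 1).choose 2)| * (κ + 1))) ≤ ((κ + 1).choose 2 * b : ℕ))
    (hT : 10 * (f ((κ + 1).choose 2) * q.eval N) ≤ budget e u b) :
    2 / 3 - 1 / 10 ≤ certPr A d e u b κ H := by
  classical
  set k := (κ + 1).choose 2 with hk
  obtain ⟨h1, h2⟩ := hA N H k (isPerfectInstance_of_isNClique hS hκ)
  have hT0 : 0 < budget e u b := by
    rw [budget]
    positivity
  have h3 := avg_exhausted_le A H k hT0 h1
  have h4 : ((f k * q.eval N : ℕ) : ℝ) / budget e u b ≤ 1 / 10 := by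
    rw [div_le_div_iff₀ (by exact_mod_cast hT0) (by norm_num)]
    have : ((10 * (f k * q.eval N) : ℕ) : ℝ) ≤ (budget e u b : ℕ) := by exact_mod_cast hT
    push_cast at this ⊢
    linarith
  rw [certPr, ← hk]
  have h5 := Tree.coins_eval (interp A (inputMem H k, budget e u b))
    {y | Cert d u b k H (fun i => y.1 2 i)}
  have h6 := Tree.coins_eval (interp A (inputMem H k, budget e u b)) {y | y.2 = 0}
  simp only [Set.mem_ofPred_eq] at h5 h6
  replace h3 := h6.le.trans (le_of_eq_of_le (by congr!) h3)
  rw [← h5]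
  suffices h : {ω | ∃ S : Finset (Fin N), OutputsSet A H k ω S ∧ Feasible H k S ∧
      (S.card : ℝ) ≤ g k * (opt H k : ℝ)} ⊆
      {ω | Cert d u b k H fun i => ((interp A (inputMem H k, budget e u b)).eval ω).1.1 2 i} ∪
      {ω | ((interp A (inputMem H k, budget e u b)).eval ω).1.2 = 0} by
    have h7 := (measureReal_mono h (by finiteness)).trans (measureReal_union_le (μ := coins) _ _)
    linarith
  rintro ω ⟨S', ⟨t, s', hE, hout⟩, hfeas, hcard⟩
  by_cases hz : ((interp A (inputMem H k, budget e u b)).eval ω).1.2 = 0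
  · exact Or.inr hz
  left
  have hE' := exec_of_interp A (inputMem H k, budget e u b) ω (Nat.pos_of_ne_zero hz)
  rw [input_eq] at hE
  have hmem : ((interp A (inputMem H k, budget e u b)).eval ω).1.1 = s'.mem := by
    have := (hE'.det hE).2
    rw [← this]
  simp only [Set.mem_ofPred_eq, hmem]
  have hS' : ∀ i : Fin N, s'.mem 2 i ≠ 0 ↔ i ∈ S' := fun i => (hout i).symm
  simp only [Cert, hS']
  refine ⟨?_, ?_⟩
  · rw [Feasible] at hfeas
    have := two_mul_ncard_edgeSet_induce H S'
    convert (Nat.mul_le_mul_left 2 hfeas).trans this.le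
  · have h7 : (S'.card : ℝ) ≤ |g k| * (κ + 1) := by
      have h8 : (opt H k : ℝ) ≤ κ + 1 := by exact_mod_cast opt_le_of_isNClique hS
      calc (S'.card : ℝ) ≤ g k * opt H k := hcard
        _ ≤ |g k| * opt H k := by gcongr; exact le_abs_self _
        _ ≤ |g k| * (κ + 1) := by gcongr
    have h8 : (4 * d ^ 2 * (u * S'.card) : ℝ) ≤ (k * b : ℕ) := by
      refine le_trans ?_ hg
      gcongr
    have h9 : (∑ i : Fin N, if i ∈ S' then 1 else 0) = S'.card := by simp
    have h10 : 4 * d ^ 2 * (u * S'.card) ≤ k * b := by exact_mod_cast h8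
    rw [← h9] at h10
    convert h10

open Classical in
/-- Completeness: in a graph with a large clique, an attempt succeeds with constant probability. -/
lemma le_pr_attemptTree {A : Prog} {g : ℕ → ℝ} {f : ℕ → ℕ} {q : Polynomial ℕ}
    (hA : Approximates A IsPerfectInstance g f q) {d e u b κ n : ℕ} {G : SimpleGraph (Fin n)}
    {C : Finset (Fin n)} (hC : G.IsClique C) (hCm : 2 ^ (2 * u) ≤ C.card) (hn : n ≤ 2 ^ (d * u))
    (hd : 2 ≤ d) (hu : 0 < u) (hb : 2 ≤ b) (hκ : 0 < κ) (hκb : κ ≤ b)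
    (hg : 4 * d ^ 2 * (u * (|g ((κ + 1).choose 2)| * (κ + 1))) ≤ ((κ + 1).choose 2 * b : ℕ))
    (hT : 10 * (f ((κ + 1).choose 2) * q.eval (numTuples d u b)) ≤ budget e u b) :
    1 / 3 ≤ (attemptTree A d e u b G κ).pr := by
  let C' : Finset (Fin (2 ^ (d * u))) := C.map (Fin.castLEEmb hn)
  have hC' : C'.card = C.card := Finset.card_map _
  have hN : κ ≤ numTuples d u b := by
    refine hκb.trans ((Nat.lt_two_pow_self (n := b)).le.trans
      (Nat.pow_le_pow_right (by norm_num) ?_))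
    have h1 : 0 < (d - 1) * (2 * d) * u := by
      have : 0 < d - 1 := by omega
      positivity
    calc b ≤ (d - 1) * (2 * d) * u * b := Nat.le_mul_of_pos_left _ h1
      _ = _ := by ring
  have h1 := (expect_few_tuples_le (L := 2 * d * b) hN C').trans (few_tuples_term_le hd hu hb hκb
    (hC' ▸ hCm) ((Finset.card_le_univ C').trans (by simp)))
  rw [pr_attemptTree]
  -- Another `1/10` is lost if too few tuples lie in the clique, and `2/3 - 1/10 - 1/10` is still
  -- above `1/3`.
  have h2 : ∀ τ : Fin (numTuples d u b) → Fin (2 * d * b) → Fin (2 ^ (d * u)),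
      (2 / 3 - 1 / 10) - (if ∃ S : Finset (Fin (numTuples d u b)), S.card = κ + 1 ∧
        ∀ i ∈ S, ∀ a, τ i a ∈ C' then (0 : ℝ) else 1) ≤ certPr A d e u b κ (tupGraph G τ) := by
    intro τ
    split_ifs with h
    · obtain ⟨S, hS, hτ⟩ := h
      rw [sub_zero]
      refine le_certPr hA (exists_isNClique_tupGraph hC hS fun i hi a => ?_) hκ hg hT
      obtain ⟨v, hv, hv'⟩ := Finset.mem_map.1 (hτ i hi a)
      exact ⟨v, hv, by rw [← hv']; rfl⟩
    · have : 0 ≤ certPr A d e u b κ (tupGraph G τ) :=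
        Tree.avg_nonneg _ fun y => by split_ifs <;> norm_num
      linarith
  have h3 := Finset.expect_le_expect (s := Finset.univ) fun τ _ => h2 τ
  rw [Finset.expect_sub_distrib] at h3
  have : Nonempty (Fin (numTuples d u b) → Fin (2 * d * b) → Fin (2 ^ (d * u))) :=
    ⟨fun _ _ => ⟨0, by positivity⟩⟩
  rw [Fintype.expect_const] at h3
  linarith

lemma isClique_sup_cliqueOn {n : ℕ} (G : SimpleGraph (Fin n)) (C : Finset (Fin n)) :
    (G ⊔ PlantedClique.cliqueOn C).IsClique C :=
  fun _ hv _ hw hvw => Or.inr ⟨hvw, hv, hw⟩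

lemma card_firstVertices {n p : ℕ} (h : p ≤ n) : (firstVertices n p).card = p := by
  rw [firstVertices, Fin.card_filter_val_lt, min_eq_right h]

/-- The level passes its test, with few exceptions. -/
lemma one_sub_pr_testTree_le {A : Prog} {d e u b n : ℕ}
    (h : ∀ (G : SimpleGraph (Fin n)) (C : Finset (Fin n)), G.IsClique C → 2 ^ (2 * u) ≤ C.card →
      1 - (2 / 3) ^ n ≤ (tryTree A d e u b G).pr) :
    1 - (testTree A d e u b n (2 ^ (2 * u))).pr ≤ (n + 1) * n * (2 / 3) ^ n := by
  rw [pr_testTree]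
  have h1 : ∀ c ∈ Finset.range (n + 1 - 2 ^ (2 * u)), 1 - (2 / 3 : ℝ) ^ n ≤
      plantedPr A d e u b (firstVertices n (2 ^ (2 * u) + c)) := by
    intro c hc
    rw [Finset.mem_range] at hc
    refine Finset.le_expect Finset.univ_nonempty fun G _ =>
      h _ _ (isClique_sup_cliqueOn G _) ?_
    rw [card_firstVertices (by omega)]
    omega
  have h0 : (0 : ℝ) ≤ 1 - (2 / 3) ^ n := sub_nonneg.2 (pow_le_one₀ (by norm_num) (by norm_num))
  -- There are at most `(n + 1) * n` trials; Bernoulli's inequality turns the power into a linear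
  -- bound.
  have h2 : (1 - (2 / 3 : ℝ) ^ n) ^ ((n + 1) * n) ≤
      ∏ c ∈ Finset.range (n + 1 - 2 ^ (2 * u)),
        plantedPr A d e u b (firstVertices n (2 ^ (2 * u) + c)) ^ n := by
    calc (1 - (2 / 3 : ℝ) ^ n) ^ ((n + 1) * n)
        ≤ (1 - (2 / 3 : ℝ) ^ n) ^ ((n + 1 - 2 ^ (2 * u)) * n) :=
          pow_le_pow_of_le_one h0 (sub_le_self _ (by positivity))
            (Nat.mul_le_mul_right _ (Nat.sub_le _ _))
      _ = ∏ _c ∈ Finset.range (n + 1 - 2 ^ (2 * u)), (1 - (2 / 3 : ℝ) ^ n) ^ n := by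
          rw [Finset.prod_const, Finset.card_range, ← pow_mul, mul_comm]
      _ ≤ _ := Finset.prod_le_prod (fun _ _ => pow_nonneg h0 n)
          fun c hc => pow_le_pow_left₀ h0 (h1 c hc) n
  have h3 := one_add_mul_le_pow (a := -(2 / 3 : ℝ) ^ n)
    (by have : (2 / 3 : ℝ) ^ n ≤ 1 := pow_le_one₀ (by norm_num) (by norm_num)
        linarith) ((n + 1) * n)
  rw [← sub_eq_add_neg 1] at h3
  push_cast at h3
  linarith

/-- A bad level hardly ever passes its test. -/
lemma pr_testTree_le {A : Prog} {d e u b n q : ℕ} (hn : n ≤ 2 ^ (d * u)) {C : Finset (Fin n)}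
    (hC : q ≤ C.card) (h : plantedPr A d e u b C ≤ 9 / 10) :
    (testTree A d e u b n q).pr ≤ (9 / 10) ^ n := by
  have hCn : C.card ≤ n := (Finset.card_le_univ C).trans (by simp)
  -- The size of `C` is among the tested sizes, and its `n` trials alone make passing unlikely.
  have hmem : C.card - q ∈ Finset.range (n + 1 - q) := by
    rw [Finset.mem_range]
    omega
  rw [pr_testTree, ← Finset.mul_prod_erase _ _ hmem, Nat.add_sub_cancel' hC,
    plantedPr_eq A hn (card_firstVertices hCn)]
  have h1 : ∏ c ∈ (Finset.range (n + 1 - q)).erase (C.card - q),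
      plantedPr A d e u b (firstVertices n (q + c)) ^ n ≤ 1 :=
    Finset.prod_le_one (fun _ _ => pow_nonneg (plantedPr_nonneg _ _ _ _ _ _) _)
      fun _ _ => pow_le_one₀ (plantedPr_nonneg _ _ _ _ _ _) (plantedPr_le_one _ _ _ _ _ _)
  calc _ ≤ plantedPr A d e u b C ^ n * 1 :=
        mul_le_mul_of_nonneg_left h1 (pow_nonneg (plantedPr_nonneg _ _ _ _ _ _) _)
    _ ≤ _ := by
        rw [mul_one]
        exact pow_le_pow_left₀ (plantedPr_nonneg _ _ _ _ _ _) h n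

/-! ### Analysis of the search -/

/-- One round of the search. -/
noncomputable def searchStep (A : Prog) (d e u n q : ℕ) (x : ℕ × Bool) : Tree (ℕ × Bool) :=
  if x.2 then .leaf x else (testTree A d e u (x.1 + 1) n q).map fun ok => (x.1 + 1, ok)

lemma searchTree_eq (A : Prog) (d e u b₀ n q : ℕ) :
    searchTree A d e u b₀ n q = .down (fun _ => searchStep A d e u n q) u (b₀, false) := rfl

lemma down_searchStep_true (A : Prog) (d e u n q r b : ℕ) :
    Tree.down (fun _ => searchStep A d e u n q) r (b, true) = .leaf (b, true) := by
  induction r with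
  | zero => rfl
  | succ r ih => rw [Tree.down, searchStep, if_pos rfl, Tree.bind_leaf, ih]

lemma avg_down_searchStep (A : Prog) (d e u n q r b : ℕ) (F : ℕ × Bool → ℝ) :
    (Tree.down (fun _ => searchStep A d e u n q) (r + 1) (b, false)).avg F =
      (testTree A d e u (b + 1) n q).pr * F (b + 1, true) +
      (1 - (testTree A d e u (b + 1) n q).pr) *
        (Tree.down (fun _ => searchStep A d e u n q) r (b + 1, false)).avg F := by
  rw [Tree.down, searchStep, if_neg (by simp), Tree.avg_bind, Tree.avg_map, Tree.pr,
    ← Tree.avg_mul_right, ← Tree.pr, ← Tree.avg_false, ← Tree.avg_mul_right, ← Tree.avg_add]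
  congr 1
  funext x
  cases x
  · simp
  · simp [down_searchStep_true]

lemma all_searchTree (A : Prog) (d e u b₀ n q : ℕ) :
    (searchTree A d e u b₀ n q).All fun x => b₀ ≤ x.1 ∧ x.1 ≤ b₀ + u := by
  rw [searchTree_eq]
  suffices h : ∀ r (x : ℕ × Bool), (Tree.down (fun _ => searchStep A d e u n q) r x).All
      fun y => x.1 ≤ y.1 ∧ y.1 ≤ x.1 + r from h u (b₀, false)
  intro r
  induction r with
  | zero => exact fun x => ⟨le_rfl, le_rfl⟩
  | succ r ih =>
    intro x
    have hstep : (searchStep A d e u n q x).All fun y => x.1 ≤ y.1 ∧ y.1 ≤ x.1 + 1 := by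
      rw [searchStep]
      split_ifs
      · exact ⟨le_rfl, by omega⟩
      · have : ∀ c : Tree Bool, c.All fun _ => True := fun c => by
          induction c with
          | leaf a => trivial
          | flip k ih => exact fun b => ih b
        exact (this _).bind fun ok _ => ⟨by simp only; omega, by simp only; omega⟩
    exact hstep.bind fun y hy => (ih y).mono fun z hz => ⟨by omega, by omega⟩

open Classical in
-- A union bound over the at most `u` levels that are tested.
lemma avg_search_bad_le (A : Prog) {d e u b₀ n q : ℕ} {bad : ℕ → Prop} {η : ℝ} (hη : 0 ≤ η)
    (h : ∀ b, bad b → (testTree A d e u b n q).pr ≤ η) :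
    ((searchTree A d e u b₀ n q).avg fun x => if x.2 = true ∧ bad x.1 then 1 else 0) ≤ u * η := by
  rw [searchTree_eq]
  suffices h : ∀ r b, ((Tree.down (fun _ => searchStep A d e u n q) r (b, false)).avg fun x =>
      if x.2 = true ∧ bad x.1 then 1 else 0) ≤ r * η from h u b₀
  intro r
  induction r with
  | zero => simp [Tree.down]
  | succ r ih =>
    intro b
    rw [avg_down_searchStep]
    have h1 := Tree.pr_nonneg (testTree A d e u (b + 1) n q)
    have h2 := Tree.pr_le_one (testTree A d e u (b + 1) n q)
    have h3 := ih (b + 1)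
    have h4 : 0 ≤ (Tree.down (fun _ => searchStep A d e u n q) r (b + 1, false)).avg fun x =>
      if x.2 = true ∧ bad x.1 then 1 else 0 :=
      Tree.avg_nonneg _ fun x => by split_ifs <;> norm_num
    have h5 : (testTree A d e u (b + 1) n q).pr *
        (if (true = true) ∧ bad (b + 1) then 1 else 0) ≤ η := by
      by_cases hb : bad (b + 1)
      · simpa [hb] using h _ hb
      · simpa [hb] using hη
    push_cast
    nlinarith

open Classical in
-- The search can only go beyond the level `b`, or end there without success, if `b` was tested and
-- failed.
lemma avg_search_late_le (A : Prog) {d e u b₀ n q b : ℕ} (hb : b₀ < b) (hbu : b ≤ b₀ + u) :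
    ((searchTree A d e u b₀ n q).avg fun x => if x.2 = false ∨ b < x.1 then 1 else 0) ≤
      1 - (testTree A d e u b n q).pr := by
  rw [searchTree_eq]
  suffices h : ∀ r b', b' < b → b ≤ b' + r →
      ((Tree.down (fun _ => searchStep A d e u n q) r (b', false)).avg fun x =>
      if x.2 = false ∨ b < x.1 then 1 else 0) ≤ 1 - (testTree A d e u b n q).pr from h u b₀ hb hbu
  intro r
  induction r with
  | zero => intro b' h1 h2; omega
  | succ r ih =>
    intro b' h1 h2
    rw [avg_down_searchStep, if_neg (by simp; omega), mul_zero, zero_add]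
    have h3 := Tree.pr_nonneg (testTree A d e u (b' + 1) n q)
    have h4 := Tree.pr_le_one (testTree A d e u (b' + 1) n q)
    have h5 : 0 ≤ (Tree.down (fun _ => searchStep A d e u n q) r (b' + 1, false)).avg fun x =>
      if x.2 = false ∨ b < x.1 then 1 else 0 :=
      Tree.avg_nonneg _ fun x => by split_ifs <;> norm_num
    rcases eq_or_lt_of_le (Nat.succ_le_of_lt h1) with heq | hlt
    · rw [← heq]
      refine mul_le_of_le_one_right (by simpa using h4) ?_
      have := Tree.avg_mono (Tree.down (fun _ => searchStep A d e u n q) r (b' + 1, false))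
        (F := fun x => if x.2 = false ∨ b < x.1 then 1 else 0) (F' := fun _ => 1)
        fun x => by split_ifs <;> norm_num
      rw [Tree.avg_const] at this
      simpa [← heq] using this
    · refine le_trans (mul_le_of_le_one_left h5 (by linarith)) (ih (b' + 1) hlt (by omega))

end RAM

namespace RAM

open scoped BigOperators

/-! ### Acceptance probabilities -/

/-- The probability that the distinguisher accepts. -/
noncomputable def acceptPr (A : Prog) (d e b₀ : ℕ) {n : ℕ} (G : SimpleGraph (Fin n)) : ℝ :=
  ((distTree A d e b₀ G).map Prod.snd).pr

lemma acceptPr_eq (A : Prog) (d e b₀ : ℕ) {n : ℕ} (G : SimpleGraph (Fin n)) :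
    acceptPr A d e b₀ G =
      (searchTree A d e (Nat.clog (2 ^ d) n) b₀ n (2 ^ (2 * Nat.clog (2 ^ d) n))).avg fun x =>
        (tryTree A d e (Nat.clog (2 ^ d) n) x.1 G).pr := by
  rw [acceptPr, Tree.pr, Tree.avg_map, distTree, Tree.avg_bind]
  simp only [Tree.avg_map, Tree.pr]

lemma Tree.avg_expect {α : Type} {ι : Type*} [Fintype ι] (c : Tree α) (F : ι → α → ℝ) :
    𝔼 i, c.avg (F i) = c.avg fun a => 𝔼 i, F i a := by
  simp only [Fintype.expect_eq_sum_div_card, div_eq_mul_inv, Tree.avg_mul_right, Tree.avg_sum]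

lemma le_pow_clog {d : ℕ} (hd : 0 < d) (n : ℕ) : n ≤ 2 ^ (d * Nat.clog (2 ^ d) n) := by
  rw [pow_mul]
  exact Nat.le_pow_clog (Nat.one_lt_two_pow hd.ne') n

/-- If some level passes its test almost surely, then large planted cliques are recognized. -/
lemma le_expect_acceptPr (A : Prog) {d e b₀ n b : ℕ} (hd : 0 < d) (hb : b₀ < b)
    (hbu : b ≤ b₀ + Nat.clog (2 ^ d) n) {C : Finset (Fin n)}
    (hC : 2 ^ (2 * Nat.clog (2 ^ d) n) ≤ C.card) :
    9 / 10 * (1 - Nat.clog (2 ^ d) n * (9 / 10) ^ n -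
      (1 - (testTree A d e (Nat.clog (2 ^ d) n) b n (2 ^ (2 * Nat.clog (2 ^ d) n))).pr)) ≤
      𝔼 G, acceptPr A d e b₀ (G ⊔ PlantedClique.cliqueOn C) := by
  classical
  simp only [acceptPr_eq]
  set u := Nat.clog (2 ^ d) n
  rw [Tree.avg_expect]
  change _ ≤ (searchTree A d e u b₀ n (2 ^ (2 * u))).avg fun x => plantedPr A d e u x.1 C
  have h1 := avg_search_bad_le A (d := d) (e := e) (u := u) (b₀ := b₀) (n := n) (q := 2 ^ (2 * u))
    (bad := fun b => plantedPr A d e u b C ≤ 9 / 10) (η := (9 / 10) ^ n) (by positivity)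
    fun b hb => pr_testTree_le (le_pow_clog hd n) hC hb
  have h2 := avg_search_late_le A (d := d) (e := e) (n := n) (q := 2 ^ (2 * u)) hb hbu
  -- If the search ends with a level that passed its test and is not bad, the clique is recognized
  -- with probability above `9/10`; in the other cases the lower bound is at most zero.
  refine le_trans ?_ (Tree.avg_mono (searchTree A d e u b₀ n (2 ^ (2 * u)))
    (F := fun x => 9 / 10 * (1 - (if x.2 = true ∧ plantedPr A d e u x.1 C ≤ 9 / 10 then 1 else 0) -
      (if x.2 = false ∨ b < x.1 then 1 else 0))) fun x => ?_)
  · rw [Tree.avg_mul_left, Tree.avg_sub, Tree.avg_sub, Tree.avg_const]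
    gcongr
  · have h3 := plantedPr_nonneg A d e u x.1 C
    by_cases h4 : x.2 = false ∨ b < x.1
    · rw [if_pos h4]
      have : (0 : ℝ) ≤ if x.2 = true ∧ plantedPr A d e u x.1 C ≤ 9 / 10 then 1 else 0 := by
        split_ifs <;> norm_num
      linarith
    · rw [if_neg h4]
      split_ifs with h5
      · linarith
      · have h6 : x.2 = true := by
          by_contra h
          exact h4 (Or.inl (by simpa using h))
        have h7 : 9 / 10 < plantedPr A d e u x.1 C := not_le.1 fun h => h5 ⟨h6, h⟩
        linarith

/-- Soundness holds at every level where the search may end, whether its test was passed or not.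
These levels lie between `b₀` and `b₀ + u ≤ 2u`. The factor `n ≤ 2^(du)` uses up one of the four
factors `2^(-du)`. -/
lemma expect_acceptPr_le (A : Prog) {d e b₀ n w : ℕ} (hd : 0 < d) (hb₀ : 16 ≤ b₀)
    (hu : b₀ ≤ Nat.clog (2 ^ d) n) (hw : 2 * Nat.clog (2 ^ d) n ≤ 2 ^ w)
    (hwu : 12 * w ≤ Nat.clog (2 ^ d) n) :
    𝔼 G : SimpleGraph (Fin n), acceptPr A d e b₀ G ≤
      2 ^ (3 * w + 1) * (1 / 2) ^ (3 * (d * Nat.clog (2 ^ d) n)) := by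
  simp only [acceptPr_eq]
  have hn := le_pow_clog hd n
  set u := Nat.clog (2 ^ d) n
  rw [Tree.avg_expect, ← Tree.avg_const (searchTree A d e u b₀ n (2 ^ (2 * u)))
    (2 ^ (3 * w + 1) * (1 / 2) ^ (3 * (d * u)))]
  refine Tree.avg_mono_of_all (all_searchTree A d e u b₀ n (2 ^ (2 * u))) fun x hx => ?_
  refine (expect_tryTree_le A (w := w) hd (by omega) (by omega) (by omega) (by omega) hwu).trans ?_
  have h1 : (x.1 : ℝ) ≤ 2 ^ w := by exact_mod_cast (by omega : x.1 ≤ 2 ^ w)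
  have h2 : (n : ℝ) ≤ 2 ^ (d * u) := by exact_mod_cast hn
  calc (n : ℝ) * (x.1 * (2 * x.1 ^ 2 * (1 / 2) ^ (4 * u * d)))
      ≤ 2 ^ (d * u) * (2 ^ w * (2 * (2 ^ w) ^ 2 * (1 / 2) ^ (4 * u * d))) := by gcongr
    _ = _ := by
        rw [show 4 * u * d = d * u + 3 * (d * u) by ring, pow_add (1 / 2 : ℝ), one_div, inv_pow]
        field_simp
        ring

lemma accepts_iff (A : Prog) {d : ℕ} (hd : 0 < d) (e b₀ : ℕ) {n : ℕ} (G : SimpleGraph (Fin n))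
    (ω : ℕ → Bool) : Accepts (distinguisher A d e b₀) G ω ↔
      (((distTree A d e b₀ G).map Prod.snd).eval ω).1 ∈ ({true} : Set Bool) := by
  obtain ⟨t, m', hE, hm, -⟩ := impl_distinguisher A hd e b₀ G ω
  rw [Tree.eval_map, Set.mem_singleton_iff]
  have h0 : Bool.toNat ((distTree A d e b₀ G).eval ω).1.2 = 1 ↔
      ((distTree A d e b₀ G).eval ω).1.2 = true := by
    cases ((distTree A d e b₀ G).eval ω).1.2 <;> simp
  rw [← h0, ← hm]
  constructor
  · rintro ⟨t', s', hE', h⟩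
    rw [input_eq] at hE'
    have := (hE'.det hE).2
    subst this
    exact h
  · exact fun h => ⟨t, _, hE, h⟩

instance {n : ℕ} : MeasurableSingletonClass (SimpleGraph (Fin n)) where
  measurableSet_singleton G := by
    have h := SimpleGraph.measurable_edgeSet (measurableSet_singleton G.edgeSet)
    convert h using 1
    ext G'
    simp

/-- Tonelli's theorem. The accepting set is measurable because it is a union over finitely many
graphs of sets that are measurable in the coins. -/
lemma measureReal_accepts (A : Prog) {d : ℕ} (hd : 0 < d) (e b₀ : ℕ) {n : ℕ}
    (μ : Measure (SimpleGraph (Fin n))) [IsFiniteMeasure μ] :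
    (μ.prod coins).real {x | Accepts (distinguisher A d e b₀) x.1 x.2} =
      ∫ G, acceptPr A d e b₀ G ∂μ := by
  classical
  have h1 : ∀ G : SimpleGraph (Fin n), {ω | Accepts (distinguisher A d e b₀) G ω} =
      {ω | (((distTree A d e b₀ G).map Prod.snd).eval ω).1 ∈ ({true} : Set Bool)} := fun G =>
    Set.ext fun ω => accepts_iff A hd e b₀ G ω
  have h2 : ∀ G : SimpleGraph (Fin n),
      MeasurableSet {ω | Accepts (distinguisher A d e b₀) G ω} := fun G => by
    rw [h1]
    exact Tree.measurableSet_eval _ _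
  have h3 : ∀ G : SimpleGraph (Fin n),
      coins {ω | Accepts (distinguisher A d e b₀) G ω} =
        ENNReal.ofReal (acceptPr A d e b₀ G) := fun G => by
    rw [← ofReal_measureReal, h1, Tree.coins_eval, acceptPr, Tree.pr]
    simp
  have hmeas : MeasurableSet {x : SimpleGraph (Fin n) × (ℕ → Bool) |
      Accepts (distinguisher A d e b₀) x.1 x.2} := by
    have : {x : SimpleGraph (Fin n) × (ℕ → Bool) | Accepts (distinguisher A d e b₀) x.1 x.2} =
        ⋃ G : SimpleGraph (Fin n), {G} ×ˢ {ω | Accepts (distinguisher A d e b₀) G ω} := by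
      ext ⟨G, ω⟩
      simp
    rw [this]
    exact .iUnion fun G => (measurableSet_singleton G).prod (h2 G)
  rw [measureReal_def, Measure.prod_apply hmeas,
    integral_eq_lintegral_of_nonneg_ae (f := acceptPr A d e b₀)
      (ae_of_all _ fun G => Tree.pr_nonneg _) Integrable.of_finite.aestronglyMeasurable]
  congr 1
  exact lintegral_congr fun G => h3 G

instance (n : ℕ) : IsProbabilityMeasure (PlantedClique.gnHalf n) := by
  unfold PlantedClique.gnHalf
  infer_instance

/-- With edge probability `1/2` all graphs have the same mass `2^(-(n choose 2))`. -/
lemma integral_gnHalf {n : ℕ} (F : SimpleGraph (Fin n) → ℝ) :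
    ∫ G, F G ∂PlantedClique.gnHalf n = 𝔼 G, F G := by
  have h1 : ∀ G : SimpleGraph (Fin n),
      (PlantedClique.gnHalf n).real {G} = (1 / 2) ^ (n.choose 2) := by
    intro G
    have hle : G.edgeSet.ncard ≤ n.choose 2 := by
      classical
      rw [Set.ncard_eq_toFinset_card', ← SimpleGraph.edgeFinset]
      simpa using G.card_edgeFinset_le_card_choose_two
    have h : ((unitInterval.toNNReal (⟨1 / 2, by norm_num, by norm_num⟩ : unitInterval)) : ℝ) =
        1 / 2 := rfl
    have h' : ((unitInterval.toNNReal
        (unitInterval.symm ⟨1 / 2, by norm_num, by norm_num⟩ : unitInterval)) : ℝ) = 1 / 2 := by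
      change (1 : ℝ) - 1 / 2 = 1 / 2
      norm_num
    rw [measureReal_def, PlantedClique.gnHalf, SimpleGraph.binomialRandom_singleton,
      ENNReal.toReal_mul, ENNReal.toReal_pow, ENNReal.toReal_pow, ENNReal.coe_toReal,
      ENNReal.coe_toReal, h, h', ← pow_add]
    congr 1
    simp only [Nat.card_eq_fintype_card, Fintype.card_fin]
    omega
  have h2 : ∑ G : SimpleGraph (Fin n), (PlantedClique.gnHalf n).real {G} = 1 := by
    simp
  simp only [h1, Finset.sum_const, nsmul_eq_mul, Finset.card_univ] at h2
  rw [integral_fintype Integrable.of_finite, Fintype.expect_eq_sum_div_card, Finset.sum_div]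
  refine Finset.sum_congr rfl fun G _ => ?_
  rw [h1, smul_eq_mul, eq_div_iff (by positivity), mul_right_comm, mul_comm _ (Fintype.card _ : ℝ),
    h2, one_mul]

/-- It suffices to treat each clique position separately; `κ ≤ n` ensures that the uniform law on
the positions is a probability measure. -/
lemma le_integral_planted {n κ : ℕ} (hκ : κ ≤ n) (F : SimpleGraph (Fin n) → ℝ) (a : ℝ)
    (h : ∀ C : Finset (Fin n), C.card = κ → a ≤ 𝔼 G, F (G ⊔ PlantedClique.cliqueOn C)) :
    a ≤ ∫ G, F G ∂PlantedClique.planted n κ := by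
  have hne : {C : Finset (Fin n) | C.card = κ}.Nonempty :=
    ⟨firstVertices n κ, card_firstVertices hκ⟩
  have : IsProbabilityMeasure (uniformOn {C : Finset (Fin n) | C.card = κ}) :=
    isProbabilityMeasure_uniformOn (Set.toFinite _) hne
  rw [PlantedClique.planted, integral_map (measurable_of_countable _).aemeasurable
    Integrable.of_finite.aestronglyMeasurable, integral_prod_symm _ Integrable.of_finite]
  simp only [integral_gnHalf]
  have h1 : ∀ᵐ C ∂uniformOn {C : Finset (Fin n) | C.card = κ}, C.card = κ :=
    ae_cond_mem (Set.toFinite _).measurableSet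
  calc a = ∫ _C, a ∂uniformOn {C : Finset (Fin n) | C.card = κ} := by simp
    _ ≤ _ := integral_mono_ae (integrable_const _) Integrable.of_finite (h1.mono fun C hC => h C hC)

instance (n κ : ℕ) : IsFiniteMeasure (PlantedClique.planted n κ) := by
  unfold PlantedClique.planted uniformOn
  infer_instance

end RAM

/-! ### Running time of the distinguisher -/

namespace RAM

/-! ### Running time -/

/-- The expected bound for the running time of the distinguisher. -/
noncomputable def meanTime (A : Prog) (d e b₀ n : ℕ) : ℝ :=
  (searchTree A d e (Nat.clog (2 ^ d) n) b₀ n (2 ^ (2 * Nat.clog (2 ^ d) n))).avg fun x =>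
    (distTime A d e b₀ n x.1 : ℝ)

/-- The step bound depends on the coins only through the level where the search ends, and the search
does not look at `G`; so one mean value serves for all graphs. -/
lemma expectedTime_distinguisher_le (A : Prog) {d : ℕ} (hd : 0 < d) (e b₀ : ℕ) {n : ℕ}
    (G : SimpleGraph (Fin n)) :
    expectedTime (distinguisher A d e b₀) G 0 ≤ ENNReal.ofReal (meanTime A d e b₀ n) := by
  have h1 : meanTime A d e b₀ n =
      (distTree A d e b₀ G).avg fun x => (distTime A d e b₀ n x.1 : ℝ) := by
    rw [distTree, Tree.avg_bind, meanTime]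
    simp only [Tree.avg_map, Tree.avg_const]
  rw [h1, ← Tree.lintegral_eval _ fun x => by positivity]
  refine lintegral_mono fun ω => ?_
  obtain ⟨t, m', hE, -, ht⟩ := impl_distinguisher A hd e b₀ G ω
  have hle : runtime (distinguisher A d e b₀) (input G 0 ω) ≤ t :=
    iInf_le_of_le t (iInf_le_of_le _ (iInf_le_of_le hE le_rfl))
  refine hle.trans ?_
  rw [ENNReal.ofReal_natCast]
  exact_mod_cast ht

/-- `F` is bounded by a power of `X`. -/
def PowBounded {ι : Type} (X F : ι → ℕ) : Prop := ∃ c, ∀ i, F i ≤ X i ^ c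

namespace PowBounded

variable {ι : Type} {X F F' : ι → ℕ}

lemma mono (h : PowBounded X F') (hF : ∀ i, F i ≤ F' i) : PowBounded X F :=
  h.imp fun _ hc i => (hF i).trans (hc i)

lemma const (hX : ∀ i, 2 ≤ X i) (a : ℕ) : PowBounded X fun _ => a :=
  ⟨a, fun i => Nat.lt_two_pow_self.le.trans (Nat.pow_le_pow_left (hX i) a)⟩

lemma mul (h : PowBounded X F) (h' : PowBounded X F') : PowBounded X fun i => F i * F' i := by
  obtain ⟨c, hc⟩ := h
  obtain ⟨c', hc'⟩ := h'
  exact ⟨c + c', fun i => by rw [pow_add]; exact Nat.mul_le_mul (hc i) (hc' i)⟩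

lemma add (hX : ∀ i, 2 ≤ X i) (h : PowBounded X F) (h' : PowBounded X F') :
    PowBounded X fun i => F i + F' i := by
  obtain ⟨c, hc⟩ := h
  obtain ⟨c', hc'⟩ := h'
  refine ⟨c + c' + 1, fun i => ?_⟩
  have h1 : X i ^ c ≤ X i ^ (c + c') := Nat.pow_le_pow_right (by linarith [hX i]) (by omega)
  have h2 : X i ^ c' ≤ X i ^ (c + c') := Nat.pow_le_pow_right (by linarith [hX i]) (by omega)
  have h3 := Nat.mul_le_mul_left (X i ^ (c + c')) (hX i)
  rw [pow_succ]
  linarith [hc i, hc' i]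

lemma pow (h : PowBounded X F) (r : ℕ) : PowBounded X fun i => F i ^ r := by
  obtain ⟨c, hc⟩ := h
  exact ⟨c * r, fun i => by rw [pow_mul]; exact Nat.pow_le_pow_left (hc i) r⟩

end PowBounded

/-- Pairs of a number `n ≥ 2` of vertices and a level. -/
abbrev SizeLevel := {x : ℕ × ℕ // 2 ≤ x.1}

/-- The scale `2 ^ (u (b + 1))`. -/
def scale (d : ℕ) (x : SizeLevel) : ℕ := 2 ^ (Nat.clog (2 ^ d) x.1.1 * (x.1.2 + 1))

lemma clog_pos {d n : ℕ} (hd : 0 < d) (hn : 2 ≤ n) : 0 < Nat.clog (2 ^ d) n :=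
  Nat.clog_pos (Nat.one_lt_two_pow hd.ne') hn

lemma two_le_scale {d : ℕ} (hd : 0 < d) (x : SizeLevel) : 2 ≤ scale d x := by
  have h := clog_pos hd x.2
  calc 2 = 2 ^ 1 := rfl
    _ ≤ _ := Nat.pow_le_pow_right (by norm_num) (Nat.mul_pos h (Nat.succ_pos _))

/-- The bound is composed, by sums and products, of quantities that are at most powers of
`2^(u(b+1))`. With `b + 1` in place of `b` this scale dominates `n` even at `b = 0`, and by its
monotonicity the earlier levels cost no more than the last one. -/
lemma powBounded_distTime (A : Prog) {d : ℕ} (hd : 0 < d) (e b₀ : ℕ) :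
    PowBounded (scale d) fun x => distTime A d e b₀ x.1.1 x.1.2 := by
  have hX := two_le_scale hd
  have hn : PowBounded (scale d) fun x => x.1.1 := by
    refine ⟨d, fun x => (le_pow_clog hd x.1.1).trans ?_⟩
    rw [scale, ← pow_mul]
    refine Nat.pow_le_pow_right (by norm_num) ?_
    rw [mul_comm d]
    exact Nat.mul_le_mul_right _ (Nat.le_mul_of_pos_right _ (Nat.succ_pos _))
  have hu : PowBounded (scale d) fun x => Nat.clog (2 ^ d) x.1.1 := by
    refine ⟨1, fun x => Nat.lt_two_pow_self.le.trans ?_⟩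
    rw [pow_one]
    exact Nat.pow_le_pow_right (by norm_num) (Nat.le_mul_of_pos_right _ (Nat.succ_pos _))
  have hb : PowBounded (scale d) fun x => x.1.2 := by
    refine ⟨1, fun x => Nat.lt_two_pow_self.le.trans ?_⟩
    rw [pow_one]
    exact Nat.pow_le_pow_right (by norm_num)
      ((Nat.le_succ _).trans (Nat.le_mul_of_pos_left _ (clog_pos hd x.2)))
  have hE : ∀ a, PowBounded (scale d) fun x => 2 ^ (a * (Nat.clog (2 ^ d) x.1.1 * x.1.2)) := by
    refine fun a => ⟨a, fun x => ?_⟩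
    simp only [scale]
    rw [← pow_mul, mul_comm a]
    exact Nat.pow_le_pow_right (by norm_num)
      (Nat.mul_le_mul_right _ (Nat.mul_le_mul_left _ (Nat.le_succ _)))
  have hN : PowBounded (scale d) fun x => numTuples d (Nat.clog (2 ^ d) x.1.1) x.1.2 := hE _
  have hT : PowBounded (scale d) fun x => budget e (Nat.clog (2 ^ d) x.1.1) x.1.2 := hE _
  have hk : PowBounded (scale d) fun x => (x.1.2 + 1).choose 2 :=
    ((hb.add hX (.const hX 1)).pow 2).mono fun x => Nat.choose_le_pow _ _
  have k : ∀ a, PowBounded (scale d) fun _ => a := .const hX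
  have hatt : PowBounded (scale d) fun x =>
      attemptTime A d e (Nat.clog (2 ^ d) x.1.1) x.1.2 x.1.1 x.1.2 := by
    unfold attemptTime attemptSteps
    have hL : PowBounded (scale d) fun x => 2 * d * x.1.2 := (k _).mul hb
    refine .add hX (.add hX (.add hX (.add hX (.add hX ?_ ?_) ?_) ?_) ?_) ?_
    · exact .add hX ((k _).mul hb) (k _)
    · exact .add hX (.add hX ((k _).mul hN) (k _))
        ((hN.mul hL).mul (.add hX ((k _).mul ((k _).mul hu)) (k _)))
    · exact .add hX (k _) (hN.mul (.add hX (hN.mul (.add hX (.add hX ((k _).mul hN) (k _))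
        (hL.mul (.add hX (hL.mul (.add hX (.add hX ((k _).mul hN) ((k _).mul hn)) (k _))) (k _)))))
        (k _)))
    · exact .add hX (.add hX (.add hX (.add hX ((k _).mul hN) ((hN.mul hN).mul (k _))) (k _)) (k _))
        ((k _).mul (.add hX hT (k _)))
    · exact .add hX (hN.mul (k _)) (k _)
    · exact .add hX (.add hX (.add hX (.add hX (hN.mul (k _)) (k _))
        (hN.mul (.add hX (hN.mul (.add hX ((k _).mul hN) (k _))) (k _)))) ((k _).mul hk))
        ((k _).mul hu)
  have htry : PowBounded (scale d) fun x =>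
      tryTime A d e (Nat.clog (2 ^ d) x.1.1) x.1.2 x.1.1 := by
    unfold tryTime
    exact .add hX (k _) (hn.mul (.add hX (hb.mul (.add hX hatt (k _))) (k _)))
  have hlevel : PowBounded (scale d) fun x =>
      levelTime A d e (Nat.clog (2 ^ d) x.1.1) x.1.1 x.1.2 := by
    unfold levelTime computeTime testTime
    exact .add hX (.add hX (.add hX (.add hX ((k _).mul ((k _).mul (hu.mul hb)))
      ((k _).mul ((k _).mul (hu.mul hb)))) (k _))
      (.add hX (k _) ((hn.add hX (k _)).mul (.add hX (hn.mul (.add hX (.add hX (.add hX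
        ((k _).mul hn) (k _)) ((hn.mul hn).mul (k _))) htry)) (k _))))) (k _)
  have hsum : PowBounded (scale d) fun x =>
      ∑ i ∈ Finset.range (x.1.2 + 1), levelTime A d e (Nat.clog (2 ^ d) x.1.1) x.1.1 i := by
    obtain ⟨c, hc⟩ := hlevel
    refine PowBounded.mono (F' := fun x => (x.1.2 + 1) * scale d x ^ c)
      ((hb.add hX (k 1)).mul ⟨c, fun _ => le_rfl⟩) fun x => ?_
    refine (Finset.sum_le_card_nsmul _ _ (scale d x ^ c) fun i hi => ?_).trans (by simp)
    refine (hc ⟨(x.1.1, i), x.2⟩).trans (Nat.pow_le_pow_left ?_ c)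
    exact Nat.pow_le_pow_right (by norm_num) (Nat.mul_le_mul_left _ (Finset.mem_range.1 hi))
  unfold distTime prepareTime computeTime
  exact .add hX (.add hX (.add hX (.add hX (.add hX (.add hX (hn.mul (k _)) ((k _).mul hu)) (k _))
    (.add hX (.add hX ((k _).mul ((k _).mul (hu.mul (k _)))) ((k _).mul ((k _).mul (hu.mul (k _)))))
    (k _))) (.add hX (.add hX (hu.mul (k _)) (k _)) hsum)) htry) (k _)

lemma one_le_meanTime (A : Prog) (d e b₀ n : ℕ) : 1 ≤ meanTime A d e b₀ n := by
  rw [meanTime, ← Tree.avg_const (searchTree A d e (Nat.clog (2 ^ d) n) b₀ n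
    (2 ^ (2 * Nat.clog (2 ^ d) n))) 1]
  refine Tree.avg_mono _ fun x => ?_
  have : 1 ≤ distTime A d e b₀ n x.1 := by
    simp only [distTime]
    omega
  exact_mod_cast this

/-- The mean running time, if the level `b` passes its test almost surely. -/
lemma meanTime_le (A : Prog) {d e b₀ n b c : ℕ} (hn : 2 ≤ n)
    (hc : ∀ x, distTime A d e b₀ x.1.1 x.1.2 ≤ scale d x ^ c)
    (hb : b₀ < b) (hbu : b ≤ b₀ + Nat.clog (2 ^ d) n) :
    meanTime A d e b₀ n ≤ (2 : ℝ) ^ (Nat.clog (2 ^ d) n * (b + 1) * c) +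
      (1 - (testTree A d e (Nat.clog (2 ^ d) n) b n (2 ^ (2 * Nat.clog (2 ^ d) n))).pr) *
        2 ^ (Nat.clog (2 ^ d) n * (b₀ + Nat.clog (2 ^ d) n + 1) * c) := by
  classical
  have h2 := avg_search_late_le A (d := d) (e := e) (n := n)
    (q := 2 ^ (2 * Nat.clog (2 ^ d) n)) hb hbu
  set u := Nat.clog (2 ^ d) n
  have h1 : ∀ b' m, b' ≤ m → (distTime A d e b₀ n b' : ℝ) ≤ 2 ^ (u * (m + 1) * c) := by
    intro b' m hm
    have h3 : distTime A d e b₀ n b' ≤ 2 ^ (u * (m + 1) * c) := by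
      refine (hc ⟨(n, b'), hn⟩).trans ?_
      rw [scale, ← pow_mul]
      exact Nat.pow_le_pow_right (by norm_num)
        (Nat.mul_le_mul_right _ (Nat.mul_le_mul_left _ (by simpa using hm)))
    exact_mod_cast h3
  rw [meanTime]
  -- Ending at a level up to `b` costs at most the first term; ending later, at most at `b₀ + u`,
  -- adds at most the second.
  refine le_trans (Tree.avg_mono_of_all (all_searchTree A d e u b₀ n (2 ^ (2 * u)))
    (F' := fun x => 2 ^ (u * (b + 1) * c) + (if x.2 = false ∨ b < x.1 then 1 else 0) *
      2 ^ (u * (b₀ + u + 1) * c)) fun x hx => ?_) ?_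
  · split_ifs with h
    · have := h1 x.1 _ hx.2
      have h0 : (0 : ℝ) ≤ 2 ^ (u * (b + 1) * c) := by positivity
      linarith
    · have := h1 x.1 b (by
        by_contra hlt
        exact h (Or.inr (by omega)))
      linarith
  · rw [Tree.avg_add, Tree.avg_const, Tree.avg_mul_right]
    gcongr

end RAM

namespace RAM

open scoped BigOperators
open SmallestEdgeSubgraph

/-! ### Asymptotics -/

lemma tendsto_clog {d : ℕ} (hd : 0 < d) :
    Tendsto (fun n => Nat.clog (2 ^ d) n) atTop atTop := by
  refine tendsto_atTop.2 fun K => (eventually_gt_atTop (2 ^ (d * K))).mono fun n hn => ?_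
  by_contra hlt
  have h := le_pow_clog hd n
  have h2 : 2 ^ (d * Nat.clog (2 ^ d) n) ≤ 2 ^ (d * K) :=
    Nat.pow_le_pow_right (by norm_num) (Nat.mul_le_mul_left _ (by omega))
  omega

lemma pow_clog_sub_one_lt {d n : ℕ} (hd : 0 < d) (hn : 2 ≤ n) :
    2 ^ (d * (Nat.clog (2 ^ d) n - 1)) < n := by
  rw [pow_mul]
  exact Nat.pow_pred_clog_lt_self (Nat.one_lt_two_pow hd.ne') hn

lemma eval_le_mul_pow (q : Polynomial ℕ) {N : ℕ} (hN : 0 < N) :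
    q.eval N ≤ q.eval 1 * N ^ q.natDegree := by
  rw [Polynomial.eval_eq_sum_range, Polynomial.eval_eq_sum_range, Finset.sum_mul]
  refine Finset.sum_le_sum fun i hi => ?_
  rw [one_pow, mul_one]
  exact Nat.mul_le_mul_left _ (Nat.pow_le_pow_right hN (by
    rw [Finset.mem_range] at hi
    omega))

/-- The exponent of the budget. -/
def budgetExp (d : ℕ) (q : Polynomial ℕ) : ℕ := (d - 1) * (2 * d) * q.natDegree + 1

/-- In `budgetExp`, the multiple of the degree pays for the power of the number of tuples, and the
`+ 1` gives a factor `2^(ub) ≥ u`, which outgrows all constants. -/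
lemma mul_eval_le_budget (q : Polynomial ℕ) {d u b a : ℕ} (hb : 0 < b)
    (hu : 10 * (a * q.eval 1) ≤ u) :
    10 * (a * q.eval (numTuples d u b)) ≤ budget (budgetExp d q) u b := by
  have h1 := eval_le_mul_pow q (N := numTuples d u b) (by rw [numTuples]; positivity)
  have h2 : numTuples d u b ^ q.natDegree = 2 ^ ((d - 1) * (2 * d) * q.natDegree * (u * b)) := by
    rw [numTuples, ← pow_mul]
    congr 1
    ring
  have h3 : u ≤ 2 ^ (u * b) :=
    Nat.lt_two_pow_self.le.trans (Nat.pow_le_pow_right (by norm_num) (Nat.le_mul_of_pos_right _ hb))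
  calc 10 * (a * q.eval (numTuples d u b))
      ≤ 10 * (a * (q.eval 1 * numTuples d u b ^ q.natDegree)) := by gcongr
    _ = 10 * (a * q.eval 1) * numTuples d u b ^ q.natDegree := by ring
    _ ≤ 2 ^ (u * b) * numTuples d u b ^ q.natDegree := Nat.mul_le_mul_right _ (hu.trans h3)
    _ = budget (budgetExp d q) u b := by
      rw [h2, budget, budgetExp, ← pow_add]
      congr 1
      ring

/-- For `k = (κ+2 choose 2)` the root of `k` is at most `κ + 2`, so `|g(k)| ≤ √k/(2a)` gives
`a|g(k)| ≤ (κ+2)/2 ≤ κ + 1`. The size does not depend on `n`, so `f(k)` is a constant for the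
distinguisher. -/
lemma exists_clique_size {g : ℕ → ℝ} (hg : g =o[atTop] (fun k : ℕ => Real.sqrt k)) {a : ℝ}
    (ha : 0 < a) : ∃ κ : ℕ, a * |g ((κ + 1 + 1).choose 2)| ≤ κ + 1 := by
  have h1 := hg.def (c := 1 / (2 * a)) (by positivity)
  obtain ⟨K, hK⟩ := eventually_atTop.1 h1
  have h2 : K ≤ (K + 1 + 1).choose 2 := by
    rw [Nat.choose_succ_succ' (K + 1) 1, Nat.choose_one_right]
    omega
  have h3 := hK _ h2
  have h4 : Real.sqrt ((K + 1 + 1).choose 2 : ℕ) ≤ K + 2 := by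
    rw [Real.sqrt_le_left (by positivity)]
    have : (K + 1 + 1).choose 2 ≤ (K + 2) ^ 2 := Nat.choose_le_pow _ _
    exact_mod_cast this
  rw [Real.norm_eq_abs, Real.norm_eq_abs, abs_of_nonneg (Real.sqrt_nonneg _)] at h3
  refine ⟨K, ?_⟩
  calc a * |g ((K + 1 + 1).choose 2)| ≤ a * (1 / (2 * a) * (K + 2)) := by
        refine mul_le_mul_of_nonneg_left (h3.trans ?_) ha.le
        gcongr
    _ = (K + 2) / 2 := by
        field_simp
    _ ≤ K + 1 := by linarith [(Nat.cast_nonneg K : (0 : ℝ) ≤ K)]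

/-- The levels `u / D + 1` are good. -/
lemma eventually_le_pr_tryTree {A : Prog} {g : ℕ → ℝ} {f : ℕ → ℕ} {q : Polynomial ℕ}
    (hA : Approximates A IsPerfectInstance g f q)
    (hg : g =o[atTop] (fun k : ℕ => Real.sqrt k)) {d D : ℕ} (hd : 2 ≤ d) (hD : 0 < D) :
    ∀ᶠ n in atTop, ∀ (G : SimpleGraph (Fin n)) (C : Finset (Fin n)), G.IsClique C →
      2 ^ (2 * Nat.clog (2 ^ d) n) ≤ C.card → 1 - (2 / 3) ^ n ≤
        (tryTree A d (budgetExp d q) (Nat.clog (2 ^ d) n) (Nat.clog (2 ^ d) n / D + 1) G).pr := by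
  -- With `u ≤ Db` and clique size `κ + 2`, this constant gives `4d²u|g(k)|(κ+2) ≤ (κ+1)(κ+2)b/2 =
  -- kb`.
  obtain ⟨κ, hκ⟩ := exists_clique_size hg (a := 8 * D * d ^ 2) (by positivity)
  have hu := tendsto_clog (d := d) (by omega)
  filter_upwards [hu.eventually_ge_atTop (10 * (f ((κ + 1 + 1).choose 2) * q.eval 1)),
    hu.eventually_ge_atTop (D * (κ + 1))] with n h1 h2 G C hC hCm
  have hn := le_pow_clog (d := d) (by omega) n
  set u := Nat.clog (2 ^ d) n
  have hκu : κ + 1 ≤ u / D := (Nat.le_div_iff_mul_le hD).2 (by rwa [mul_comm] at h2)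
  have hDu : u < D * (u / D + 1) := Nat.lt_mul_div_succ u hD
  refine le_pr_tryTree A d _ u G (κ := κ) (by omega) (le_pr_attemptTree hA hC hCm hn hd
    (by by_contra h; rw [Nat.eq_zero_of_not_pos h] at hκu; simp at hκu) (by omega) (by omega)
    (by omega) ?_ (mul_eval_le_budget q (by omega) h1))
  set b := u / D + 1
  set k := (κ + 1 + 1).choose 2 with hk
  have hk2 : (k : ℝ) * 2 = (κ + 2) * (κ + 1) := by
    have : k * 2 = (κ + 2) * (κ + 1) := by
      rw [hk, Nat.choose_two_right]
      exact Nat.div_mul_cancel (Nat.even_mul_pred_self _).two_dvd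
    exact_mod_cast this
  have hub : (u : ℝ) ≤ D * b := by exact_mod_cast hDu.le
  push_cast
  calc 4 * (d : ℝ) ^ 2 * (u * (|g k| * (κ + 1 + 1)))
      ≤ 4 * (d : ℝ) ^ 2 * ((D * b) * (|g k| * (κ + 1 + 1))) := by gcongr
    _ = (8 * D * d ^ 2 * |g k|) * ((κ + 2) * b) / 2 := by ring
    _ ≤ (κ + 1) * ((κ + 2) * b) / 2 := by gcongr
    _ = k * b := by linear_combination (-(b : ℝ) / 2) * hk2

lemma tendsto_fail : Tendsto (fun n : ℕ => ((n : ℝ) + 1) * n * (2 / 3) ^ n) atTop (nhds 0) := by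
  have h1 := tendsto_pow_const_mul_const_pow_of_abs_lt_one 2 (r := (2 / 3 : ℝ))
    (by rw [abs_of_pos] <;> norm_num)
  have h2 := tendsto_pow_const_mul_const_pow_of_abs_lt_one 1 (r := (2 / 3 : ℝ))
    (by rw [abs_of_pos] <;> norm_num)
  have h3 := h1.add h2
  rw [add_zero] at h3
  exact h3.congr fun n => by ring

lemma tendsto_mul_pow : Tendsto (fun n : ℕ => (n : ℝ) * (9 / 10) ^ n) atTop (nhds 0) := by
  have h2 := tendsto_pow_const_mul_const_pow_of_abs_lt_one 1 (r := (9 / 10 : ℝ))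
    (by rw [abs_of_pos] <;> norm_num)
  exact h2.congr fun n => by ring

lemma clog_le_self {d n : ℕ} (hd : 0 < d) : Nat.clog (2 ^ d) n ≤ n := by
  refine Nat.clog_le_of_le_pow (Nat.lt_two_pow_self.le.trans ?_)
  rw [← pow_mul]
  exact Nat.pow_le_pow_right (by norm_num) (Nat.le_mul_of_pos_left _ hd)

/-- The planted cliques are larger than the tested ones. -/
lemma eventually_pow_clog_le {δ : ℝ} (hδ : 0 < δ) {d : ℕ} (hd : 4 / δ ≤ d) :
    ∀ᶠ n : ℕ in atTop, 2 ^ (2 * Nat.clog (2 ^ d) n) ≤ ⌈(n : ℝ) ^ δ⌉₊ := by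
  have hd0 : (0 : ℝ) < d := lt_of_lt_of_le (by positivity) hd
  have hd1 : 0 < d := by exact_mod_cast hd0
  have h1 : Tendsto (fun n : ℕ => (n : ℝ) ^ (δ / 2)) atTop atTop :=
    (tendsto_rpow_atTop (by positivity)).comp tendsto_natCast_atTop_atTop
  filter_upwards [h1.eventually_ge_atTop 4, eventually_ge_atTop 2] with n h4 hn
  have h2 := pow_clog_sub_one_lt hd1 hn
  have h3 := clog_pos hd1 hn
  set u := Nat.clog (2 ^ d) n
  have hn0 : (0 : ℝ) < n := by exact_mod_cast (by omega : 0 < n)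
  have hn1 : (1 : ℝ) ≤ n := by exact_mod_cast (by omega : 1 ≤ n)
  have h5 : (2 : ℝ) ^ (d * (u - 1)) ≤ n := by exact_mod_cast h2.le
  -- Here `2/d ≤ δ/2` is used; the other `n^(δ/2)` absorbs the factor `4` lost by rounding `u` up.
  have h6 : (2 : ℝ) ^ (2 * (u - 1)) ≤ (n : ℝ) ^ (δ / 2) := by
    calc (2 : ℝ) ^ (2 * (u - 1)) = ((2 : ℝ) ^ (d * (u - 1))) ^ (2 / d : ℝ) := by
          rw [← Real.rpow_natCast, ← Real.rpow_natCast, ← Real.rpow_mul (by norm_num)]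
          congr 1
          push_cast
          field_simp
      _ ≤ (n : ℝ) ^ (2 / d : ℝ) := Real.rpow_le_rpow (by positivity) h5 (by positivity)
      _ ≤ (n : ℝ) ^ (δ / 2) := by
          refine Real.rpow_le_rpow_of_exponent_le hn1 ?_
          rw [div_le_iff₀ hδ] at hd
          rw [div_le_div_iff₀ hd0 (by norm_num)]
          linarith
  have h7 : (2 : ℝ) ^ (2 * u) ≤ (n : ℝ) ^ δ := by
    calc (2 : ℝ) ^ (2 * u) = 4 * 2 ^ (2 * (u - 1)) := by
          rw [show 2 * u = 2 * (u - 1) + 2 by omega, pow_add]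
          ring_nf
      _ ≤ (n : ℝ) ^ (δ / 2) * (n : ℝ) ^ (δ / 2) := by gcongr
      _ = (n : ℝ) ^ δ := by
          rw [← Real.rpow_add hn0]
          congr 1
          ring
  have h8 : ((2 ^ (2 * u) : ℕ) : ℝ) ≤ (⌈(n : ℝ) ^ δ⌉₊ : ℕ) := by
    push_cast
    exact h7.trans (Nat.le_ceil _)
  exact_mod_cast h8

lemma mul_succ_le_two_pow {w : ℕ} (hw : 8 ≤ w) : 24 * (w + 1) ≤ 2 ^ w := by
  induction w, hw using Nat.le_induction with
  | base => norm_num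
  | succ w hw ih =>
    rw [pow_succ]
    omega

lemma eventually_expect_acceptPr_le (A : Prog) {d : ℕ} (hd : 0 < d) (e : ℕ) :
    ∀ᶠ n in atTop, 𝔼 G : SimpleGraph (Fin n), acceptPr A d e 16 G ≤ 1 / 3 := by
  filter_upwards [(tendsto_clog hd).eventually_ge_atTop 96] with n hu
  -- The parameter `w` is `⌊u/12⌋`: then `12w ≤ u`, and `2u ≤ 24(w+1) ≤ 2^w` as soon as `w ≥ 8`,
  -- that is `u ≥ 96`.
  have h8 : 8 ≤ Nat.clog (2 ^ d) n / 12 := by omega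
  have hw := mul_succ_le_two_pow h8
  refine (expect_acceptPr_le A (w := Nat.clog (2 ^ d) n / 12) hd le_rfl (by omega) (by omega)
    (by omega)).trans ?_
  set u := Nat.clog (2 ^ d) n
  have h1 : 3 * (u / 12) + 1 + 2 ≤ 3 * (d * u) := by
    have : u ≤ d * u := Nat.le_mul_of_pos_left _ hd
    omega
  calc (2 : ℝ) ^ (3 * (u / 12) + 1) * (1 / 2) ^ (3 * (d * u))
      ≤ 2 ^ (3 * (u / 12) + 1) * (1 / 2) ^ (3 * (u / 12) + 1 + 2) := by
        gcongr ?_ * ?_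
        exact pow_le_pow_of_le_one (by norm_num) (by norm_num) h1
    _ = 1 / 4 := by
        rw [pow_add (1 / 2 : ℝ) _ 2, ← mul_assoc, ← mul_pow]
        norm_num
    _ ≤ 1 / 3 := by norm_num

/-- For correctness it is enough that some level passes, so `D = 1` is used; larger `D` matter for
the running time only. Both error terms are eventually at most `1/100`. -/
lemma eventually_le_expect_acceptPr {A : Prog} {g : ℕ → ℝ} {f : ℕ → ℕ} {q : Polynomial ℕ}
    (hA : Approximates A IsPerfectInstance g f q)
    (hg : g =o[atTop] (fun k : ℕ => Real.sqrt k)) {d : ℕ} (hd : 2 ≤ d) :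
    ∀ᶠ n in atTop, ∀ C : Finset (Fin n), 2 ^ (2 * Nat.clog (2 ^ d) n) ≤ C.card →
      2 / 3 ≤ 𝔼 G, acceptPr A d (budgetExp d q) 16 (G ⊔ PlantedClique.cliqueOn C) := by
  filter_upwards [eventually_le_pr_tryTree hA hg hd one_pos,
    (tendsto_clog (d := d) (by omega)).eventually_ge_atTop 16,
    tendsto_fail.eventually_le_const (by norm_num : (0 : ℝ) < 1 / 100),
    tendsto_mul_pow.eventually_le_const (by norm_num : (0 : ℝ) < 1 / 100)] with n h1 h2 h3 h4 C hC
  have h5 := one_sub_pr_testTree_le h1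
  have h6 := le_expect_acceptPr A (e := budgetExp d q) (b₀ := 16)
    (b := Nat.clog (2 ^ d) n / 1 + 1) (by omega) (by omega) (by omega) hC
  have h7 : (Nat.clog (2 ^ d) n : ℝ) ≤ n := by exact_mod_cast clog_le_self (d := d) (by omega)
  have h8 : (Nat.clog (2 ^ d) n : ℝ) * (9 / 10) ^ n ≤ n * (9 / 10) ^ n := by gcongr
  linarith

/-- The exponent of the worst-case time is quadratic in `u`, while `n > 2^(d(u-1))` is exponential
in `u`. -/
lemma eventually_pow_sq_le {d : ℕ} (hd : 0 < d) (c : ℕ) :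
    ∀ᶠ n in atTop, 7 * (Nat.clog (2 ^ d) n * (16 + Nat.clog (2 ^ d) n + 1) * c + 1) ≤ n := by
  have h1 := tendsto_pow_const_div_const_pow_of_one_lt 2 (r := (2 : ℝ)) (by norm_num)
  have h2 := h1.eventually_le_const (u := (1 / (14 * (18 * (c : ℝ) + 1)) : ℝ)) (by positivity)
  filter_upwards [(tendsto_clog hd).eventually h2, (tendsto_clog hd).eventually_ge_atTop 1,
    eventually_ge_atTop 2] with n h3 h4 hn
  have h5 := pow_clog_sub_one_lt hd hn
  set u := Nat.clog (2 ^ d) n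
  have h6 : 14 * (18 * c + 1) * u ^ 2 ≤ 2 ^ u := by
    rw [div_le_div_iff₀ (by positivity) (by positivity)] at h3
    have : ((14 * (18 * c + 1) * u ^ 2 : ℕ) : ℝ) ≤ (2 ^ u : ℕ) := by
      push_cast
      linarith
    exact_mod_cast this
  have h7 : 2 ^ (u - 1) ≤ 2 ^ (d * (u - 1)) :=
    Nat.pow_le_pow_right (by norm_num) (Nat.le_mul_of_pos_left _ hd)
  have h8 : 2 ^ u = 2 * 2 ^ (u - 1) := by
    rw [← pow_succ', Nat.sub_add_cancel h4]
  have h9 : u * (16 + u + 1) * c + 1 ≤ (18 * c + 1) * u ^ 2 := by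
    have h10 : 16 + u + 1 ≤ 18 * u := by omega
    have h11 : u * (16 + u + 1) * c ≤ u * (18 * u) * c :=
      Nat.mul_le_mul_right _ (Nat.mul_le_mul_left _ h10)
    have h12 : 1 ≤ u ^ 2 := Nat.one_le_pow _ _ h4
    nlinarith
  nlinarith

/-- Split `2/3 ≤ (9/10)³`: two factors `(9/10)^n` beat the polynomial, and the third beats `2^m`,
since `2(9/10)^7 ≤ 1`. -/
lemma fail_mul_pow_le {n m : ℕ} (h : 7 * (m + 1) ≤ n) (hn : (n : ℝ) * (9 / 10) ^ n ≤ 1 / 100) :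
    ((n : ℝ) + 1) * n * (2 / 3) ^ n * 2 ^ m ≤ 1 := by
  have h1 : (9 / 10 : ℝ) ^ n * 2 ^ m ≤ 1 := by
    calc (9 / 10 : ℝ) ^ n * 2 ^ m ≤ (9 / 10) ^ (7 * m) * 2 ^ m := by
          gcongr ?_ * _
          exact pow_le_pow_of_le_one (by norm_num) (by norm_num) (by omega)
      _ = ((9 / 10) ^ 7 * 2) ^ m := by rw [pow_mul, mul_pow]
      _ ≤ 1 := pow_le_one₀ (by norm_num) (by norm_num)
  have h2 : (2 / 3 : ℝ) ^ n ≤ (9 / 10) ^ n * (9 / 10) ^ n * (9 / 10) ^ n := by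
    rw [← mul_pow, ← mul_pow]
    gcongr
    norm_num
  have hn1 : (1 : ℝ) ≤ n := by exact_mod_cast (by omega : 1 ≤ n)
  have h0 : (0 : ℝ) ≤ n * (9 / 10) ^ n := by positivity
  calc ((n : ℝ) + 1) * n * (2 / 3) ^ n * 2 ^ m
      ≤ (n + n) * n * ((9 / 10) ^ n * (9 / 10) ^ n * (9 / 10) ^ n) * 2 ^ m := by gcongr
    _ = 2 * (n * (9 / 10) ^ n) ^ 2 * ((9 / 10) ^ n * 2 ^ m) := by ring
    _ ≤ 2 * (1 / 100) ^ 2 * 1 := by gcongr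
    _ ≤ 1 := by norm_num

lemma clog_le_two_mul_log {d n : ℕ} (hd : 2 ≤ d) (hn : 1 ≤ Real.log n) (hn2 : 2 ≤ n) :
    (Nat.clog (2 ^ d) n : ℝ) ≤ 2 * Real.log n := by
  have h2 := pow_clog_sub_one_lt (d := d) (by omega) hn2
  set u := Nat.clog (2 ^ d) n
  have h3 : (2 : ℝ) ^ (2 * (u - 1)) ≤ n := by
    have : 2 ^ (2 * (u - 1)) ≤ n :=
      (Nat.pow_le_pow_right (by norm_num) (Nat.mul_le_mul_right _ hd)).trans h2.le
    exact_mod_cast this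
  have h4 := Real.log_le_log (by positivity) h3
  rw [Real.log_pow] at h4
  have h5 := Real.log_two_gt_d9
  have h6 : (u : ℝ) - 1 ≤ (u - 1 : ℕ) := by
    rw [sub_le_iff_le_add]
    exact_mod_cast (by omega : u ≤ u - 1 + 1)
  have h7 : (0 : ℝ) ≤ (u - 1 : ℕ) := by positivity
  push_cast at h4
  nlinarith

/-- The mean running time is `n ^ o(log n)`. -/
lemma isLittleO_log_meanTime {A : Prog} {g : ℕ → ℝ} {f : ℕ → ℕ} {q : Polynomial ℕ}
    (hA : Approximates A IsPerfectInstance g f q)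
    (hg : g =o[atTop] (fun k : ℕ => Real.sqrt k)) {d : ℕ} (hd : 2 ≤ d) :
    (fun n : ℕ => Real.log (meanTime A d (budgetExp d q) 16 n) / Real.log n) =o[atTop]
      fun n : ℕ => Real.log n := by
  have hd0 : 0 < d := by omega
  obtain ⟨c, hc⟩ := powBounded_distTime A hd0 (budgetExp d q) 16
  refine IsLittleO.of_bound fun ε hε => ?_
  -- This `D` keeps the leading term `cu²/D` of the logarithm below `(ε/8)u²`; the bound `K ≤ u`
  -- below does the same for the lower-order terms.
  obtain ⟨D, hD⟩ := exists_nat_gt (8 * c / ε)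
  have hD0 : 0 < D := by
    have : (0 : ℝ) < D := lt_of_le_of_lt (by positivity) hD
    exact_mod_cast this
  have hlog : Tendsto (fun n : ℕ => Real.log n) atTop atTop :=
    Real.tendsto_log_atTop.comp tendsto_natCast_atTop_atTop
  obtain ⟨K, hK⟩ := exists_nat_gt ((2 * c + 1) * 8 / ε)
  filter_upwards [eventually_le_pr_tryTree hA hg hd hD0,
    (tendsto_clog hd0).eventually_ge_atTop (16 * D), eventually_pow_sq_le hd0 c,
    (tendsto_clog hd0).eventually_ge_atTop K, (tendsto_clog hd0).eventually_ge_atTop 1,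
    tendsto_mul_pow.eventually_le_const (by norm_num : (0 : ℝ) < 1 / 100),
    eventually_ge_atTop 2, hlog.eventually_ge_atTop 1] with n h1 h2 h3 h4 h5 h6 h7 h8
  have h9 := one_sub_pr_testTree_le h1
  have hu := clog_le_two_mul_log hd h8 h7
  have h16 : 16 ≤ Nat.clog (2 ^ d) n / D := (Nat.le_div_iff_mul_le hD0).2 h2
  have h10 := meanTime_le A h7 hc (b := Nat.clog (2 ^ d) n / D + 1) (by omega)
    (by have := Nat.div_le_self (Nat.clog (2 ^ d) n) D; omega)
  have hE1 := one_le_meanTime A d (budgetExp d q) 16 n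
  set u := Nat.clog (2 ^ d) n
  set E := meanTime A d (budgetExp d q) 16 n
  have h11 : E ≤ 2 ^ (u * (u / D + 1 + 1) * c + 1) := by
    have h12 := fail_mul_pow_le h3 h6
    have h13 := mul_le_mul_of_nonneg_right h9
      (by positivity : (0 : ℝ) ≤ 2 ^ (u * (16 + u + 1) * c))
    have h14 : (1 : ℝ) ≤ 2 ^ (u * (u / D + 1 + 1) * c) := one_le_pow₀ (by norm_num)
    rw [pow_succ]
    linarith
  have h12 : Real.log E ≤ u * (u / D + 2) * c + 1 := by
    have h13 := Real.log_le_log (by linarith) h11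
    rw [Real.log_pow] at h13
    have h14 : Real.log 2 ≤ 1 := by linarith [Real.log_two_lt_d9]
    have h15 : ((u / D : ℕ) : ℝ) ≤ u / D := Nat.cast_div_le
    calc Real.log E ≤ ((u * (u / D + 1 + 1) * c + 1 : ℕ) : ℝ) * Real.log 2 := h13
      _ ≤ ((u * (u / D + 1 + 1) * c + 1 : ℕ) : ℝ) * 1 := by gcongr
      _ = u * ((u / D : ℕ) + 2) * c + 1 := by
          push_cast
          ring
      _ ≤ _ := by gcongr
  have hu1 : (1 : ℝ) ≤ u := by exact_mod_cast h5
  have h13 : (u : ℝ) * (u / D + 2) * c + 1 ≤ ε / 4 * u ^ 2 := by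
    have h14 : (c : ℝ) / D ≤ ε / 8 := by
      rw [div_lt_iff₀ hε] at hD
      rw [div_le_div_iff₀ (by exact_mod_cast hD0) (by norm_num)]
      linarith
    have h15 : (2 * (c : ℝ) + 1) ≤ ε / 8 * u := by
      have h16 : (K : ℝ) ≤ u := by exact_mod_cast h4
      rw [div_lt_iff₀ hε] at hK
      nlinarith
    calc (u : ℝ) * (u / D + 2) * c + 1 = c / D * u ^ 2 + 2 * c * u + 1 := by ring
      _ ≤ ε / 8 * u ^ 2 + (2 * c + 1) * u := by nlinarith
      _ ≤ ε / 8 * u ^ 2 + ε / 8 * u * u := by gcongr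
      _ = ε / 4 * u ^ 2 := by ring
  have hl0 : 0 ≤ Real.log E := Real.log_nonneg hE1
  rw [Real.norm_eq_abs, Real.norm_eq_abs, abs_of_nonneg (by positivity),
    abs_of_nonneg (by linarith), div_le_iff₀ (by linarith)]
  -- The bound `(ε/4)u²` becomes `ε(log n)²`.
  have h14 : (u : ℝ) ^ 2 ≤ (2 * Real.log n) ^ 2 := by gcongr
  nlinarith

/-- An approximation algorithm for the perfect completeness case breaks the hypothesis. -/
lemma not_approximates_isPerfectInstance (hSPCH : PlantedClique.SPCH) {g : ℕ → ℝ}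
    (hg : g =o[atTop] (fun k : ℕ => Real.sqrt k)) (f : ℕ → ℕ) (q : Polynomial ℕ) (A : Prog) :
    ¬ Approximates A IsPerfectInstance g f q := by
  intro hA
  obtain ⟨δ, hδ0, hδ, hno⟩ := hSPCH
  obtain ⟨d, hdδ⟩ := exists_nat_ge (4 / δ)
  have hd : 2 ≤ d := by
    rw [div_le_iff₀ hδ0] at hdδ
    by_contra hlt
    have : (d : ℝ) ≤ 1 := by exact_mod_cast (by omega : d ≤ 1)
    nlinarith
  -- The exponent is the logarithm of the mean time divided by `log n`, so `n ^ h n` equals the mean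
  -- time.
  refine hno ⟨distinguisher A d (budgetExp d q) 16, _, isLittleO_log_meanTime hA hg hd, ?_⟩
  filter_upwards [eventually_expect_acceptPr_le A (d := d) (by omega) (budgetExp d q),
    eventually_le_expect_acceptPr hA hg hd, eventually_pow_clog_le hδ0 hdδ,
    eventually_ge_atTop 2] with n h1 h2 h3 hn
  have hn1 : (1 : ℝ) < n := by exact_mod_cast hn
  refine ⟨fun G => (expectedTime_distinguisher_le A (by omega) _ _ G).trans (le_of_eq ?_), ?_, ?_⟩
  · rw [Real.rpow_def_of_pos (by linarith), mul_div_cancel₀ _ (Real.log_pos hn1).ne',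
      Real.exp_log (by linarith [one_le_meanTime A d (budgetExp d q) 16 n])]
  · rw [measureReal_accepts A (by omega)]
    refine le_integral_planted ?_ _ _ fun C hC => h2 C (h3.trans hC.ge)
    refine Nat.ceil_le.2 ?_
    calc (n : ℝ) ^ δ ≤ (n : ℝ) ^ (1 : ℝ) :=
          Real.rpow_le_rpow_of_exponent_le hn1.le (by linarith)
      _ = n := Real.rpow_one _
  · rw [measureReal_accepts A (by omega), integral_gnHalf]
    exact h1

end RAM

theorem mainTheorem7 (hSPCH : PlantedClique.SPCH) (g : ℕ → ℝ)
    (hg : g =o[atTop] (fun k : ℕ => Real.sqrt k)) (f : ℕ → ℕ) (q : Polynomial ℕ) :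
    (¬ ∃ A : RAM.Prog, SmallestEdgeSubgraph.Approximates A
        SmallestEdgeSubgraph.IsInstance g f q) ∧
    (¬ ∃ A : RAM.Prog, SmallestEdgeSubgraph.Approximates A
        SmallestEdgeSubgraph.IsPerfectInstance g f q) := by
  have h : ∀ A : RAM.Prog, ¬ SmallestEdgeSubgraph.Approximates A
      SmallestEdgeSubgraph.IsPerfectInstance g f q :=
    RAM.not_approximates_isPerfectInstance hSPCH hg f q
  refine ⟨fun ⟨A, hA⟩ => h A fun n G k hP => hA n G k ?_, fun ⟨A, hA⟩ => h A hA⟩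
  exact RAM.IsPerfectInstance.isInstance hP
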